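/- **Setting.** Let $d\ge 1$, let $\mathcal X=\{x\in\mathbb R^d:\|x\|_2\le 1\}$, and let $\rho$ be a Borel probability measure on $\mathbb R^d\times[-1,1]$ whose marginal $\rho_{\mathcal X}$ on $\mathbb R^d$ has support exactly $\mathcal X$ (it is supported on $\mathcal X$ and non-degenerate). Let $g_\rho(x)=\int y\,d\rho(y|x)$ be the regression function and $\|\cdot\|_\rho$ the norm of $L^2(\rho_{\mathcal X})$. Let $\gamma\in[0,1]$, and let $\sigma:\mathbb R\to\mathbb R$ be twice differentiable with $|\sigma'|\le C_\sigma$, $|\sigma''|\le C_\sigma$ and $|\sigma(u)|\le 1+|u|$ for all $u$, where $C_\sigma>0$; put $\kappa=\sqrt{4+2C_\sigma^2}$. For an even width $M$ and parameters $\Theta=(a_r,b_r,c_r)_{r=1}^M$ with $a_r,c_r\in\mathbb R$, $b_r\in\mathbb R^d$, let $g_\Theta(x)=M^{-1/2}\sum_{r=1}^M a_r\,\sigma(b_r^\top x+\gamma c_r)$. Initialize $\Theta^{(0)}$ symmetrically: $a_r^{(0)}=1$ and $a^{(0)}_{r+M/2}=-1$ for $r\le M/2$; $b_r^{(0)}=b_{r+M/2}^{(0)}$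 for $r\le M/2$, with $b_1^{(0)},\dots,b_{M/2}^{(0)}$ i.i.d. uniform on the unit sphere $\mathbb S^{d-1}$; and $c_r^{(0)}=0$ for all $r$. Given $\lambda>0$, $\eta>0$ and $\theta\in(1/2,1)$, draw i.i.d. samples $z_t=(x_t,y_t)\sim\rho$, put $\Theta^{(1)}=\Theta^{(0)}$ and $\eta_t=\eta t^{-\theta}$, and iterate for $t=1,\dots,T$ $$\Theta^{(t+1)}=\Theta^{(t)}-\eta_t\bigl(g_{\Theta^{(t)}}(x_t)-y_t\bigr)\nabla_\Theta g_\Theta(x_t)\big|_{\Theta=\Theta^{(t)}}-\eta_t\lambda\bigl(\Theta^{(t)}-\Theta^{(0)}\bigr).$$ Let $$k_\infty(x,x')=\mathbb E_b[\sigma(b^\top x)\sigma(b^\top x')]+(x^\top x'+\gamma^2)\,\mathbb E_b[\sigma'(b^\top x)\sigma'(b^\top x')],\qquad b\ \text{uniform on}\ \mathbb S^{d-1},$$ and let $L_\infty f=\int f(x)k_\infty(x,\cdot)\,d\rho_{\mathcal X}(x)$ on $L^2(\rho_{\mathcal X})$. Let $(\mu_k,\phi_k)_{k\ge1}$ be an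 orthonormal eigensystem of $L_\infty$ that is complete up to $\ker L_\infty$, with $\mu_1\ge\mu_2\ge\dots$ counted with multiplicity, and let $L_\infty^r h=\sum_k\mu_k^r\langle\phi_k,h\rangle\phi_k$. Assume that $g_\rho\in L_\infty^r(L^2(\rho_{\mathcal X}))$ for some $\tfrac12<r\le1$, and that for some $\beta>1$ and $b,c>0$ one has $b\,i^{-\beta}\le\mu_i\le c\,i^{-\beta}$ for all $i\ge1$. **Corollary 1.** Let $\theta=\frac{2r}{2r+1}$ and let $\eta>0$. (a) If $r<1-\frac1{2\beta}$, then there is a constant $C>0$, which does not depend on $T$, $M$ or $\delta$, such that the following holds. Let $T\ge1$ be an integer, put $\lambda=T^{-\frac1{2r+1}}$, and suppose that $$\eta<\left(\lambda+\frac{208(1+\kappa)^4}{(1-2^{\theta-1})(2\theta-1)}\Bigl(\log\frac8{1-\theta}+\frac1{1-\theta}\Bigr)\right)^{-1}.\tag{1}$$ Then for every even $M\ge T^{1+\frac5{2r+1}}=T^{\frac{2r+6}{2r+1}}$ and every $\delta\in(0,1)$, with probability at least $1-\delta$ over the random choice of $\Theta^{(0)}$, $$\mathbb E_{z_1,\dots,z_T}\bigl[\|g_{\Theta^{(T+1)}}-g_\rho\|_\rho^2\bigr]\le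 C\,T^{-\frac{2r}{2r+1}}\log\frac2\delta .$$ (b) If $r\ge1-\frac1{2\beta}$, then for every $0<\epsilon<\frac{2r}{2r+1}$ there is a constant $C>0$, which does not depend on $T$, $M$ or $\delta$, such that the following holds. Let $T\ge1$ be an integer, put $\lambda=T^{-\frac1{2r+1}+\frac{\epsilon}{2r}}$, and suppose that (1) holds. Then for every even $M\ge T^{1+\frac5{2r+1}}$ and every $\delta\in(0,1)$, with probability at least $1-\delta$ over the random choice of $\Theta^{(0)}$, $$\mathbb E_{z_1,\dots,z_T}\bigl[\|g_{\Theta^{(T+1)}}-g_\rho\|_\rho^2\bigr]\le C\,T^{-\frac{2r}{2r+1}+\epsilon}\log\frac2\delta .$$ -/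

import Mathlib

open MeasureTheory ProbabilityTheory

noncomputable section

namespace TwoLayerSGD

/-- The input space `ℝᵈ` with its Euclidean norm. -/
abbrev Inp (d : ℕ) : Type := EuclideanSpace ℝ (Fin d)

/-- The activation `σ` is twice differentiable, `‖σ'‖_∞ ≤ C`, `‖σ''‖_∞ ≤ C` and
`|σ u| ≤ 1 + |u|`. -/
structure IsActivation (σ : ℝ → ℝ) (C : ℝ) : Prop where
  pos : 0 < C
  diff : Differentiable ℝ σ
  diff_deriv : Differentiable ℝ (deriv σ)
  deriv_le : ∀ u, |deriv σ u| ≤ C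
  deriv_deriv_le : ∀ u, |deriv (deriv σ) u| ≤ C
  growth : ∀ u, |σ u| ≤ 1 + |u|

/-- The uniform distribution on the unit sphere of `ℝᵈ` (for `d ≥ 1`): the normalized surface
measure, as a measure on `ℝᵈ`. -/
def sphereUniform (d : ℕ) : Measure (Inp d) :=
  (((volume : Measure (Inp d)).toSphere Set.univ)⁻¹ • (volume : Measure (Inp d)).toSphere).map
    Subtype.val

/-- The neurons of a network of even width `M = 2 m`: `Sum.inl r` is neuron `r` of the first half
and `Sum.inr r` is neuron `r + M / 2`. -/
abbrev Neuron (m : ℕ) : Type := Fin m ⊕ Fin m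

/-- Parameters `Θ = (a, B, c)` of a network of width `2 m`. -/
structure Params (d m : ℕ) where
  a : Neuron m → ℝ
  b : Neuron m → Inp d
  c : Neuron m → ℝ

/-- `g_Θ(x) = M^{-1/2} ∑_r a_r σ(b_rᵀ x + γ c_r)` with `M = 2 m`. -/
def network {d m : ℕ} (σ : ℝ → ℝ) (γ : ℝ) (Θ : Params d m) (x : Inp d) : ℝ :=
  (Real.sqrt (2 * m : ℝ))⁻¹ * ∑ r, Θ.a r * σ (inner ℝ (Θ.b r) x + γ * Θ.c r)

/-- Symmetric initialization from the vectors `w₁, …, w_{M/2}`. -/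
def initParams {d m : ℕ} (R : ℝ) (w : Fin m → Inp d) : Params d m where
  a := Sum.elim (fun _ => R) (fun _ => -R)
  b := Sum.elim w w
  c := fun _ => 0

/-- One step of regularized stochastic gradient descent with step size `s`, regularization
parameter `lam`, initial parameters `Θ₀` and sample `z = (x, y)`. -/
def sgdStep {d m : ℕ} (σ : ℝ → ℝ) (γ lam s : ℝ) (Θ₀ Θ : Params d m) (z : Inp d × ℝ) :
    Params d m where
  a := fun r => Θ₀.a r + ((1 - s * lam) * (Θ.a r - Θ₀.a r)
    - s * (Real.sqrt (2 * m : ℝ))⁻¹ * (network σ γ Θ z.1 - z.2)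
        * σ (inner ℝ (Θ.b r) z.1 + γ * Θ.c r))
  b := fun r => Θ₀.b r + ((1 - s * lam) • (Θ.b r - Θ₀.b r)
    - (s * (Real.sqrt (2 * m : ℝ))⁻¹ * (network σ γ Θ z.1 - z.2)
        * (Θ.a r * deriv σ (inner ℝ (Θ.b r) z.1 + γ * Θ.c r))) • z.1)
  c := fun r => Θ₀.c r + ((1 - s * lam) * (Θ.c r - Θ₀.c r)
    - s * (Real.sqrt (2 * m : ℝ))⁻¹ * (network σ γ Θ z.1 - z.2)
        * (Θ.a r * γ * deriv σ (inner ℝ (Θ.b r) z.1 + γ * Θ.c r)))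

/-- `sgd … T z` is the iterate `Θ^{(T+1)}` after the `T` samples `z = (z₁, …, z_T)`, started at
`Θ^{(1)} = Θ₀`, with step sizes `η_t = η t^{-θ}`. -/
def sgd {d m : ℕ} (σ : ℝ → ℝ) (γ lam η θ : ℝ) (Θ₀ : Params d m) :
    (T : ℕ) → (Fin T → Inp d × ℝ) → Params d m
  | 0, _ => Θ₀
  | T + 1, z =>
      sgdStep σ γ lam (η * ((T + 1 : ℕ) : ℝ) ^ (-θ)) Θ₀
        (sgd σ γ lam η θ Θ₀ T (fun i => z i.castSucc)) (z (Fin.last T))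

/-- The regression function `g_ρ(x) = ∫ y dρ(y|x)`. -/
def regression {d : ℕ} (ρ : Measure (Inp d × ℝ)) [IsFiniteMeasure ρ] (x : Inp d) : ℝ :=
  ∫ y, y ∂(ρ.condKernel x)

/-- The squared distance `‖g - g_ρ‖²` in `L²(ρ_X)`, that is, the excess risk of `g`. -/
def excessRisk {d : ℕ} (ρ : Measure (Inp d × ℝ)) [IsFiniteMeasure ρ] (g : Inp d → ℝ) : ENNReal :=
  eLpNorm (fun x => g x - regression ρ x) 2 ρ.fst ^ 2

/-- The expectation over `z₁, …, z_T ∼ ρ` (i.i.d.) of the excess risk of the last iterate, for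
the initialization given by `w`. -/
def expectedExcessRisk {d m : ℕ} (σ : ℝ → ℝ) (γ R lam η θ : ℝ)
    (ρ : Measure (Inp d × ℝ)) [IsFiniteMeasure ρ] (T : ℕ) (w : Fin m → Inp d) : ENNReal :=
  ∫⁻ z, excessRisk ρ (network σ γ (sgd σ γ lam η θ (initParams R w) T z))
    ∂(Measure.pi fun _ : Fin T => ρ)

/-- The law of the random vectors used for initialization: i.i.d. uniform on the sphere. -/
def initLaw (d m : ℕ) : Measure (Fin m → Inp d) :=
  Measure.pi fun _ : Fin m => sphereUniform d

/-- The neural tangent kernel `k_∞`. -/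
def ntk {d : ℕ} (σ : ℝ → ℝ) (R γ : ℝ) (x x' : Inp d) : ℝ :=
  (∫ b, σ (inner ℝ b x) * σ (inner ℝ b x') ∂(sphereUniform d))
    + R ^ 2 * (inner ℝ x x' + γ ^ 2)
      * ∫ b, deriv σ (inner ℝ b x) * deriv σ (inner ℝ b x') ∂(sphereUniform d)

/-- The integral operator of the kernel `k` and the measure `ν`. -/
def integralOp {d : ℕ} (k : Inp d → Inp d → ℝ) (ν : Measure (Inp d)) (f : Inp d → ℝ) :
    Inp d → ℝ :=
  fun x' => ∫ x, f x * k x x' ∂ν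

/-- `(μ_k, φ_k)` is an orthonormal eigensystem in `L²(ν)` of the integral operator `L` of the
kernel `k`: the eigenvalues are listed with multiplicity in non-ascending order, and the
eigenfunctions are complete up to the kernel of `L`. The index `k : ℕ` stands for `k + 1`. -/
structure IsEigensystem {d : ℕ} (k : Inp d → Inp d → ℝ) (ν : Measure (Inp d))
    (μ : ℕ → ℝ) (φ : ℕ → Lp ℝ 2 ν) : Prop where
  antitone : Antitone μ
  nonneg : ∀ i, 0 ≤ μ i
  orthonormal : Orthonormal ℝ φ
  eigen : ∀ i, integralOp k ν (φ i) =ᵐ[ν] fun x => μ i * φ i x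
  complete : ∀ f : Lp ℝ 2 ν, (∀ i, inner ℝ (φ i) f = 0) → integralOp k ν f =ᵐ[ν] 0

/-- `f ∈ L^r(L²(ν))`, where `L^r h = ∑_k μ_k^r ⟨φ_k, h⟩ φ_k` for the eigensystem `(μ_k, φ_k)`. -/
def InPowRange {d : ℕ} {ν : Measure (Inp d)} (μ : ℕ → ℝ) (φ : ℕ → Lp ℝ 2 ν) (r : ℝ)
    (f : Inp d → ℝ) : Prop :=
  ∃ h F : Lp ℝ 2 ν, HasSum (fun k => (μ k ^ r * inner ℝ (φ k) h) • φ k) F ∧ F =ᵐ[ν] f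

/-- `b i^{-β} ≤ μ_i ≤ c i^{-β}` for all `i ≥ 1`, for some constants `b, c > 0`. -/
def PolynomialDecay (μ : ℕ → ℝ) (β : ℝ) : Prop :=
  ∃ b > 0, ∃ c > 0, ∀ i : ℕ,
    b * ((i : ℝ) + 1) ^ (-β) ≤ μ i ∧ μ i ≤ c * ((i : ℝ) + 1) ^ (-β)

/-- The upper bound on the step size constant `η`, with `κ² = 4 + 2 C²`. -/
def stepBound (C lam θ : ℝ) : ℝ :=
  (lam + 208 * (1 + Real.sqrt (4 + 2 * C ^ 2)) ^ 4 / ((1 - 2 ^ (θ - 1)) * (2 * θ - 1))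
    * (Real.log (8 / (1 - θ)) + 1 / (1 - θ)))⁻¹

end TwoLayerSGD

end

/-! A wide network stays close to its first-order expansion in the parameters at initialization, so
SGD on it shadows SGD for a linear model in parameter space whose features are the initial gradient.
The symmetric initialization makes the initial network vanish, hence there is no offset. The Taylor
errors are of order ‖Θ - Θ₀‖² / √M. The linear iterates have norm at most λ^(-1/2), and each linear
step contracts differences by 1 - sλ, so local errors accumulate to at most 1/λ times the worst one.
With M ≥ T λ^(-5) the two predictions differ by O(T^(-1/2)) on the unit ball
(`norm_displacement_sub_linSgd_le`, `abs_network_sgd_sub_linear_le`), which costs O(1/T) in risk.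
The finitely many small T for which the comparison does not close are covered by a bound independent
of the width (`exists_network_sgd_bound`).

For the linear model, the second moments of the error are followed coordinate by coordinate in the
eigenbasis of the feature covariance (`integral_inner_linSgd_le`). The risk then splits into the
ridge residual, the remainder of the zero start, the noise of the first half of the steps and the
noise of the second half (`sum_ev_mul_le`). The source condition makes the first two O(λ^(2r)) up to
the logarithm of 2/δ, and the late noise is of order T^(-θ). The early noise is damped and amounts
to E = ∑ ev² exp(-(ev + λ) η T^(1-θ)).

The covariance is random. Its kernel is an empirical mean of independent one-neuron kernels with
expectation k_∞, so it is close to k_∞ in mean square with high probability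
(`measure_meanSquare_deviation_le`). A mean square bound between kernels is a Hilbert-Schmidt bound
between their integral operators. This suffices to transfer the source condition (`ridge_bias`) and
the effective dimension (`sum_effectiveDim_le`) from L_∞ to the random operator.

The two regimes differ only in E. If r < 1 - 1/(2β), then λ = T^(-(1-θ)) and E is controlled by λ² ∑
(μ/(μ+λ))², which is O(λ^(2r)) by the eigenvalue decay. Otherwise λ is larger by T^(ε/(2r)), and the
factor exp(-η T^(ε/(2r))) alone beats every power of T. -/

open MeasureTheory ProbabilityTheory

noncomputable section

namespace TwoLayerSGD


/-! ### Ridge regression and effective dimension in a Hilbert space -/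

section Hilbert

variable {K : Type*} [NormedAddCommGroup K] [InnerProductSpace ℝ K]
  {ι : Type*} [Fintype ι]

/-- The finite rank operator `f ↦ ∑ i, ⟪p i, f⟫ p i`. -/
def finiteRankOp (p : ι → K) (f : K) : K := ∑ i, inner ℝ (p i) f • p i

lemma finiteRankOp_sub (p : ι → K) (f g : K) :
    finiteRankOp p (f - g) = finiteRankOp p f - finiteRankOp p g := by
  simp [finiteRankOp, inner_sub_right, sub_smul, Finset.sum_sub_distrib]

lemma inner_finiteRankOp (p : ι → K) (f : K) :
    inner ℝ (finiteRankOp p f) f = ∑ i, inner ℝ (p i) f ^ 2 := by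
  simp [finiteRankOp, sum_inner, inner_smul_left, sq]

/-- Stability of the regularized equation `(L + lam) w = g` for a finite rank operator `L`. -/
lemma ridge_stability {p : ι → K} {lam : ℝ} (hlam : 0 < lam) {w g : K}
    (hw : finiteRankOp p w + lam • w = g) (w' : K) :
    lam * ‖w - w'‖ ≤ ‖g - (finiteRankOp p w' + lam • w')‖ ∧
      lam * ∑ i, inner ℝ (p i) (w - w') ^ 2 ≤ ‖g - (finiteRankOp p w' + lam • w')‖ ^ 2 := by
  set e := g - (finiteRankOp p w' + lam • w') with he
  have h1 : finiteRankOp p (w - w') + lam • (w - w') = e := by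
    rw [finiteRankOp_sub, smul_sub, he, ← hw]; abel
  have h2 : ∑ i, inner ℝ (p i) (w - w') ^ 2 + lam * ‖w - w'‖ ^ 2 = inner ℝ e (w - w') := by
    rw [← h1, inner_add_left, inner_finiteRankOp, inner_smul_left, real_inner_self_eq_norm_sq]
    simp
  have h3 : inner ℝ e (w - w') ≤ ‖e‖ * ‖w - w'‖ := real_inner_le_norm _ _
  have h4 : 0 ≤ ∑ i, inner ℝ (p i) (w - w') ^ 2 := Finset.sum_nonneg fun _ _ => sq_nonneg _
  have h5 : lam * ‖w - w'‖ ≤ ‖e‖ := by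
    rcases (norm_nonneg (w - w')).eq_or_lt with h | h
    · rw [← h]; simp
    · refine le_of_mul_le_mul_right ?_ h
      nlinarith
  refine ⟨h5, ?_⟩
  have h6 : ∑ i, inner ℝ (p i) (w - w') ^ 2 ≤ ‖e‖ * ‖w - w'‖ := by nlinarith [sq_nonneg ‖w - w'‖]
  nlinarith [norm_nonneg e]

/-- The saturation of ridge regression: x ^ r ≤ (x + lam) ^ r, and the remaining power r - 1 is
nonpositive exactly because r ≤ 1. -/
lemma rpow_div_add_le {x lam r : ℝ} (hx : 0 ≤ x) (hlam : 0 < lam) (hr : 0 ≤ r) (hr1 : r ≤ 1) :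
    x ^ r / (x + lam) ≤ lam ^ (r - 1) := by
  have hp : 0 < x + lam := by linarith
  rw [div_le_iff₀ hp]
  calc x ^ r ≤ (x + lam) ^ r := Real.rpow_le_rpow hx (by linarith) hr
    _ = (x + lam) ^ (r - 1) * (x + lam) := by
        rw [Real.rpow_sub_one hp.ne']; field_simp
    _ ≤ lam ^ (r - 1) * (x + lam) := by
        refine mul_le_mul_of_nonneg_right ?_ hp.le
        exact Real.rpow_le_rpow_of_nonpos hlam (by linarith) (by linarith)

lemma norm_sq_sum_smul_orthonormal {φ : ℕ → K} (hφ : Orthonormal ℝ φ) (c : ℕ → ℝ)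
    (s : Finset ℕ) : ‖∑ k ∈ s, c k • φ k‖ ^ 2 = ∑ k ∈ s, c k ^ 2 := by
  rw [← real_inner_self_eq_norm_sq, hφ.inner_sum]
  simp [sq]

/-- The bias of regularized least squares for a finite rank operator that is close to an operator
with eigensystem `(μ, φ)`, under a source condition of order `r`. -/
theorem ridge_bias {p : ι → K} {lam : ℝ} (hlam : 0 < lam) {w g h : K}
    (hw : finiteRankOp p w + lam • w = g) {L : K →L[ℝ] K} {D : ℝ}
    (hD : ∀ f, ‖L f - finiteRankOp p f‖ ≤ D * ‖f‖) (hD0 : 0 ≤ D)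
    {μ : ℕ → ℝ} {φ : ℕ → K} (hμ : Antitone μ) (hμ0 : ∀ i, 0 ≤ μ i) (hφ : Orthonormal ℝ φ)
    (hL : ∀ i, L (φ i) = μ i • φ i) {r : ℝ} (hr : 1 / 2 ≤ r) (hr1 : r ≤ 1)
    (hg : HasSum (fun k => (μ k ^ r * inner ℝ (φ k) h) • φ k) g) :
    ‖w‖ ≤ lam ^ (r - 1) * ‖h‖ * (1 + D / lam) ∧
      ∑ i, inner ℝ (p i) w ^ 2 ≤ 2 * (μ 0 ^ (2 * r - 1) + D * (lam ^ (r - 1)) ^ 2) * ‖h‖ ^ 2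
        + 2 * (D * (lam ^ (r - 1) * ‖h‖)) ^ 2 / lam := by
  set G : ℕ → K := fun n => ∑ k ∈ Finset.range n, (μ k ^ r * inner ℝ (φ k) h) • φ k with hG
  -- The coefficients of (L + lam)⁻¹ g. The truncation W n solves the equation for L with right side
  -- G n, so in the equation for the finite rank operator it leaves a residual of at most ‖g - G n‖
  -- + D ‖W n‖. Stability compares it with w, and n tends to infinity.
  set c : ℕ → ℝ := fun k => μ k ^ r / (μ k + lam) * inner ℝ (φ k) h with hc
  set W : ℕ → K := fun n => ∑ k ∈ Finset.range n, c k • φ k with hW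
  have hGt : Filter.Tendsto (fun n => ‖g - G n‖) Filter.atTop (nhds 0) := by
    have h1 := (tendsto_const_nhds (x := g)).sub hg.tendsto_sum_nat
    simpa using h1.norm
  have hpos : ∀ k, 0 < μ k + lam := fun k => by linarith [hμ0 k]
  have hl0 : 0 ≤ lam ^ (r - 1) := Real.rpow_nonneg hlam.le _
  have hbessel : ∀ n, ∑ k ∈ Finset.range n, inner ℝ (φ k) h ^ 2 ≤ ‖h‖ ^ 2 := fun n => by
    simpa using hφ.sum_inner_products_le h (s := Finset.range n)
  have hLW : ∀ n, L (W n) + lam • W n = G n := by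
    intro n
    simp only [hW, hG, map_sum, map_smul, hL, Finset.smul_sum, ← Finset.sum_add_distrib, smul_smul,
      ← add_smul]
    refine Finset.sum_congr rfl fun k _ => ?_
    congr 1
    have := (hpos k).ne'
    simp only [hc]; field_simp
  have hWn : ∀ n, ‖W n‖ ≤ lam ^ (r - 1) * ‖h‖ := by
    intro n
    refine le_of_sq_le_sq ?_ (by positivity)
    rw [norm_sq_sum_smul_orthonormal hφ, mul_pow]
    calc ∑ k ∈ Finset.range n, c k ^ 2
        ≤ ∑ k ∈ Finset.range n, (lam ^ (r - 1)) ^ 2 * inner ℝ (φ k) h ^ 2 := by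
          refine Finset.sum_le_sum fun k _ => ?_
          simp only [hc, mul_pow]
          gcongr
          · have := hpos k; have := hμ0 k; positivity
          · exact rpow_div_add_le (hμ0 k) hlam (by linarith) hr1
      _ ≤ _ := by rw [← Finset.mul_sum]; gcongr; exact hbessel n
  have hres : ∀ n, ‖g - (finiteRankOp p (W n) + lam • W n)‖
      ≤ ‖g - G n‖ + D * (lam ^ (r - 1) * ‖h‖) := by
    intro n
    have : g - (finiteRankOp p (W n) + lam • W n)
        = (g - G n) + (L (W n) - finiteRankOp p (W n)) := by rw [← hLW n]; abel
    rw [this]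
    refine (norm_add_le _ _).trans ?_
    gcongr
    exact (hD _).trans (by gcongr; exact hWn n)
  constructor
  · have h1 : ∀ n, lam * ‖w‖ ≤ lam * (lam ^ (r - 1) * ‖h‖)
        + (‖g - G n‖ + D * (lam ^ (r - 1) * ‖h‖)) := by
      intro n
      have h2 := (ridge_stability hlam hw (W n)).1.trans (hres n)
      have h3 : ‖w‖ ≤ ‖W n‖ + ‖w - W n‖ := by
        simpa using norm_add_le (W n) (w - W n)
      have h4 := hWn n
      nlinarith
    have h5 : lam * ‖w‖ ≤ lam * (lam ^ (r - 1) * ‖h‖) + (0 + D * (lam ^ (r - 1) * ‖h‖)) :=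
      ge_of_tendsto' ((hGt.add_const _).const_add _) h1
    rw [show lam ^ (r - 1) * ‖h‖ * (1 + D / lam)
      = (lam * (lam ^ (r - 1) * ‖h‖) + (0 + D * (lam ^ (r - 1) * ‖h‖))) / lam by field_simp; ring,
      le_div_iff₀ hlam]
    linarith
  · have hLWW : ∀ n, inner ℝ (L (W n)) (W n) ≤ μ 0 ^ (2 * r - 1) * ‖h‖ ^ 2 := by
      intro n
      have h1 : L (W n) = ∑ k ∈ Finset.range n, (μ k * c k) • φ k := by
        simp only [hW, map_sum, map_smul, hL, smul_smul, mul_comm]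
      rw [h1, hφ.inner_sum]
      calc ∑ k ∈ Finset.range n, (starRingEnd ℝ) (μ k * c k) * c k
          ≤ ∑ k ∈ Finset.range n, μ 0 ^ (2 * r - 1) * inner ℝ (φ k) h ^ 2 := by
            refine Finset.sum_le_sum fun k _ => ?_
            have e1 : (starRingEnd ℝ) (μ k * c k) * c k
                = (μ k * (μ k ^ r / (μ k + lam)) ^ 2) * inner ℝ (φ k) h ^ 2 := by
              simp only [hc, conj_trivial]; ring
            rw [e1]
            gcongr
            -- Dropping lam from the denominator leaves μ k ^ (2r - 1), which μ 0 dominates because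
            -- 2r ≥ 1.
            have e2 : μ k * (μ k ^ r / (μ k + lam)) ^ 2 ≤ μ k ^ (2 * r - 1) := by
              rcases (hμ0 k).eq_or_lt with h0 | h0
              · rw [← h0, zero_mul]; exact Real.rpow_nonneg le_rfl _
              · have e3 : (μ k ^ r / (μ k + lam)) ≤ μ k ^ r / μ k := by gcongr; linarith
                have e4 : 0 ≤ μ k ^ r / (μ k + lam) := by have := hpos k; positivity
                calc μ k * (μ k ^ r / (μ k + lam)) ^ 2 ≤ μ k * (μ k ^ r / μ k) ^ 2 := by gcongr
                  _ = μ k ^ (2 * r - 1) := by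
                    rw [Real.rpow_sub_one h0.ne', two_mul, Real.rpow_add h0]; field_simp
            exact e2.trans (Real.rpow_le_rpow (hμ0 k) (hμ (Nat.zero_le k)) (by linarith))
        _ ≤ _ := by
            rw [← Finset.mul_sum]
            have := Real.rpow_nonneg (hμ0 0) (2 * r - 1)
            gcongr; exact hbessel n
    have hpW : ∀ n, ∑ i, inner ℝ (p i) (W n) ^ 2
        ≤ (μ 0 ^ (2 * r - 1) + D * (lam ^ (r - 1)) ^ 2) * ‖h‖ ^ 2 := by
      intro n
      rw [← inner_finiteRankOp]
      have h1 : inner ℝ (finiteRankOp p (W n)) (W n)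
          = inner ℝ (L (W n)) (W n) - inner ℝ (L (W n) - finiteRankOp p (W n)) (W n) := by
        rw [inner_sub_left]; ring
      have h2 : |inner ℝ (L (W n) - finiteRankOp p (W n)) (W n)| ≤ D * (lam ^ (r - 1) * ‖h‖) ^ 2 :=
        calc _ ≤ ‖L (W n) - finiteRankOp p (W n)‖ * ‖W n‖ := abs_real_inner_le_norm _ _
          _ ≤ (D * ‖W n‖) * ‖W n‖ := by gcongr; exact hD _
          _ = D * ‖W n‖ ^ 2 := by ring
          _ ≤ _ := by gcongr; exact hWn n
      have h3 := hLWW n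
      have h4 := (abs_le.1 h2).1
      rw [h1]
      nlinarith
    have h1 : ∀ n, ∑ i, inner ℝ (p i) w ^ 2
        ≤ 2 * (μ 0 ^ (2 * r - 1) + D * (lam ^ (r - 1)) ^ 2) * ‖h‖ ^ 2
          + 2 * (‖g - G n‖ + D * (lam ^ (r - 1) * ‖h‖)) ^ 2 / lam := by
      intro n
      have h2 : lam * ∑ i, inner ℝ (p i) (w - W n) ^ 2
          ≤ (‖g - G n‖ + D * (lam ^ (r - 1) * ‖h‖)) ^ 2 :=
        (ridge_stability hlam hw (W n)).2.trans (by gcongr; exact hres n)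
      have h3 : ∑ i, inner ℝ (p i) w ^ 2
          ≤ ∑ i, (2 * inner ℝ (p i) (W n) ^ 2 + 2 * inner ℝ (p i) (w - W n) ^ 2) := by
        refine Finset.sum_le_sum fun i _ => ?_
        rw [inner_sub_right]
        nlinarith [sq_nonneg (2 * inner ℝ (p i) (W n) - inner ℝ (p i) w)]
      rw [Finset.sum_add_distrib, ← Finset.mul_sum, ← Finset.mul_sum] at h3
      have h4 : ∑ i, inner ℝ (p i) (w - W n) ^ 2
          ≤ (‖g - G n‖ + D * (lam ^ (r - 1) * ‖h‖)) ^ 2 / lam := by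
        rw [le_div_iff₀ hlam]; linarith
      have h5 := hpW n
      rw [mul_div_assoc]
      nlinarith
    have h6 := ge_of_tendsto' (((((hGt.add_const (D * (lam ^ (r - 1) * ‖h‖))).pow 2).const_mul
      2).div_const lam).const_add
        (2 * (μ 0 ^ (2 * r - 1) + D * (lam ^ (r - 1)) ^ 2) * ‖h‖ ^ 2)) h1
    simpa using h6

/-- Comparison of the effective dimension of a family of approximate eigenvectors with that of
an operator that is diagonal in a Hilbert basis. -/
theorem sum_effectiveDim_le {κ : Type*} (b : HilbertBasis κ ℝ K) {m : κ → ℝ} (hm : ∀ k, 0 ≤ m k)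
    {L : K →L[ℝ] K} (hL : ∀ k f, inner ℝ (b k) (L f) = m k * inner ℝ (b k) f)
    {f : ι → K} (hf : Orthonormal ℝ f) {s : ι → ℝ} (hs : ∀ i, 0 ≤ s i) {lam : ℝ} (hlam : 0 < lam)
    {Q : ℝ} (hQ : ∑ i, ‖L (f i) - s i • f i‖ ^ 2 ≤ Q) {N : ℝ}
    (hN : HasSum (fun k => (m k / (m k + lam)) ^ 2) N) :
    ∑ i, (s i / (s i + lam)) ^ 2 ≤ 2 * N + 2 * Q / lam ^ 2 := by
  have parseval : ∀ x : K, HasSum (fun k => inner ℝ (b k) x ^ 2) (‖x‖ ^ 2) := by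
    intro x
    have := b.hasSum_inner_mul_inner x x
    rw [real_inner_self_eq_norm_sq] at this
    refine this.congr_fun ?_
    intro k; rw [real_inner_comm x (b k)]; ring
  have h1 : HasSum (fun k => ∑ i, (s i / (s i + lam)) ^ 2 * inner ℝ (b k) (f i) ^ 2)
      (∑ i, (s i / (s i + lam)) ^ 2) := by
    refine hasSum_sum fun i _ => ?_
    have := (parseval (f i)).mul_left ((s i / (s i + lam)) ^ 2)
    rwa [hf.1 i, one_pow, mul_one] at this
  have h2 : HasSum (fun k => ∑ i, inner ℝ (b k) (L (f i) - s i • f i) ^ 2)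
      (∑ i, ‖L (f i) - s i • f i‖ ^ 2) := hasSum_sum fun i _ => parseval _
  have h3 := hasSum_le (fun k => ?_) h1 ((hN.mul_left 2).add (h2.mul_left (2 / lam ^ 2)))
  · refine h3.trans ?_
    rw [mul_div_right_comm]
    gcongr
  · have bessel : ∑ i, inner ℝ (b k) (f i) ^ 2 ≤ 1 := by
      have := hf.sum_inner_products_le (b k) (s := Finset.univ)
      simpa [real_inner_comm, b.orthonormal.1 k] using this
    calc ∑ i, (s i / (s i + lam)) ^ 2 * inner ℝ (b k) (f i) ^ 2
        ≤ ∑ i, (2 * (m k / (m k + lam)) ^ 2 * inner ℝ (b k) (f i) ^ 2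
            + 2 / lam ^ 2 * inner ℝ (b k) (L (f i) - s i • f i) ^ 2) := by
          refine Finset.sum_le_sum fun i _ => ?_
          rw [inner_sub_right, hL, inner_smul_right]
          set a := inner ℝ (b k) (f i)
          have hs1 : 0 < s i + lam := by linarith [hs i]
          have hm1 : 0 < m k + lam := by linarith [hm k]
          -- By the resolvent identity the filters s/(s+lam) and m/(m+lam) differ by lam
          -- (s-m)/((s+lam)(m+lam)), that is, by q times the eigenvector defect divided by lam.
          set q := lam ^ 2 / ((s i + lam) * (m k + lam)) with hq
          have hq0 : 0 ≤ q := by positivity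
          have hq1 : q ≤ 1 := by
            rw [hq, div_le_one (by positivity)]
            nlinarith [hs i, hm k, mul_nonneg (hs i) (hm k)]
          have e1 : s i / (s i + lam) * a
              = m k / (m k + lam) * a - q * ((m k * a - s i * a) / lam) := by
            rw [hq]; field_simp; ring
          have e2 : (s i / (s i + lam)) ^ 2 * a ^ 2 = (s i / (s i + lam) * a) ^ 2 := by ring
          have e3 : 2 / lam ^ 2 * (m k * a - s i * a) ^ 2 = 2 * ((m k * a - s i * a) / lam) ^ 2 := by
            field_simp
          rw [e2, e1, e3]
          set x := m k / (m k + lam) * a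
          set y := (m k * a - s i * a) / lam
          have e4 : 2 * (m k / (m k + lam)) ^ 2 * a ^ 2 = 2 * x ^ 2 := by ring
          rw [e4]
          have e5 : (q * y) ^ 2 ≤ y ^ 2 := by
            rw [mul_pow]; exact mul_le_of_le_one_left (sq_nonneg _) (by nlinarith)
          nlinarith [sq_nonneg (x + q * y)]
      _ ≤ _ := by
          rw [Finset.sum_add_distrib, ← Finset.mul_sum, ← Finset.mul_sum]
          refine add_le_add_left ?_ _
          exact mul_le_of_le_one_right (by positivity) bessel

/-- A symmetric operator with an orthonormal eigensystem that is complete up to the kernel is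
diagonal in some Hilbert basis, with the same nonzero eigenvalues. -/
theorem exists_eigen_hilbertBasis [CompleteSpace K] {L : K →L[ℝ] K}
    (hsymm : ∀ f g, inner ℝ (L f) g = inner ℝ f (L g)) {μ : ℕ → ℝ} {φ : ℕ → K}
    (hμ0 : ∀ i, 0 ≤ μ i) (hφ : Orthonormal ℝ φ) (hL : ∀ i, L (φ i) = μ i • φ i)
    (hcomplete : ∀ f, (∀ i, inner ℝ (φ i) f = 0) → L f = 0) :
    ∃ (w : Set K) (b : HilbertBasis w ℝ K) (m : w → ℝ), (∀ k, 0 ≤ m k) ∧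
      (∀ k f, inner ℝ (b k) (L f) = m k * inner ℝ (b k) f) ∧
      ∀ F : ℝ → ℝ, F 0 = 0 → ∀ N, HasSum (fun i => F (μ i)) N → HasSum (fun k => F (m k)) N := by
  -- The vectors added to the range of φ are orthogonal to every φ i, so completeness puts them into
  -- the kernel of L. They carry the eigenvalue 0, whence the requirement F 0 = 0.
  obtain ⟨w, b, hwb, hb⟩ := (hφ.toSubtypeRange).exists_hilbertBasis_extension
  set m : w → ℝ := fun k => inner ℝ (k : K) (L k) with hm
  have hbo : Orthonormal ℝ (Subtype.val : w → K) := hb ▸ b.orthonormal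
  have hmφ : ∀ i (h : φ i ∈ w), m ⟨φ i, h⟩ = μ i := by
    intro i h
    simp [hm, hL, inner_smul_right, hφ.1 i]
  have hextra : ∀ k : w, (k : K) ∉ Set.range φ → L k = 0 := by
    intro k hk
    refine hcomplete _ fun i => ?_
    have hne : (⟨φ i, hwb ⟨i, rfl⟩⟩ : w) ≠ k := fun h => hk ⟨i, by rw [← h]⟩
    exact hbo.2 hne
  have hcase : ∀ k : w, L k = m k • (k : K) := by
    intro k
    by_cases hk : (k : K) ∈ Set.range φ
    · obtain ⟨i, hi⟩ := hk
      have : k = ⟨φ i, hwb ⟨i, rfl⟩⟩ := Subtype.ext hi.symm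
      rw [this, hmφ i, hL]
    · simp [hm, hextra k hk]
  refine ⟨w, b, m, ?_, ?_, ?_⟩
  · intro k
    by_cases hk : (k : K) ∈ Set.range φ
    · obtain ⟨i, hi⟩ := hk
      have : k = ⟨φ i, hwb ⟨i, rfl⟩⟩ := Subtype.ext hi.symm
      rw [this, hmφ i]; exact hμ0 i
    · simp [hm, hextra k hk]
  · intro k f
    rw [← hsymm, hb, hcase, inner_smul_left]; simp
  · intro F hF N hN
    have hinj : Function.Injective (fun i => (⟨φ i, hwb ⟨i, rfl⟩⟩ : w)) := by
      intro i j hij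
      exact hφ.linearIndependent.injective (Subtype.ext_iff.1 hij)
    refine (hinj.hasSum_iff ?_).1 ?_
    · intro k hk
      have hk' : (k : K) ∉ Set.range φ := by
        rintro ⟨i, hi⟩; exact hk ⟨i, Subtype.ext hi⟩
      have : m k = 0 := by simp [hm, hextra k hk']
      rw [this, hF]
    · refine hN.congr_fun ?_
      intro i; simp [hmφ]

end Hilbert


/-! ### Second moments of regularized SGD for a linear model -/

section LinearSGD

set_option linter.unusedSectionVars false

variable {X : Type*} [MeasurableSpace X]
  {H : Type*} [NormedAddCommGroup H] [InnerProductSpace ℝ H]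

/-- One step of regularized stochastic gradient descent for the linear model with feature map
`Φ`. -/
def linStep (Φ : X → H) (lam s : ℝ) (u : H) (z : X × ℝ) : H :=
  (1 - s * lam) • u - (s * (inner ℝ (Φ z.1) u - z.2)) • Φ z.1

/-- Regularized stochastic gradient descent, started at zero, for the linear model with feature
map `Φ`; the step from `t` to `t + 1` samples has step size `s t`. -/
def linSgd (Φ : X → H) (lam : ℝ) (s : ℕ → ℝ) : (T : ℕ) → (Fin T → X × ℝ) → H
  | 0, _ => 0
  | T + 1, z => linStep Φ lam (s T) (linSgd Φ lam s T fun i => z i.castSucc) (z (Fin.last T))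

/-- With s‖Φ‖² ≤ 1 - s lam in the quadratic term, it combines with the cross term to s (1 - s
lam)(y² - f²), which is at most s whatever the prediction f is. -/
lemma norm_linStep_sq_le {Φ : X → H} {lam s κ : ℝ} {u : H} {z : X × ℝ} (hs : 0 ≤ s)
    (hlam : 0 ≤ lam) (hsl : s * (lam + κ ^ 2) ≤ 1) (hΦ : ‖Φ z.1‖ ≤ κ) (hy : |z.2| ≤ 1) :
    ‖linStep Φ lam s u z‖ ^ 2 ≤ (1 - s * lam) * ‖u‖ ^ 2 + s := by
  set f := inner ℝ (Φ z.1) u with hf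
  have h1 : ‖linStep Φ lam s u z‖ ^ 2 = (1 - s * lam) ^ 2 * ‖u‖ ^ 2
      - 2 * (1 - s * lam) * (s * (f - z.2)) * f + (s * (f - z.2)) ^ 2 * ‖Φ z.1‖ ^ 2 := by
    rw [linStep, norm_sub_sq_real, inner_smul_left, inner_smul_right, norm_smul, norm_smul,
      real_inner_comm (Φ z.1) u, ← hf]
    simp only [mul_pow, Real.norm_eq_abs, sq_abs, conj_trivial]
    ring
  have hκ : ‖Φ z.1‖ ^ 2 ≤ κ ^ 2 := by gcongr
  have hy2 : z.2 ^ 2 ≤ 1 := by rw [← sq_abs]; nlinarith [abs_nonneg z.2]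
  have h2 : s * ‖Φ z.1‖ ^ 2 ≤ 1 - s * lam := by nlinarith
  have h0 : 0 ≤ 1 - s * lam := le_trans (by positivity) h2
  have h3 : (s * (f - z.2)) ^ 2 * ‖Φ z.1‖ ^ 2 ≤ s * (f - z.2) ^ 2 * (1 - s * lam) := by
    have : (s * (f - z.2)) ^ 2 * ‖Φ z.1‖ ^ 2 = s * (f - z.2) ^ 2 * (s * ‖Φ z.1‖ ^ 2) := by ring
    rw [this]; gcongr
  have h4 : (1 - s * lam) ^ 2 * ‖u‖ ^ 2 ≤ (1 - s * lam) * ‖u‖ ^ 2 := by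
    have : (1 - s * lam) ≤ 1 := by nlinarith
    gcongr
    nlinarith
  have h5 : s * (1 - s * lam) * (z.2 ^ 2 - f ^ 2) ≤ s * 1 * 1 := by
    have e1 : z.2 ^ 2 - f ^ 2 ≤ 1 := by nlinarith [sq_nonneg f]
    have e2 : 1 - s * lam ≤ 1 := by nlinarith
    calc s * (1 - s * lam) * (z.2 ^ 2 - f ^ 2) ≤ s * (1 - s * lam) * 1 := by gcongr
      _ ≤ _ := by gcongr
  rw [h1]
  nlinarith

/-- The value 1/lam is the fixed point of v ↦ (1 - s lam) v + s for every step size s. The bound is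
pathwise and does not depend on T. -/
lemma norm_linSgd_sq_le {Φ : X → H} {lam κ : ℝ} {s : ℕ → ℝ} (hs : ∀ t, 0 ≤ s t)
    (hlam : 0 < lam) (hsl : ∀ t, s t * (lam + κ ^ 2) ≤ 1) {T : ℕ} {z : Fin T → X × ℝ}
    (hΦ : ∀ i, ‖Φ (z i).1‖ ≤ κ) (hy : ∀ i, |(z i).2| ≤ 1) :
    ‖linSgd Φ lam s T z‖ ^ 2 ≤ 1 / lam := by
  induction T with
  | zero => simp [linSgd, hlam.le]
  | succ T ih =>
    have h1 := ih (z := fun i => z i.castSucc) (fun i => hΦ _) (fun i => hy _)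
    refine (norm_linStep_sq_le (hs T) hlam.le (hsl T) (hΦ (Fin.last T)) (hy _)).trans ?_
    have h2 : 0 ≤ 1 - s T * lam := by
      have := hsl T; have := hs T; nlinarith [mul_nonneg (hs T) (sq_nonneg κ)]
    calc _ ≤ (1 - s T * lam) * (1 / lam) + s T := by gcongr
      _ = 1 / lam := by field_simp; ring

variable [FiniteDimensional ℝ H] [MeasurableSpace H] [BorelSpace H]

lemma measurable_linStep {Φ : X → H} (hΦ : Measurable Φ) (lam s : ℝ) :
    Measurable fun q : H × (X × ℝ) => linStep Φ lam s q.1 q.2 := by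
  have : Measurable fun q : H × (X × ℝ) => Φ q.2.1 := hΦ.comp (by fun_prop)
  unfold linStep
  exact (measurable_fst.const_smul _).sub
    (((this.inner measurable_fst).sub (by fun_prop)).const_mul _ |>.smul this)

lemma measurable_linSgd {Φ : X → H} (hΦ : Measurable Φ) (lam : ℝ) (s : ℕ → ℝ) (T : ℕ) :
    Measurable (linSgd Φ lam s T) := by
  induction T with
  | zero => exact measurable_const
  | succ T ih =>
    have h1 : Measurable fun z : Fin (T + 1) → X × ℝ => fun i : Fin T => z i.castSucc :=
      measurable_pi_lambda _ fun i => measurable_pi_apply _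
    exact (measurable_linStep hΦ lam (s T)).comp
      ((ih.comp h1).prodMk (measurable_pi_apply (Fin.last T)))

variable {ρ : Measure (X × ℝ)} [IsProbabilityMeasure ρ]

lemma ae_pi_of_ae {Z : Type*} [MeasurableSpace Z] {μ : Measure Z} [IsProbabilityMeasure μ]
    {P : Z → Prop} (h : ∀ᵐ z ∂μ, P z) (T : ℕ) :
    ∀ᵐ z ∂(Measure.pi fun _ : Fin T => μ), ∀ i, P (z i) := by
  rw [ae_all_iff]
  intro i
  exact (measurePreserving_eval (fun _ : Fin T => μ) i).quasiMeasurePreserving.ae h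

/-- The assumptions on a linear model: bounded features and labels, an orthonormal eigenbasis `e`
of the covariance of the features with eigenvalues `ev`, and the regularized minimizer `ul`. -/
structure IsLinearModel {ι : Type*} [Fintype ι] (ρ : Measure (X × ℝ)) (Φ : X → H) (κ lam : ℝ)
    (e : OrthonormalBasis ι ℝ H) (ev : ι → ℝ) (ul : H) : Prop where
  measurable : Measurable Φ
  bound : ∀ᵐ z ∂ρ, ‖Φ z.1‖ ≤ κ
  label : ∀ᵐ z ∂ρ, |z.2| ≤ 1
  lam_pos : 0 < lam
  eigen : ∀ i u, ∫ z, inner ℝ (e i) (Φ z.1) * inner ℝ (Φ z.1) u ∂ρ = ev i * inner ℝ (e i) u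
  minimizer : ∀ i, ∫ z, z.2 * inner ℝ (e i) (Φ z.1) ∂ρ = (ev i + lam) * inner ℝ (e i) ul

namespace IsLinearModel

variable {ι : Type*} [Fintype ι] {Φ : X → H} {κ lam : ℝ} {e : OrthonormalBasis ι ℝ H}
  {ev : ι → ℝ} {ul : H}

lemma kappa_nonneg (hM : IsLinearModel ρ Φ κ lam e ev ul) : 0 ≤ κ := by
  obtain ⟨z, hz⟩ := hM.bound.exists
  exact (norm_nonneg _).trans hz

lemma abs_inner_le (hM : IsLinearModel ρ Φ κ lam e ev ul) (u : H) :
    ∀ᵐ z ∂ρ, |inner ℝ (Φ z.1) u| ≤ κ * ‖u‖ := by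
  filter_upwards [hM.bound] with z hz
  exact (abs_real_inner_le_norm _ _).trans (by gcongr)

lemma abs_residual_le (hM : IsLinearModel ρ Φ κ lam e ev ul) (u : H) :
    ∀ᵐ z ∂ρ, |inner ℝ (Φ z.1) u - z.2| ≤ κ * ‖u‖ + 1 := by
  filter_upwards [hM.abs_inner_le u, hM.label] with z hz hy
  exact (abs_sub _ _).trans (by gcongr)

lemma integrable_of_bounded {f : X × ℝ → ℝ} (hf : Measurable f) {C : ℝ}
    (hC : ∀ᵐ z ∂ρ, |f z| ≤ C) : Integrable f ρ :=
  Integrable.of_bound hf.aestronglyMeasurable C hC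

lemma ev_nonneg (hM : IsLinearModel ρ Φ κ lam e ev ul) (i : ι) : 0 ≤ ev i := by
  have h := hM.eigen i (e i)
  rw [real_inner_self_eq_norm_sq, e.orthonormal.1 i, one_pow, mul_one] at h
  rw [← h]
  refine integral_nonneg fun z => ?_
  simp only [real_inner_comm (e i), Pi.zero_apply]
  exact mul_self_nonneg _

lemma integral_inner_sq (hM : IsLinearModel ρ Φ κ lam e ev ul) (i : ι) :
    ∫ z, inner ℝ (e i) (Φ z.1) ^ 2 ∂ρ = ev i := by
  have h := hM.eigen i (e i)
  rw [real_inner_self_eq_norm_sq, e.orthonormal.1 i, one_pow, mul_one] at h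
  rw [← h]
  refine integral_congr_ae (.of_forall fun z => ?_)
  simp only [real_inner_comm (e i), sq]

lemma sum_ev_le (hM : IsLinearModel ρ Φ κ lam e ev ul) : ∑ i, ev i ≤ κ ^ 2 := by
  have hm := hM.measurable
  have h1 : ∀ i, Integrable (fun z => inner ℝ (e i) (Φ z.1) ^ 2) ρ := fun i => by
    refine integrable_of_bounded (C := (κ * ‖e i‖) ^ 2) (by fun_prop) ?_
    filter_upwards [hM.abs_inner_le (e i)] with z hz
    rw [real_inner_comm, abs_pow]; gcongr
  simp_rw [← hM.integral_inner_sq]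
  rw [← integral_finsetSum _ fun i _ => h1 i]
  calc ∫ z, ∑ i, inner ℝ (e i) (Φ z.1) ^ 2 ∂ρ ≤ ∫ _, κ ^ 2 ∂ρ := by
        refine integral_mono_ae (integrable_finsetSum _ fun i _ => h1 i) (integrable_const _) ?_
        filter_upwards [hM.bound] with z hz
        have := e.sum_sq_norm_inner_right (Φ z.1)
        simp only [Real.norm_eq_abs, sq_abs] at this
        simp only [this]
        gcongr
    _ = κ ^ 2 := by simp

lemma integral_inner_sq_eq_sum (hM : IsLinearModel ρ Φ κ lam e ev ul) (v : H) :
    ∫ z, inner ℝ (Φ z.1) v ^ 2 ∂ρ = ∑ i, ev i * inner ℝ (e i) v ^ 2 := by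
  have hm := hM.measurable
  have h1 : ∀ i, Integrable
      (fun z => inner ℝ (e i) v * (inner ℝ (e i) (Φ z.1) * inner ℝ (Φ z.1) v)) ρ := fun i => by
    refine (integrable_of_bounded (C := (κ * ‖e i‖) * (κ * ‖v‖)) (by fun_prop) ?_).const_mul _
    filter_upwards [hM.abs_inner_le (e i), hM.abs_inner_le v] with z hz hz'
    rw [real_inner_comm (Φ z.1), abs_mul]; gcongr
    exact (abs_nonneg _).trans hz
  calc ∫ z, inner ℝ (Φ z.1) v ^ 2 ∂ρ
      = ∫ z, ∑ i, inner ℝ (e i) v * (inner ℝ (e i) (Φ z.1) * inner ℝ (Φ z.1) v) ∂ρ := by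
        refine integral_congr_ae (.of_forall fun z => ?_)
        have h := e.sum_inner_mul_inner (Φ z.1) v
        simp only [← mul_assoc, ← Finset.sum_mul, sq]
        congr 1
        rw [← h]
        exact Finset.sum_congr rfl fun i _ => by rw [real_inner_comm (e i) (Φ z.1)]; ring
    _ = _ := by
        rw [integral_finsetSum _ fun i _ => h1 i]
        refine Finset.sum_congr rfl fun i _ => ?_
        rw [integral_const_mul, hM.eigen]; ring

lemma integrable_noise (hM : IsLinearModel ρ Φ κ lam e ev ul) (i : ι) (u : H) :
    Integrable (fun z => (inner ℝ (Φ z.1) u - z.2) ^ 2 * inner ℝ (e i) (Φ z.1) ^ 2) ρ := by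
  have hm := hM.measurable
  refine integrable_of_bounded (C := (κ * ‖u‖ + 1) ^ 2 * (κ * ‖e i‖) ^ 2) (by fun_prop) ?_
  filter_upwards [hM.abs_inner_le (e i), hM.abs_residual_le u] with z hz hz'
  rw [abs_mul, abs_pow, abs_pow, real_inner_comm (Φ z.1)]
  gcongr

/-- Mean plus variance: by the normal equations for `ul`, the mean of the new error coordinate is
exactly (1 - s (ev i + lam)) times the old one. The variance of the gradient coordinate is replaced
by its second moment. -/
lemma integral_inner_linStep_le (hM : IsLinearModel ρ Φ κ lam e ev ul) (i : ι) (s : ℝ) (u : H) :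
    ∫ z, inner ℝ (e i) (linStep Φ lam s u z - ul) ^ 2 ∂ρ
      ≤ (1 - s * (ev i + lam)) ^ 2 * inner ℝ (e i) (u - ul) ^ 2
        + s ^ 2 * ∫ z, (inner ℝ (Φ z.1) u - z.2) ^ 2 * inner ℝ (e i) (Φ z.1) ^ 2 ∂ρ := by
  have hm := hM.measurable
  set m0 := (1 - s * lam) * inner ℝ (e i) u - inner ℝ (e i) ul with hm0
  set W : X × ℝ → ℝ := fun z => (inner ℝ (Φ z.1) u - z.2) * inner ℝ (e i) (Φ z.1) with hW
  have hWi1 : Integrable (fun z => inner ℝ (e i) (Φ z.1) * inner ℝ (Φ z.1) u) ρ := by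
    refine integrable_of_bounded (C := (κ * ‖e i‖) * (κ * ‖u‖)) (by fun_prop) ?_
    filter_upwards [hM.abs_inner_le (e i), hM.abs_inner_le u] with z hz hz'
    rw [real_inner_comm (Φ z.1), abs_mul]; gcongr
    exact (abs_nonneg _).trans hz
  have hWi2 : Integrable (fun z => z.2 * inner ℝ (e i) (Φ z.1)) ρ := by
    refine integrable_of_bounded (C := 1 * (κ * ‖e i‖)) (by fun_prop) ?_
    filter_upwards [hM.abs_inner_le (e i), hM.label] with z hz hz'
    rw [real_inner_comm (Φ z.1), abs_mul]; gcongr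
  have hWeq : W = fun z => inner ℝ (e i) (Φ z.1) * inner ℝ (Φ z.1) u
      - z.2 * inner ℝ (e i) (Φ z.1) := by
    funext z; simp only [hW]; ring
  have hWi : Integrable W ρ := by rw [hWeq]; exact hWi1.sub hWi2
  have hWm : ∫ z, W z ∂ρ = ev i * inner ℝ (e i) u - (ev i + lam) * inner ℝ (e i) ul := by
    rw [hWeq, integral_sub hWi1 hWi2, hM.eigen, hM.minimizer]
  have hW2 : (fun z => W z ^ 2)
      = fun z => (inner ℝ (Φ z.1) u - z.2) ^ 2 * inner ℝ (e i) (Φ z.1) ^ 2 := by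
    funext z; simp only [hW]; ring
  have hW2i : Integrable (fun z => W z ^ 2) ρ := by rw [hW2]; exact hM.integrable_noise i u
  have h1 : ∀ z, inner ℝ (e i) (linStep Φ lam s u z - ul) ^ 2
      = m0 ^ 2 - 2 * s * m0 * W z + s ^ 2 * W z ^ 2 := by
    intro z
    simp only [linStep, inner_sub_right, inner_smul_right, hm0, hW]
    ring
  simp_rw [h1]
  rw [integral_add (by fun_prop) (by fun_prop), integral_sub (by fun_prop) (by fun_prop),
    integral_const_mul, integral_const_mul, hWm, hW2]
  simp only [integral_const, probReal_univ, smul_eq_mul, one_mul, inner_sub_right, hm0]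
  gcongr
  nlinarith [sq_nonneg (s * (ev i * inner ℝ (e i) u - (ev i + lam) * inner ℝ (e i) ul))]

/-- The residual is bounded through norms only, so that the other factor integrates to ev i. This
weight makes the noise summable over the spectrum independently of the dimension of `H`. -/
lemma integral_inner_linStep_le' (hM : IsLinearModel ρ Φ κ lam e ev ul) (i : ι) (s : ℝ) (u : H) :
    ∫ z, inner ℝ (e i) (linStep Φ lam s u z - ul) ^ 2 ∂ρ
      ≤ (1 - s * (ev i + lam)) ^ 2 * inner ℝ (e i) (u - ul) ^ 2
        + s ^ 2 * ev i * (2 + 4 * κ ^ 2 * ‖ul‖ ^ 2 + 4 * κ ^ 2 * ‖u - ul‖ ^ 2) := by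
  refine (hM.integral_inner_linStep_le i s u).trans ?_
  have hm := hM.measurable
  rw [mul_assoc (s ^ 2)]
  gcongr
  have hκ := hM.kappa_nonneg
  calc _ ≤ ∫ z, (2 + 4 * κ ^ 2 * ‖ul‖ ^ 2 + 4 * κ ^ 2 * ‖u - ul‖ ^ 2)
          * inner ℝ (e i) (Φ z.1) ^ 2 ∂ρ := by
        refine integral_mono_ae (hM.integrable_noise i u) ?_ ?_
        · refine (integrable_of_bounded (C := (κ * ‖e i‖) ^ 2) (by fun_prop) ?_).const_mul _
          filter_upwards [hM.abs_inner_le (e i)] with z hz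
          rw [real_inner_comm, abs_pow]; gcongr
        · filter_upwards [hM.abs_residual_le u] with z hz
          gcongr
          have h1 : ‖u‖ ≤ ‖ul‖ + ‖u - ul‖ := by simpa using norm_add_le ul (u - ul)
          have h2 : (inner ℝ (Φ z.1) u - z.2) ^ 2 ≤ (κ * (‖ul‖ + ‖u - ul‖) + 1) ^ 2 := by
            rw [← sq_abs]; gcongr; exact hz.trans (by gcongr)
          refine h2.trans ?_
          nlinarith [sq_nonneg (κ * (‖ul‖ + ‖u - ul‖) - 1), sq_nonneg (κ * ‖ul‖ - κ * ‖u - ul‖)]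
    _ = _ := by rw [integral_const_mul, hM.integral_inner_sq]; ring

lemma sum_inner_sq (e : OrthonormalBasis ι ℝ H) (v : H) : ∑ i, inner ℝ (e i) v ^ 2 = ‖v‖ ^ 2 := by
  simpa using e.sum_sq_norm_inner_right v

/-- The residual at u is the prediction of u - ul plus the residual at ul. The contribution of the
former, 2 s² κ² ev i in each direction, is absorbed by the contraction factor (1 - s (ev i + lam))².
Only the residual at ul remains, with the summable weight s². -/
lemma integral_norm_linStep_le (hM : IsLinearModel ρ Φ κ lam e ev ul) {s : ℝ} (hs : 0 ≤ s)
    (hsl : s * (lam + 2 * κ ^ 2) ≤ 1) (u : H) :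
    ∫ z, ‖linStep Φ lam s u z - ul‖ ^ 2 ∂ρ
      ≤ ‖u - ul‖ ^ 2 + 2 * κ ^ 2 * (κ * ‖ul‖ + 1) ^ 2 * s ^ 2 := by
  have hm := hM.measurable
  have hκ := hM.kappa_nonneg
  have hlam := hM.lam_pos
  have hstep : Measurable fun z => linStep Φ lam s u z :=
    (measurable_linStep hM.measurable lam s).comp (measurable_const.prodMk measurable_id)
  have hev : ∀ i, ev i ≤ κ ^ 2 := fun i =>
    (Finset.single_le_sum (fun j _ => hM.ev_nonneg j) (Finset.mem_univ i)).trans hM.sum_ev_le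
  have hint : ∀ i, Integrable (fun z => inner ℝ (e i) (linStep Φ lam s u z - ul) ^ 2) ρ := by
    intro i
    refine integrable_of_bounded
      (C := (‖e i‖ * (|1 - s * lam| * ‖u‖ + s * (κ * ‖u‖ + 1) * κ + ‖ul‖)) ^ 2) (by fun_prop) ?_
    filter_upwards [hM.bound, hM.abs_residual_le u] with z hz hz'
    rw [abs_pow]
    gcongr
    refine (abs_real_inner_le_norm _ _).trans ?_
    gcongr
    refine (norm_sub_le _ _).trans ?_
    gcongr
    refine (norm_sub_le _ _).trans ?_
    rw [norm_smul, norm_smul, Real.norm_eq_abs, Real.norm_eq_abs, abs_mul, abs_of_nonneg hs]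
    gcongr
  have hres : ∫ z, (inner ℝ (Φ z.1) u - z.2) ^ 2 * ‖Φ z.1‖ ^ 2 ∂ρ
      ≤ κ ^ 2 * (2 * ∑ i, ev i * inner ℝ (e i) (u - ul) ^ 2 + 2 * (κ * ‖ul‖ + 1) ^ 2) := by
    have hi : Integrable (fun z => inner ℝ (Φ z.1) (u - ul) ^ 2) ρ := by
      refine integrable_of_bounded (C := (κ * ‖u - ul‖) ^ 2) (by fun_prop) ?_
      filter_upwards [hM.abs_inner_le (u - ul)] with z hz
      rw [abs_pow]; gcongr
    calc _ ≤ ∫ z, κ ^ 2 * (2 * inner ℝ (Φ z.1) (u - ul) ^ 2 + 2 * (κ * ‖ul‖ + 1) ^ 2) ∂ρ := by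
          refine integral_mono_of_nonneg (.of_forall fun z => by positivity)
            (((hi.const_mul 2).add (integrable_const _)).const_mul _) ?_
          filter_upwards [hM.bound, hM.abs_residual_le ul] with z hz hz'
          rw [mul_comm]
          have e1 : inner ℝ (Φ z.1) u - z.2
              = inner ℝ (Φ z.1) (u - ul) + (inner ℝ (Φ z.1) ul - z.2) := by
            rw [inner_sub_right]; ring
          have e2 : (inner ℝ (Φ z.1) ul - z.2) ^ 2 ≤ (κ * ‖ul‖ + 1) ^ 2 := by
            rw [← sq_abs]; gcongr
          gcongr
          rw [e1]
          nlinarith [sq_nonneg (inner ℝ (Φ z.1) (u - ul) - (inner ℝ (Φ z.1) ul - z.2))]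
      _ = _ := by
          rw [integral_const_mul, integral_add (hi.const_mul 2) (integrable_const _),
            integral_const_mul, hM.integral_inner_sq_eq_sum]
          simp
  have hnoise : ∑ i, ∫ z, (inner ℝ (Φ z.1) u - z.2) ^ 2 * inner ℝ (e i) (Φ z.1) ^ 2 ∂ρ
      = ∫ z, (inner ℝ (Φ z.1) u - z.2) ^ 2 * ‖Φ z.1‖ ^ 2 ∂ρ := by
    rw [← integral_finsetSum _ fun i _ => hM.integrable_noise i u]
    simp_rw [← Finset.mul_sum, sum_inner_sq]
  calc ∫ z, ‖linStep Φ lam s u z - ul‖ ^ 2 ∂ρ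
      = ∑ i, ∫ z, inner ℝ (e i) (linStep Φ lam s u z - ul) ^ 2 ∂ρ := by
        rw [← integral_finsetSum _ fun i _ => hint i]
        simp_rw [sum_inner_sq]
    _ ≤ ∑ i, ((1 - s * (ev i + lam)) ^ 2 * inner ℝ (e i) (u - ul) ^ 2
        + s ^ 2 * ∫ z, (inner ℝ (Φ z.1) u - z.2) ^ 2 * inner ℝ (e i) (Φ z.1) ^ 2 ∂ρ) :=
        Finset.sum_le_sum fun i _ => hM.integral_inner_linStep_le i s u
    _ ≤ ∑ i, (1 - s * (ev i + lam)) ^ 2 * inner ℝ (e i) (u - ul) ^ 2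
        + s ^ 2 * (κ ^ 2 * (2 * ∑ i, ev i * inner ℝ (e i) (u - ul) ^ 2
          + 2 * (κ * ‖ul‖ + 1) ^ 2)) := by
        rw [Finset.sum_add_distrib, ← Finset.mul_sum, hnoise]
        gcongr
    _ = ∑ i, ((1 - s * (ev i + lam)) ^ 2 + 2 * s ^ 2 * κ ^ 2 * ev i) * inner ℝ (e i) (u - ul) ^ 2
        + 2 * κ ^ 2 * (κ * ‖ul‖ + 1) ^ 2 * s ^ 2 := by
        simp_rw [add_mul, Finset.sum_add_distrib, mul_assoc, ← Finset.mul_sum]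
        ring
    _ ≤ _ := by
        rw [← sum_inner_sq e (u - ul)]
        gcongr with i
        refine mul_le_of_le_one_left (sq_nonneg _) ?_
        have h1 := hev i
        have h2 := hM.ev_nonneg i
        have h3 : s * (ev i + lam) ≤ 1 := by nlinarith
        have h4 : 0 ≤ s * (ev i + lam) := by positivity
        have h5 : s * (2 * κ ^ 2) ≤ 1 := by nlinarith
        have h6 : s * ev i * (s * (2 * κ ^ 2)) ≤ s * ev i * 1 := by gcongr
        nlinarith

/-- Almost surely the iterates stay in a fixed compact ball, on which the continuous function F is
bounded. -/
lemma integrable_linSgd (hM : IsLinearModel ρ Φ κ lam e ev ul) {s : ℕ → ℝ}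
    (hs : ∀ t, 0 ≤ s t) (hsl : ∀ t, s t * (lam + κ ^ 2) ≤ 1) (T : ℕ) {F : H → ℝ}
    (hF : Continuous F) :
    Integrable (fun z => F (linSgd Φ lam s T z)) (Measure.pi fun _ : Fin T => ρ) := by
  obtain ⟨C, hC⟩ :=
    (isCompact_closedBall (0 : H) (Real.sqrt (1 / lam))).exists_bound_of_continuousOn
      hF.continuousOn
  refine Integrable.of_bound
    (hF.measurable.comp (measurable_linSgd hM.measurable lam s T)).aestronglyMeasurable C ?_
  filter_upwards [ae_pi_of_ae hM.bound T, ae_pi_of_ae hM.label T] with z h1 h2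
  refine hC _ ?_
  rw [mem_closedBall_zero_iff]
  exact Real.le_sqrt_of_sq_le (norm_linSgd_sq_le hs hM.lam_pos hsl h1 h2)

/-- Passing one step of the recursion through the expectation. -/
lemma integral_linSgd_succ_le (hM : IsLinearModel ρ Φ κ lam e ev ul) {s : ℕ → ℝ}
    (hs : ∀ t, 0 ≤ s t) (hsl : ∀ t, s t * (lam + κ ^ 2) ≤ 1) (T : ℕ) {F G : H → ℝ}
    (hF : Continuous F) (hG : Continuous G)
    (hFG : ∀ u, ∫ z, F (linStep Φ lam (s T) u z) ∂ρ ≤ G u) :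
    ∫ z, F (linSgd Φ lam s (T + 1) z) ∂(Measure.pi fun _ : Fin (T + 1) => ρ)
      ≤ ∫ z, G (linSgd Φ lam s T z) ∂(Measure.pi fun _ : Fin T => ρ) := by
  -- The last sample is split off. It is independent of the current iterate, which depends on the
  -- other samples only.
  have hmp := measurePreserving_piFinSuccAbove (fun _ : Fin (T + 1) => ρ) (Fin.last T)
  set f : (X × ℝ) × (Fin T → X × ℝ) → ℝ :=
    fun q => F (linStep Φ lam (s T) (linSgd Φ lam s T q.2) q.1) with hf
  have hcomp : (fun z => F (linSgd Φ lam s (T + 1) z))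
      = f ∘ (MeasurableEquiv.piFinSuccAbove (fun _ : Fin (T + 1) => X × ℝ) (Fin.last T)) := by
    funext z
    simp [hf, linSgd, MeasurableEquiv.piFinSuccAbove, Fin.insertNthEquiv]
    rfl
  have hfi : Integrable f (ρ.prod (Measure.pi fun _ : Fin T => ρ)) := by
    have := hM.integrable_linSgd hs hsl (T + 1) hF
    rw [hcomp] at this
    exact (hmp.integrable_comp_emb (MeasurableEquiv.measurableEmbedding _)).1 this
  have h1 : ∫ z, F (linSgd Φ lam s (T + 1) z) ∂(Measure.pi fun _ : Fin (T + 1) => ρ)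
      = ∫ q, f q ∂(ρ.prod (Measure.pi fun _ : Fin T => ρ)) := by
    rw [hcomp]
    exact hmp.integral_comp' f
  rw [h1, integral_prod_symm f hfi]
  exact integral_mono hfi.integral_prod_right (hM.integrable_linSgd hs hsl T hG) fun z => by
    simpa only [hf] using hFG (linSgd Φ lam s T z)

lemma integral_norm_linSgd_le (hM : IsLinearModel ρ Φ κ lam e ev ul) {s : ℕ → ℝ}
    (hs : ∀ t, 0 ≤ s t) (hsl : ∀ t, s t * (lam + 2 * κ ^ 2) ≤ 1) (T : ℕ) :
    ∫ z, ‖linSgd Φ lam s T z - ul‖ ^ 2 ∂(Measure.pi fun _ : Fin T => ρ)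
      ≤ ‖ul‖ ^ 2 + 2 * κ ^ 2 * (κ * ‖ul‖ + 1) ^ 2 * ∑ t ∈ Finset.range T, s t ^ 2 := by
  have hsl' : ∀ t, s t * (lam + κ ^ 2) ≤ 1 := fun t =>
    le_trans (by have := hs t; gcongr; nlinarith [sq_nonneg κ]) (hsl t)
  induction T with
  | zero => simp [linSgd]
  | succ T ih =>
    have hi := hM.integrable_linSgd hs hsl' T (F := fun u => ‖u - ul‖ ^ 2) (by fun_prop)
    refine (hM.integral_linSgd_succ_le hs hsl' T (F := fun u => ‖u - ul‖ ^ 2) (by fun_prop)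
      (G := fun u => ‖u - ul‖ ^ 2 + 2 * κ ^ 2 * (κ * ‖ul‖ + 1) ^ 2 * s T ^ 2) (by fun_prop)
      fun u => hM.integral_norm_linStep_le (hs T) (hsl T) u).trans ?_
    rw [integral_add hi (integrable_const _), Finset.sum_range_succ]
    simp only [integral_const, probReal_univ, smul_eq_mul, one_mul]
    linarith

/-- The second moment of each coordinate of the error in the eigenbasis. -/
theorem integral_inner_linSgd_le (hM : IsLinearModel ρ Φ κ lam e ev ul) {s : ℕ → ℝ}
    (hs : ∀ t, 0 ≤ s t) (hsl : ∀ t, s t * (lam + 2 * κ ^ 2) ≤ 1) {V : ℝ}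
    (hV : ∀ T, ∑ t ∈ Finset.range T, s t ^ 2 ≤ V) (i : ι) (T : ℕ) :
    ∫ z, inner ℝ (e i) (linSgd Φ lam s T z - ul) ^ 2 ∂(Measure.pi fun _ : Fin T => ρ)
      ≤ (∏ j ∈ Finset.range T, (1 - s j * (ev i + lam)) ^ 2) * inner ℝ (e i) ul ^ 2
        + (2 + 8 * κ ^ 2 * ‖ul‖ ^ 2 + 8 * κ ^ 4 * (κ * ‖ul‖ + 1) ^ 2 * V) * ev i
          * ∑ t ∈ Finset.range T, s t ^ 2
            * ∏ j ∈ Finset.Ico (t + 1) T, (1 - s j * (ev i + lam)) ^ 2 := by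
  have hsl' : ∀ t, s t * (lam + κ ^ 2) ≤ 1 := fun t =>
    le_trans (by have := hs t; gcongr; nlinarith [sq_nonneg κ]) (hsl t)
  induction T with
  | zero => simp [linSgd]
  | succ T ih =>
    have hi := hM.integrable_linSgd hs hsl' T (F := fun u => ‖u - ul‖ ^ 2) (by fun_prop)
    have hi' := hM.integrable_linSgd hs hsl' T (F := fun u => inner ℝ (e i) (u - ul) ^ 2)
      (by fun_prop)
    have hev := hM.ev_nonneg i
    refine (hM.integral_linSgd_succ_le hs hsl' T (F := fun u => inner ℝ (e i) (u - ul) ^ 2)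
      (by fun_prop) (G := fun u => (1 - s T * (ev i + lam)) ^ 2 * inner ℝ (e i) (u - ul) ^ 2
        + s T ^ 2 * ev i * (2 + 4 * κ ^ 2 * ‖ul‖ ^ 2 + 4 * κ ^ 2 * ‖u - ul‖ ^ 2)) (by fun_prop)
      fun u => hM.integral_inner_linStep_le' i (s T) u).trans ?_
    rw [integral_add (by fun_prop) (by fun_prop), integral_const_mul,
      integral_const_mul, integral_add (integrable_const _) (by fun_prop), integral_const_mul]
    simp only [integral_const, probReal_univ, smul_eq_mul, one_mul]
    have hv : ∫ z, ‖linSgd Φ lam s T z - ul‖ ^ 2 ∂(Measure.pi fun _ : Fin T => ρ)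
        ≤ ‖ul‖ ^ 2 + 2 * κ ^ 2 * (κ * ‖ul‖ + 1) ^ 2 * V :=
      (hM.integral_norm_linSgd_le hs hsl T).trans (by gcongr; exact hV T)
    have hsum : ∑ t ∈ Finset.range (T + 1), s t ^ 2
          * ∏ j ∈ Finset.Ico (t + 1) (T + 1), (1 - s j * (ev i + lam)) ^ 2
        = (1 - s T * (ev i + lam)) ^ 2 * (∑ t ∈ Finset.range T, s t ^ 2
          * ∏ j ∈ Finset.Ico (t + 1) T, (1 - s j * (ev i + lam)) ^ 2) + s T ^ 2 := by
      rw [Finset.sum_range_succ, Finset.mul_sum]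
      congr 1
      · refine Finset.sum_congr rfl fun t ht => ?_
        rw [Finset.prod_Ico_succ_top (by have := Finset.mem_range.1 ht; omega)]
        ring
      · simp
    rw [hsum, Finset.prod_range_succ]
    set A := ∫ z, inner ℝ (e i) (linSgd Φ lam s T z - ul) ^ 2 ∂(Measure.pi fun _ : Fin T => ρ)
    have h1 := mul_le_mul_of_nonneg_left ih (sq_nonneg (1 - s T * (ev i + lam)))
    have h2 := mul_le_mul_of_nonneg_left hv (show 0 ≤ s T ^ 2 * ev i * (4 * κ ^ 2) by positivity)
    linarith

end IsLinearModel

end LinearSGD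


/-! ### Sums and products of the step sizes -/

section StepSizes

lemma prod_one_sub_sq_le_exp {s : ℕ → ℝ} {x : ℝ} (I : Finset ℕ) (h : ∀ j, s j * x ≤ 1) :
    ∏ j ∈ I, (1 - s j * x) ^ 2 ≤ Real.exp (-2 * x * ∑ j ∈ I, s j) := by
  rw [Finset.mul_sum, Real.exp_sum]
  refine Finset.prod_le_prod (fun _ _ => sq_nonneg _) fun j _ => ?_
  have h1 : 1 - s j * x ≤ Real.exp (-(s j * x)) := by
    have := Real.add_one_le_exp (-(s j * x)); linarith
  have h0 : 0 ≤ 1 - s j * x := by linarith [h j]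
  calc (1 - s j * x) ^ 2 ≤ Real.exp (-(s j * x)) ^ 2 := by gcongr
    _ = Real.exp (-2 * x * s j) := by rw [← Real.exp_nat_mul]; congr 1; push_cast; ring

/-- With a = s T * x in [0, 1], adding a step turns a sum S ≤ 1 into (1 - a)² S + a, and (1 - a)² +
a ≤ 1. -/
lemma sum_step_mul_prod_le_one {s : ℕ → ℝ} {x : ℝ} (h0 : ∀ j, 0 ≤ s j * x)
    (h1 : ∀ j, s j * x ≤ 1) (n T : ℕ) :
    ∑ t ∈ Finset.Ico n T, s t * x * ∏ j ∈ Finset.Ico (t + 1) T, (1 - s j * x) ^ 2 ≤ 1 := by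
  induction T with
  | zero => simp
  | succ T ih =>
    by_cases hn : n ≤ T
    · have e : ∑ t ∈ Finset.Ico n (T + 1),
          s t * x * ∏ j ∈ Finset.Ico (t + 1) (T + 1), (1 - s j * x) ^ 2
          = (1 - s T * x) ^ 2 * (∑ t ∈ Finset.Ico n T,
            s t * x * ∏ j ∈ Finset.Ico (t + 1) T, (1 - s j * x) ^ 2) + s T * x := by
        rw [Finset.sum_Ico_succ_top hn, Finset.mul_sum]
        congr 1
        · refine Finset.sum_congr rfl fun t ht => ?_
          rw [Finset.prod_Ico_succ_top (by have := Finset.mem_Ico.1 ht; omega)]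
          ring
        · simp
      rw [e]
      have h2 := h0 T
      have h3 := h1 T
      have h4 : (1 - s T * x) ^ 2 * (∑ t ∈ Finset.Ico n T,
            s t * x * ∏ j ∈ Finset.Ico (t + 1) T, (1 - s j * x) ^ 2) ≤ (1 - s T * x) ^ 2 * 1 := by
        gcongr
      nlinarith
    · rw [Finset.Ico_eq_empty (by omega)]; simp

/-- The step sizes `η t^{-θ}`; the index `t` stands for `t + 1`. -/
def stepSize (η θ : ℝ) (t : ℕ) : ℝ := η * ((t + 1 : ℕ) : ℝ) ^ (-θ)

variable {η θ : ℝ}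

lemma stepSize_nonneg (hη : 0 ≤ η) (t : ℕ) : 0 ≤ stepSize η θ t := by
  unfold stepSize; positivity

lemma stepSize_le (hη : 0 ≤ η) (hθ : 0 ≤ θ) (t : ℕ) : stepSize η θ t ≤ η := by
  unfold stepSize
  refine mul_le_of_le_one_right hη (Real.rpow_le_one_of_one_le_of_nonpos ?_ (by linarith))
  push_cast; linarith [Nat.cast_nonneg (α := ℝ) t]

lemma exists_sum_stepSize_sq_le (η : ℝ) (hθ : 1 / 2 < θ) :
    ∃ V : ℝ, 0 ≤ V ∧ ∀ T, ∑ t ∈ Finset.range T, stepSize η θ t ^ 2 ≤ V := by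
  have h1 : Summable fun n : ℕ => (n : ℝ) ^ (-(2 * θ)) := by
    rw [Real.summable_nat_rpow]; linarith
  have h2 : Summable fun n : ℕ => stepSize η θ n ^ 2 := by
    refine (((summable_nat_add_iff 1).2 h1).mul_left (η ^ 2)).congr fun n => ?_
    unfold stepSize
    rw [mul_pow, ← Real.rpow_natCast (_ ^ (-θ)), ← Real.rpow_mul (by positivity)]
    congr 2; push_cast; ring
  exact ⟨∑' n, stepSize η θ n ^ 2, tsum_nonneg fun _ => sq_nonneg _, fun T =>
    h2.sum_le_tsum _ fun _ _ => sq_nonneg _⟩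

lemma stepSize_late_le (hη : 0 ≤ η) (hθ : 0 ≤ θ) (hθ1 : θ ≤ 1) {T t : ℕ} (hT : 1 ≤ T)
    (ht : T / 2 ≤ t) : stepSize η θ t ≤ 2 * η * (T : ℝ) ^ (-θ) := by
  unfold stepSize
  have hT0 : (0 : ℝ) < T := by exact_mod_cast hT
  have h1 : (T : ℝ) / 2 ≤ ((t + 1 : ℕ) : ℝ) := by
    -- `T / 2` rounds down; the shift of the index by one compensates.
    have : T ≤ 2 * (t + 1) := by omega
    have : (T : ℝ) ≤ 2 * ((t + 1 : ℕ) : ℝ) := by exact_mod_cast this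
    linarith
  have h2 : ((t + 1 : ℕ) : ℝ) ^ (-θ) ≤ ((T : ℝ) / 2) ^ (-θ) :=
    Real.rpow_le_rpow_of_nonpos (by positivity) h1 (by linarith)
  have h3 : ((T : ℝ) / 2) ^ (-θ) = (T : ℝ) ^ (-θ) * 2 ^ θ := by
    rw [Real.div_rpow hT0.le (by norm_num), Real.rpow_neg (x := 2) (by norm_num)]
    field_simp
  have h4 : (2 : ℝ) ^ θ ≤ 2 := by
    simpa using Real.rpow_le_rpow_of_exponent_le (x := 2) (by norm_num) hθ1
  calc η * ((t + 1 : ℕ) : ℝ) ^ (-θ) ≤ η * ((T : ℝ) ^ (-θ) * 2) := by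
        gcongr; rw [h3] at h2; exact h2.trans (by gcongr)
    _ = _ := by ring

lemma sum_stepSize_late_ge (hη : 0 ≤ η) (hθ : 0 ≤ θ) {T n : ℕ} (hT : 1 ≤ T)
    (hn : n ≤ T / 2) :
    η / 2 * (T : ℝ) ^ (1 - θ) ≤ ∑ j ∈ Finset.Ico n T, stepSize η θ j := by
  have hT0 : (0 : ℝ) < T := by exact_mod_cast hT
  have h1 : ∀ j ∈ Finset.Ico n T, η * (T : ℝ) ^ (-θ) ≤ stepSize η θ j := by
    intro j hj
    unfold stepSize
    refine mul_le_mul_of_nonneg_left ?_ hη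
    refine Real.rpow_le_rpow_of_nonpos (by positivity) ?_ (by linarith)
    have := (Finset.mem_Ico.1 hj).2
    exact_mod_cast this
  refine le_trans ?_ (Finset.card_nsmul_le_sum _ _ _ h1)
  rw [Nat.card_Ico, nsmul_eq_mul, sub_eq_add_neg, Real.rpow_add hT0, Real.rpow_one]
  have h2 : (T : ℝ) / 2 ≤ ((T - n : ℕ) : ℝ) := by
    have : T ≤ 2 * (T - n) := by omega
    have : (T : ℝ) ≤ 2 * ((T - n : ℕ) : ℝ) := by exact_mod_cast this
    linarith
  calc η / 2 * ((T : ℝ) * (T : ℝ) ^ (-θ)) = (T : ℝ) / 2 * (η * (T : ℝ) ^ (-θ)) := by ring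
    _ ≤ _ := by gcongr

/-- The accumulated gradient noise in a direction with eigenvalue `x`. -/
lemma noise_sum_le (hη : 0 ≤ η) (hθ : 0 ≤ θ) (hθ1 : θ ≤ 1) {T : ℕ} (hT : 1 ≤ T) {x lam V : ℝ}
    (hx : 0 ≤ x) (hlam : 0 ≤ lam) (hstep : ∀ j, stepSize η θ j * (x + lam) ≤ 1)
    (hV : ∀ T, ∑ t ∈ Finset.range T, stepSize η θ t ^ 2 ≤ V) :
    x ^ 2 * ∑ t ∈ Finset.range T, stepSize η θ t ^ 2
        * ∏ j ∈ Finset.Ico (t + 1) T, (1 - stepSize η θ j * (x + lam)) ^ 2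
      ≤ V * (x ^ 2 * Real.exp (-(x + lam) * (η * (T : ℝ) ^ (1 - θ))))
        + 2 * η * (T : ℝ) ^ (-θ) * x := by
  set s := stepSize η θ with hs
  have hs0 : ∀ t, 0 ≤ s t := stepSize_nonneg hη
  rw [← Finset.sum_range_add_sum_Ico _ (Nat.div_le_self T 2), mul_add]
  refine add_le_add ?_ ?_
  -- Noise of the first half: at least half of the steps are still to come and damp it
  -- exponentially, and the squared step sizes sum to at most V.
  · have h1 : ∀ t ∈ Finset.range (T / 2), s t ^ 2
        * ∏ j ∈ Finset.Ico (t + 1) T, (1 - s j * (x + lam)) ^ 2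
        ≤ s t ^ 2 * Real.exp (-(x + lam) * (η * (T : ℝ) ^ (1 - θ))) := by
      intro t ht
      gcongr
      refine (prod_one_sub_sq_le_exp _ hstep).trans (Real.exp_le_exp.2 ?_)
      have h2 := sum_stepSize_late_ge (θ := θ) hη hθ hT
        (n := t + 1) (by have := Finset.mem_range.1 ht; omega)
      have h3 : 0 ≤ x + lam := by linarith
      nlinarith
    calc _ ≤ x ^ 2 * ∑ t ∈ Finset.range (T / 2),
            s t ^ 2 * Real.exp (-(x + lam) * (η * (T : ℝ) ^ (1 - θ))) := by
          exact mul_le_mul_of_nonneg_left (Finset.sum_le_sum h1) (sq_nonneg x)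
      _ = (∑ t ∈ Finset.range (T / 2), s t ^ 2)
          * (x ^ 2 * Real.exp (-(x + lam) * (η * (T : ℝ) ^ (1 - θ)))) := by
          rw [← Finset.sum_mul]; ring
      _ ≤ _ := by gcongr; exact hV _
  -- Noise of the second half: one factor s t is at most 2 η T^(-θ), the other is spent on the sum
  -- bounded by `sum_step_mul_prod_le_one`.
  · have h0 : ∀ j, 0 ≤ s j * (x + lam) := fun j => by have := hs0 j; positivity
    have h1 := sum_step_mul_prod_le_one h0 hstep (T / 2) T
    rw [Finset.mul_sum]
    calc _ ≤ ∑ t ∈ Finset.Ico (T / 2) T, (2 * η * (T : ℝ) ^ (-θ) * x)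
            * (s t * (x + lam) * ∏ j ∈ Finset.Ico (t + 1) T, (1 - s j * (x + lam)) ^ 2) := by
          refine Finset.sum_le_sum fun t ht => ?_
          have h2 : s t ≤ 2 * η * (T : ℝ) ^ (-θ) :=
            stepSize_late_le hη hθ hθ1 hT (Finset.mem_Ico.1 ht).1
          have h3 : 0 ≤ ∏ j ∈ Finset.Ico (t + 1) T, (1 - s j * (x + lam)) ^ 2 :=
            Finset.prod_nonneg fun _ _ => sq_nonneg _
          have h4 := hs0 t
          calc x ^ 2 * (s t ^ 2 * ∏ j ∈ Finset.Ico (t + 1) T, (1 - s j * (x + lam)) ^ 2)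
              = s t * x * (s t * x * ∏ j ∈ Finset.Ico (t + 1) T, (1 - s j * (x + lam)) ^ 2) := by
                ring
            _ ≤ _ := by
                gcongr
                linarith
      _ ≤ _ := by
          rw [← Finset.mul_sum]
          exact mul_le_of_le_one_right (by positivity) h1

/-- From exp y ≥ y² / 2 with y = η (x + lam) / lam. Damping over time 1 / lam thus acts like the
squared ridge filter, the summand of the effective dimension. -/
lemma sq_mul_exp_le_effectiveDim {x lam η : ℝ} (hx : 0 ≤ x) (hlam : 0 < lam) (hη : 0 < η) :
    x ^ 2 * Real.exp (-(x + lam) * (η * (1 / lam)))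
      ≤ 2 / η ^ 2 * lam ^ 2 * (x / (x + lam)) ^ 2 := by
  have hp : 0 < x + lam := by linarith
  set y := η * ((x + lam) / lam) with hy
  have hy0 : 0 < y := by positivity
  have e1 : -(x + lam) * (η * (1 / lam)) = -y := by rw [hy]; field_simp
  have e2 : y ^ 2 / 2 ≤ Real.exp y := by
    have := Real.quadratic_le_exp_of_nonneg hy0.le; linarith
  rw [e1, Real.exp_neg]
  calc x ^ 2 * (Real.exp y)⁻¹ ≤ x ^ 2 * (y ^ 2 / 2)⁻¹ := by gcongr
    _ = _ := by rw [hy]; field_simp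

/-- The form with x⁻¹ fits `sum_inner_sq_div_le`. At x = 0 both sides vanish, by 0⁻¹ = 0. -/
lemma mul_mul_exp_le {x S : ℝ} (hx : 0 ≤ x) (hS : 0 < S) :
    x * Real.exp (-2 * x * S) ≤ (1 / S) ^ 2 * x⁻¹ := by
  rcases hx.eq_or_lt with h | h
  · rw [← h]; simp
  · have h1 : x * S ≤ Real.exp (x * S) := by linarith [Real.add_one_le_exp (x * S)]
    have h2 : Real.exp (-2 * x * S) = ((Real.exp (x * S)) ^ 2)⁻¹ := by
      rw [← Real.exp_nat_mul, ← Real.exp_neg]; congr 1; push_cast; ring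
    rw [h2]
    calc x * ((Real.exp (x * S)) ^ 2)⁻¹ ≤ x * ((x * S) ^ 2)⁻¹ := by gcongr
      _ = _ := by field_simp

/-- The exponential dominates the k-th term of its series, and k is chosen with a k ≥ θ. -/
lemma exp_neg_mul_rpow_le {η a θ : ℝ} (hη : 0 < η) (ha : 0 < a) :
    ∃ C : ℝ, 0 ≤ C ∧ ∀ T : ℝ, 1 ≤ T → Real.exp (-(η * T ^ a)) ≤ C * T ^ (-θ) := by
  obtain ⟨k, hk⟩ := exists_nat_ge (θ / a)
  refine ⟨k.factorial / η ^ k, by positivity, fun T hT => ?_⟩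
  have hT0 : 0 < T := by linarith
  have h1 : (η * T ^ a) ^ k / k.factorial ≤ Real.exp (η * T ^ a) :=
    Real.pow_div_factorial_le_exp _ (by positivity) k
  rw [Real.exp_neg]
  calc (Real.exp (η * T ^ a))⁻¹ ≤ ((η * T ^ a) ^ k / k.factorial)⁻¹ := by
        gcongr
    _ = k.factorial / η ^ k * T ^ (-(a * k)) := by
        rw [mul_pow, ← Real.rpow_natCast (T ^ a), ← Real.rpow_mul hT0.le, Real.rpow_neg hT0.le]
        field_simp
    _ ≤ _ := by
        gcongr
        rw [div_le_iff₀ ha] at hk; linarith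

end StepSizes

/-! ### From coordinate moments to the prediction error -/

section Spectral

variable {K : Type*} [NormedAddCommGroup K] [InnerProductSpace ℝ K]

/-- Directions with eigenvalue 0 are excluded because p i vanishes there and cannot be normalized.
-/
lemma orthonormal_normalize {ι : Type*} [DecidableEq ι] {p : ι → K} {ev : ι → ℝ}
    (hp : ∀ i j, inner ℝ (p i) (p j) = if i = j then ev i else 0) :
    Orthonormal ℝ fun i : {i // ev i ≠ 0} => (Real.sqrt (ev i))⁻¹ • p i := by
  have hev : ∀ i, 0 ≤ ev i := fun i => by
    have := hp i i; simp only [if_true] at this; rw [← this]; exact real_inner_self_nonneg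
  rw [orthonormal_iff_ite]
  rintro ⟨i, hi⟩ ⟨j, hj⟩
  rw [inner_smul_left, inner_smul_right, hp]
  simp only [Subtype.mk.injEq, conj_trivial]
  split_ifs with h
  · subst h
    have h1 : Real.sqrt (ev i) ≠ 0 := (Real.sqrt_pos.2 ((hev i).lt_of_ne' hi)).ne'
    field_simp
    exact (Real.sq_sqrt (hev i)).symm
  · simp

lemma sum_subtype_ne_zero {ι : Type*} [Fintype ι] {ev F : ι → ℝ} (hF : ∀ i, ev i = 0 → F i = 0) :
    ∑ i : {i // ev i ≠ 0}, F i = ∑ i, F i := by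
  classical
  rw [← Fintype.sum_subtype_add_sum_subtype (fun i => ev i ≠ 0) F, left_eq_add]
  exact Finset.sum_eq_zero fun i _ => hF _ (not_not.1 i.2)

variable {ι : Type*} [Fintype ι] [DecidableEq ι] {p : ι → K} {ev : ι → ℝ}

/-- Bessel's inequality for the normalized p i; zero eigenvalues contribute nothing, by 0⁻¹ = 0. -/
lemma sum_inner_sq_div_le (hp : ∀ i j, inner ℝ (p i) (p j) = if i = j then ev i else 0) (w : K) :
    ∑ i, inner ℝ (p i) w ^ 2 * (ev i)⁻¹ ≤ ‖w‖ ^ 2 := by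
  have hev : ∀ i, 0 ≤ ev i := fun i => by
    have := hp i i; simp only [if_true] at this; rw [← this]; exact real_inner_self_nonneg
  have h := (orthonormal_normalize hp).sum_inner_products_le w (s := Finset.univ)
  refine le_trans (le_of_eq ?_) h
  rw [← sum_subtype_ne_zero (ev := ev) (fun i hi => by rw [hi]; simp)]
  refine Finset.sum_congr rfl fun i _ => ?_
  rw [inner_smul_left, conj_trivial, Real.norm_eq_abs, sq_abs, mul_pow, inv_pow,
    Real.sq_sqrt (hev i)]
  ring

/-- The spectral part of the analysis of the last iterate: if the second moments `a i` of the
coordinates of the error satisfy the bound of `IsLinearModel.integral_inner_linSgd_le`, then the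
mean squared prediction error is controlled by bias, early noise and late noise. -/
theorem sum_ev_mul_le (hp : ∀ i j, inner ℝ (p i) (p j) = if i = j then ev i else 0)
    {η θ lam V D κ : ℝ} (hη : 0 < η) (hθ : 0 ≤ θ) (hθ1 : θ ≤ 1) {T : ℕ} (hT : 1 ≤ T)
    (hlam : (T : ℝ) ^ (-(1 - θ)) ≤ lam) (hstep : ∀ i j, stepSize η θ j * (ev i + lam) ≤ 1)
    (hV : ∀ T, ∑ t ∈ Finset.range T, stepSize η θ t ^ 2 ≤ V) (hD : 0 ≤ D)
    (htr : ∑ i, ev i ≤ κ ^ 2) {w : K} {a : ι → ℝ}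
    (ha : ∀ i, a i ≤ (∏ j ∈ Finset.range T, (1 - stepSize η θ j * (ev i + lam)) ^ 2)
        * inner ℝ (p i) w ^ 2 + D * ev i * ∑ t ∈ Finset.range T, stepSize η θ t ^ 2
            * ∏ j ∈ Finset.Ico (t + 1) T, (1 - stepSize η θ j * (ev i + lam)) ^ 2) :
    ∑ i, ev i * a i ≤ 4 / η ^ 2 * (lam * ‖w‖) ^ 2
      + D * (V * ∑ i, ev i ^ 2 * Real.exp (-(ev i + lam) * (η * (T : ℝ) ^ (1 - θ)))
        + 2 * η * (T : ℝ) ^ (-θ) * κ ^ 2) := by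
  have hT0 : (0 : ℝ) < T := by exact_mod_cast hT
  have hlam0 : 0 < lam := lt_of_lt_of_le (by positivity) hlam
  have hev : ∀ i, 0 ≤ ev i := fun i => by
    have := hp i i; simp only [if_true] at this; rw [← this]; exact real_inner_self_nonneg
  set S := η / 2 * (T : ℝ) ^ (1 - θ) with hS
  have hS0 : 0 < S := by positivity
  -- The total step length is at least of order 1 / lam, so what is left of the zero start costs at
  -- most a multiple of the squared ridge residual (lam ‖w‖)².
  have hSlam : 1 / S ≤ 2 / η * lam := by
    rw [Real.rpow_neg hT0.le] at hlam
    calc 1 / S = 2 / η * ((T : ℝ) ^ (1 - θ))⁻¹ := by rw [hS]; field_simp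
      _ ≤ _ := by gcongr
  have hterm : ∀ i, ev i * a i ≤ (1 / S) ^ 2 * (inner ℝ (p i) w ^ 2 * (ev i)⁻¹)
      + D * (V * (ev i ^ 2 * Real.exp (-(ev i + lam) * (η * (T : ℝ) ^ (1 - θ))))
        + 2 * η * (T : ℝ) ^ (-θ) * ev i) := by
    intro i
    have h1 : ∏ j ∈ Finset.range T, (1 - stepSize η θ j * (ev i + lam)) ^ 2
        ≤ Real.exp (-2 * ev i * S) := by
      refine (prod_one_sub_sq_le_exp _ (hstep i)).trans (Real.exp_le_exp.2 ?_)
      have h2 := sum_stepSize_late_ge (θ := θ) hη.le hθ hT (n := 0) (by omega)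
      rw [← Finset.range_eq_Ico, ← hS] at h2
      have h3 := hev i
      nlinarith [mul_le_mul_of_nonneg_left h2 h3, mul_nonneg hlam0.le (hS0.le.trans h2)]
    have h2 := noise_sum_le hη.le hθ hθ1 hT (hev i) hlam0.le (hstep i) hV
    have h3 := mul_le_mul_of_nonneg_left (ha i) (hev i)
    have h4 : ev i * Real.exp (-2 * ev i * S) * inner ℝ (p i) w ^ 2
        ≤ (1 / S) ^ 2 * (ev i)⁻¹ * inner ℝ (p i) w ^ 2 :=
      mul_le_mul_of_nonneg_right (mul_mul_exp_le (hev i) hS0) (sq_nonneg _)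
    have h5 : ev i * (∏ j ∈ Finset.range T, (1 - stepSize η θ j * (ev i + lam)) ^ 2)
        * inner ℝ (p i) w ^ 2 ≤ ev i * Real.exp (-2 * ev i * S) * inner ℝ (p i) w ^ 2 := by
      have := hev i
      gcongr
    have h6 := mul_le_mul_of_nonneg_left h2 hD
    linarith
  refine (Finset.sum_le_sum fun i _ => hterm i).trans ?_
  rw [Finset.sum_add_distrib, ← Finset.mul_sum, ← Finset.mul_sum, Finset.sum_add_distrib,
    ← Finset.mul_sum, ← Finset.mul_sum]
  have hfirst : (1 / S) ^ 2 * ∑ i, inner ℝ (p i) w ^ 2 * (ev i)⁻¹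
      ≤ 4 / η ^ 2 * (lam * ‖w‖) ^ 2 := by
    calc _ ≤ (2 / η * lam) ^ 2 * ‖w‖ ^ 2 := by
          refine mul_le_mul (by gcongr) (sum_inner_sq_div_le hp w) ?_ (sq_nonneg _)
          exact Finset.sum_nonneg fun i _ => mul_nonneg (sq_nonneg _) (inv_nonneg.2 (hev i))
      _ = _ := by ring
  gcongr

end Spectral


/-! ### Concentration of empirical means in mean square -/

section Concentration

/-- The weight exp (g² / 4) turns the standard Gaussian density into √2 times the density of
variance 2. -/
lemma lintegral_exp_sq_div_four_gaussianReal :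
    ∫⁻ g, ENNReal.ofReal (Real.exp (g ^ 2 / 4)) ∂(gaussianReal 0 1) ≤ 2 := by
  rw [gaussianReal_of_var_ne_zero _ one_ne_zero,
    lintegral_withDensity_eq_lintegral_mul _ (measurable_gaussianPDF _ _) (by fun_prop)]
  have h : ∀ g : ℝ, (gaussianPDF 0 1 * fun g => ENNReal.ofReal (Real.exp (g ^ 2 / 4))) g
      ≤ 2 * gaussianPDF 0 2 g := by
    intro g
    simp only [Pi.mul_apply, gaussianPDF, gaussianPDFReal]
    rw [← ENNReal.ofReal_mul (by positivity), show (2 : ENNReal) = ENNReal.ofReal 2 by simp,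
      ← ENNReal.ofReal_mul (by norm_num)]
    refine ENNReal.ofReal_le_ofReal ?_
    have e1 : Real.exp (-(g - 0) ^ 2 / (2 * ((1 : NNReal) : ℝ))) * Real.exp (g ^ 2 / 4)
        = Real.exp (-(g - 0) ^ 2 / (2 * ((2 : NNReal) : ℝ))) := by
      rw [← Real.exp_add]; congr 1; push_cast; ring
    rw [mul_assoc, e1, ← mul_assoc]
    refine mul_le_mul_of_nonneg_right ?_ (Real.exp_pos _).le
    have e2 : Real.sqrt (2 * Real.pi * ((2 : NNReal) : ℝ))
        = Real.sqrt 2 * Real.sqrt (2 * Real.pi * ((1 : NNReal) : ℝ)) := by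
      rw [← Real.sqrt_mul (by norm_num)]; congr 1; push_cast; ring
    rw [e2, mul_inv, ← mul_assoc]
    refine le_mul_of_one_le_left (by positivity) ?_
    have e3 : Real.sqrt 2 ≤ 2 := by
      rw [Real.sqrt_le_left (by norm_num)]; norm_num
    rw [← div_eq_mul_inv, le_div_iff₀ (by positivity)]
    linarith
  calc _ ≤ ∫⁻ g, 2 * gaussianPDF 0 2 g := lintegral_mono h
    _ = 2 := by
      rw [lintegral_const_mul _ (measurable_gaussianPDF _ _),
        lintegral_gaussianPDF_eq_one _ two_ne_zero, mul_one]

/-- Linearizes a square in the exponent: after integrating against an independent Gaussian g, only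
the moment generating function of the variable is needed. -/
lemma ofReal_exp_sq_eq_lintegral_gaussianReal (t : ℝ) :
    ENNReal.ofReal (Real.exp (t ^ 2 / 2))
      = ∫⁻ g, ENNReal.ofReal (Real.exp (t * g)) ∂(gaussianReal 0 1) := by
  have h := mgf_gaussianReal (p := gaussianReal 0 1) (X := id) (μ := 0) (v := 1)
    (by simp) t
  have hi : Integrable (fun g : ℝ => Real.exp (t * g)) (gaussianReal 0 1) :=
    integrable_exp_mul_gaussianReal t
  rw [← ofReal_integral_eq_lintegral_ofReal hi (.of_forall fun _ => (Real.exp_pos _).le)]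
  simp only [mgf, id] at h
  rw [h]; simp

/-- The square of a sub-Gaussian random variable has a finite exponential moment. -/
theorem lintegral_exp_sq_le_two_of_hasSubgaussianMGF {Ω : Type*} [MeasurableSpace Ω]
    {P : Measure Ω} [IsProbabilityMeasure P] {X : Ω → ℝ} {c : NNReal} (hX : Measurable X)
    (hc : 0 < c) (h : HasSubgaussianMGF X c P) :
    ∫⁻ ω, ENNReal.ofReal (Real.exp (X ω ^ 2 / (4 * c))) ∂P ≤ 2 := by
  have hc' : (0 : ℝ) < c := hc
  -- Chosen so that X² / (4c) = (kX)² / 2; the sub-Gaussian bound at k g is then exp (g² / 4).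
  set k := (Real.sqrt (2 * c))⁻¹ with hk
  have hk2 : k ^ 2 = 1 / (2 * c) := by
    rw [hk, inv_pow, Real.sq_sqrt (by positivity), one_div]
  have h1 : ∀ ω, ENNReal.ofReal (Real.exp (X ω ^ 2 / (4 * c)))
      = ∫⁻ g, ENNReal.ofReal (Real.exp (k * X ω * g)) ∂(gaussianReal 0 1) := by
    intro ω
    rw [← ofReal_exp_sq_eq_lintegral_gaussianReal, mul_pow, hk2]
    congr 2; field_simp; norm_num
  simp_rw [h1]
  rw [lintegral_lintegral_swap (by fun_prop)]
  refine le_trans (lintegral_mono fun g => ?_) lintegral_exp_sq_div_four_gaussianReal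
  have h2 := h.mgf_le (k * g)
  have h3 := h.integrable_exp_mul (k * g)
  simp only [mgf] at h2
  have h4 : ∀ ω, k * X ω * g = k * g * X ω := fun ω => by ring
  simp_rw [h4]
  rw [← ofReal_integral_eq_lintegral_ofReal h3 (.of_forall fun _ => (Real.exp_pos _).le)]
  refine ENNReal.ofReal_le_ofReal (h2.trans (le_of_eq ?_))
  rw [mul_pow, hk2]; congr 1; field_simp; ring

/-- Concentration, in mean square over `y`, of the empirical mean of `ψ (w r) y` around its
expectation. -/
theorem measure_meanSquare_deviation_le {B Y : Type*} [MeasurableSpace B] [MeasurableSpace Y]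
    {P : Measure B} [IsProbabilityMeasure P] {τ : Measure Y} [IsProbabilityMeasure τ]
    {ψ : B → Y → ℝ} (hψ : Measurable (Function.uncurry ψ)) {A : ℝ} (hA : 0 < A)
    {SB : B → Prop} {SY : Y → Prop} (hB : ∀ᵐ b ∂P, SB b) (hY : ∀ᵐ y ∂τ, SY y)
    (hbd : ∀ b y, SB b → SY y → |ψ b y| ≤ A) {m : ℕ} (hm : 1 ≤ m) {δ : ℝ} (hδ : 0 < δ) :
    (Measure.pi fun _ : Fin m => P) {w | 4 * A ^ 2 * Real.log (2 / δ) / m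
      < ∫ y, ((m : ℝ)⁻¹ * ∑ r, ψ (w r) y - ∫ b, ψ b y ∂P) ^ 2 ∂τ} ≤ ENNReal.ofReal δ := by
  set Pm := Measure.pi fun _ : Fin m => P with hPm
  set k : Y → ℝ := fun y => ∫ b, ψ b y ∂P with hk
  have hm0 : (0 : ℝ) < m := by exact_mod_cast hm
  have hkm : Measurable k := by
    have : Measurable (Function.uncurry fun y b => ψ b y) := hψ.comp measurable_swap
    exact (this.stronglyMeasurable.integral_prod_right).measurable
  have hψ1 : ∀ y, Measurable fun b => ψ b y := fun y => hψ.comp measurable_prodMk_right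
  have hD : Measurable fun q : (Fin m → B) × Y => (m : ℝ)⁻¹ * ∑ r, ψ (q.1 r) q.2 - k q.2 := by
    refine (Measurable.const_mul (Finset.measurable_sum _ fun r _ => ?_) _).sub
      (hkm.comp measurable_snd)
    have h1 : Measurable fun q : (Fin m → B) × Y => (q.1 r, q.2) := by fun_prop
    exact hψ.comp h1
  set D : (Fin m → B) → Y → ℝ := fun w y => (m : ℝ)⁻¹ * ∑ r, ψ (w r) y - k y with hDdef
  -- The sum m D of m centred terms is sub-Gaussian with parameter m A², and (m D)² / (4 m A²) = a
  -- D².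
  set a : ℝ := m / (4 * A ^ 2) with ha
  have ha0 : 0 < a := by positivity
  have hkbd : ∀ y, SY y → |k y| ≤ A := by
    intro y hy
    have := norm_integral_le_of_norm_le_const (μ := P) (f := fun b => ψ b y) (C := A)
      (by filter_upwards [hB] with b hb using hbd b y hb hy)
    simpa using this
  have hexp : ∀ y, SY y → ∫⁻ w, ENNReal.ofReal (Real.exp (a * D w y ^ 2)) ∂Pm ≤ 2 := by
    intro y hy
    -- The parameter that Hoeffding's lemma assigns to the interval [-A, A]; it equals A².
    set c : NNReal := (‖A - -A‖₊ / 2) ^ 2 with hc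
    have hcA : (c : ℝ) = A ^ 2 := by
      rw [hc]; push_cast
      rw [Real.norm_eq_abs, sub_neg_eq_add, ← two_mul, abs_of_pos (by positivity)]; ring
    have hsub : ∀ r : Fin m, HasSubgaussianMGF (fun w : Fin m → B => ψ (w r) y - k y) c Pm := by
      intro r
      have hmp := measurePreserving_eval (fun _ : Fin m => P) r
      have h1 := hasSubgaussianMGF_of_mem_Icc (μ := Pm) (X := fun w : Fin m → B => ψ (w r) y)
        (a := -A) (b := A) ((hψ1 y).comp (measurable_pi_apply r)).aemeasurable
        (by
          filter_upwards [hmp.quasiMeasurePreserving.ae hB] with w hw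
          exact abs_le.1 (hbd _ _ hw hy))
      have h2 : ∫ w, ψ (w r) y ∂Pm = k y := by
        have h3 := integral_map (μ := Pm) hmp.measurable.aemeasurable
          (hψ1 y).aestronglyMeasurable
        rw [hmp.map_eq] at h3
        exact h3.symm
      rwa [h2] at h1
    have hind : iIndepFun (fun (r : Fin m) (w : Fin m → B) => ψ (w r) y - k y) Pm :=
      iIndepFun_pi (X := fun _ b => ψ b y - k y) fun r => ((hψ1 y).sub_const _).aemeasurable
    have hsum := HasSubgaussianMGF.sum_of_iIndepFun hind (s := Finset.univ) fun r _ => hsub r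
    have hmeas : Measurable fun w : Fin m → B => ∑ r, (ψ (w r) y - k y) :=
      Finset.measurable_sum _ fun r _ => ((hψ1 y).comp (measurable_pi_apply r)).sub_const _
    have hcs : ((∑ _r : Fin m, c : NNReal) : ℝ) = m * A ^ 2 := by
      simp [hcA]
    have hres := lintegral_exp_sq_le_two_of_hasSubgaussianMGF hmeas
      (by rw [← NNReal.coe_pos, hcs]; positivity) hsum
    refine le_trans (le_of_eq (lintegral_congr fun w => ?_)) hres
    congr 2
    rw [hcs, Finset.sum_sub_distrib]
    simp only [hDdef, ha, Finset.sum_const, Finset.card_univ, Fintype.card_fin, nsmul_eq_mul]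
    field_simp
  set U : (Fin m → B) → ENNReal := fun w => ∫⁻ y, ENNReal.ofReal (Real.exp (a * D w y ^ 2)) ∂τ
    with hU
  have hmeasE : Measurable fun q : (Fin m → B) × Y =>
      ENNReal.ofReal (Real.exp (a * D q.1 q.2 ^ 2)) :=
    ENNReal.measurable_ofReal.comp (Real.measurable_exp.comp ((hD.pow_const 2).const_mul a))
  have hUm : Measurable U := hmeasE.lintegral_prod_right'
  have hUint : ∫⁻ w, U w ∂Pm ≤ 2 := by
    rw [hU, lintegral_lintegral_swap hmeasE.aemeasurable]
    calc _ ≤ ∫⁻ _, 2 ∂τ := lintegral_mono_ae (by filter_upwards [hY] with y hy using hexp y hy)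
      _ = 2 := by simp
  -- Jensen's inequality puts the mean over y into the exponent, so a single application of Markov's
  -- inequality to U controls the whole mean square, without a union bound over y.
  have hjensen : ∀ᵐ w ∂Pm, ENNReal.ofReal (Real.exp (∫ y, a * D w y ^ 2 ∂τ)) ≤ U w := by
    filter_upwards [ae_pi_of_ae hB m] with w hw
    have hDm : Measurable (D w) := hD.comp (measurable_const.prodMk measurable_id)
    have hDb : ∀ᵐ y ∂τ, |D w y| ≤ 2 * A := by
      filter_upwards [hY] with y hy
      have h1 : |∑ r, ψ (w r) y| ≤ m * A := by
        refine (Finset.abs_sum_le_sum_abs _ _).trans ?_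
        refine (Finset.sum_le_sum fun r _ => hbd (w r) y (hw r) hy).trans (le_of_eq ?_)
        simp
      have h2 : |(m : ℝ)⁻¹ * ∑ r, ψ (w r) y| ≤ A := by
        rw [abs_mul, abs_of_pos (inv_pos.2 hm0), inv_mul_le_iff₀ hm0]; exact h1
      exact (abs_sub _ _).trans (by linarith [hkbd y hy])
    have hb2 : ∀ᵐ y ∂τ, a * D w y ^ 2 ≤ a * (2 * A) ^ 2 := by
      filter_upwards [hDb] with y hy
      rw [← sq_abs]; gcongr
    have hi1 : Integrable (fun y => a * D w y ^ 2) τ := by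
      refine Integrable.of_bound ((hDm.pow_const 2).const_mul a).aestronglyMeasurable
        (a * (2 * A) ^ 2) ?_
      filter_upwards [hb2] with y hy
      rwa [Real.norm_eq_abs, abs_of_nonneg (by positivity)]
    have hi2 : Integrable (fun y => Real.exp (a * D w y ^ 2)) τ := by
      refine Integrable.of_bound
        (Real.measurable_exp.comp ((hDm.pow_const 2).const_mul a)).aestronglyMeasurable
        (Real.exp (a * (2 * A) ^ 2)) ?_
      filter_upwards [hb2] with y hy
      rw [Real.norm_eq_abs, abs_of_pos (Real.exp_pos _)]
      exact Real.exp_le_exp.2 hy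
    have hJ := convexOn_exp.map_integral_le Real.continuous_exp.continuousOn isClosed_univ
      (.of_forall fun _ => Set.mem_univ _) hi1 hi2
    simp only [hU]
    rw [← ofReal_integral_eq_lintegral_ofReal hi2 (.of_forall fun _ => (Real.exp_pos _).le)]
    exact ENNReal.ofReal_le_ofReal hJ
  have hsubset : Pm {w | 4 * A ^ 2 * Real.log (2 / δ) / m < ∫ y, D w y ^ 2 ∂τ}
      ≤ Pm {w | ENNReal.ofReal (2 / δ) ≤ U w} := by
    refine measure_mono_ae ?_
    filter_upwards [hjensen] with w hw hbad
    refine le_trans (ENNReal.ofReal_le_ofReal ?_) hw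
    rw [integral_const_mul, ← Real.log_le_iff_le_exp (by positivity)]
    have hbad' : 4 * A ^ 2 * Real.log (2 / δ) / m < ∫ y, D w y ^ 2 ∂τ := hbad
    rw [div_lt_iff₀ hm0] at hbad'
    rw [ha, div_mul_eq_mul_div, le_div_iff₀ (by positivity)]
    linarith
  refine hsubset.trans ?_
  have hmark := mul_meas_ge_le_lintegral hUm (μ := Pm) (ENNReal.ofReal (2 / δ))
  have h1 : ENNReal.ofReal (2 / δ) * Pm {w | ENNReal.ofReal (2 / δ) ≤ U w} ≤ 2 :=
    hmark.trans hUint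
  have h2 : ENNReal.ofReal (δ / 2) * ENNReal.ofReal (2 / δ) = 1 := by
    rw [← ENNReal.ofReal_mul (by positivity)]
    field_simp; simp
  calc Pm {w | ENNReal.ofReal (2 / δ) ≤ U w}
      = ENNReal.ofReal (δ / 2) * (ENNReal.ofReal (2 / δ)
        * Pm {w | ENNReal.ofReal (2 / δ) ≤ U w}) := by rw [← mul_assoc, h2, one_mul]
    _ ≤ ENNReal.ofReal (δ / 2) * 2 := by gcongr
    _ = ENNReal.ofReal δ := by
      rw [show (2 : ENNReal) = ENNReal.ofReal 2 by simp, ← ENNReal.ofReal_mul (by positivity)]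
      congr 1; ring

end Concentration


/-! ### Integral operators of bounded kernels on L² -/

section KernelOperator

set_option linter.unusedSectionVars false

variable {X : Type*} [MeasurableSpace X] {ν : Measure X} [IsProbabilityMeasure ν]

lemma norm_sq_Lp_two (f : Lp ℝ 2 ν) : ‖f‖ ^ 2 = ∫ x, f x ^ 2 ∂ν := by
  rw [← real_inner_self_eq_norm_sq, L2.inner_def]
  simp [sq]

lemma inner_Lp_two (f g : Lp ℝ 2 ν) : inner ℝ f g = ∫ x, f x * g x ∂ν := by
  rw [L2.inner_def]
  refine integral_congr_ae (.of_forall fun x => ?_)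
  simp [mul_comm]

lemma memLp_two_of_bounded {f : X → ℝ} (hf : Measurable f) {C : ℝ} (hC : ∀ᵐ x ∂ν, |f x| ≤ C) :
    MemLp f 2 ν := MemLp.of_bound hf.aestronglyMeasurable C hC

lemma integrable_mul_of_bounded (f : Lp ℝ 2 ν) {g : X → ℝ} (hg : Measurable g) {C : ℝ}
    (hC : ∀ᵐ x ∂ν, |g x| ≤ C) : Integrable (fun x => f x * g x) ν :=
  (Lp.memLp f).integrable_mul (memLp_two_of_bounded hg hC)

lemma inner_toLp {g : X → ℝ} (hg : MemLp g 2 ν) (f : Lp ℝ 2 ν) :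
    inner ℝ f hg.toLp = ∫ x, f x * g x ∂ν := by
  rw [inner_Lp_two]
  refine integral_congr_ae ?_
  filter_upwards [hg.coeFn_toLp] with x hx
  rw [hx]

/-- A measurable kernel that is bounded on a set of full measure. -/
structure IsBoundedKernel (k : X → X → ℝ) (R : X → Prop) (A : ℝ) : Prop where
  measurable : Measurable (Function.uncurry k)
  bound : ∀ x x', R x → R x' → |k x x'| ≤ A

variable {k : X → X → ℝ} {R : X → Prop} {A : ℝ}

lemma IsBoundedKernel.measurable_left (hk : IsBoundedKernel k R A) (x' : X) :
    Measurable fun x => k x x' := hk.measurable.comp measurable_prodMk_right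

lemma IsBoundedKernel.memLp (hk : IsBoundedKernel k R A) (hR : ∀ᵐ x ∂ν, R x) {x' : X}
    (hx' : R x') : MemLp (fun x => k x x') 2 ν :=
  memLp_two_of_bounded (hk.measurable_left x')
    (by filter_upwards [hR] with x hx using hk.bound x x' hx hx')

lemma IsBoundedKernel.abs_integral_le (hk : IsBoundedKernel k R A) (hR : ∀ᵐ x ∂ν, R x)
    (f : Lp ℝ 2 ν) {x' : X} (hx' : R x') : |∫ x, f x * k x x' ∂ν| ≤ A * ‖f‖ := by
  have hm := hk.memLp hR hx'
  have hA : 0 ≤ A := (abs_nonneg _).trans (hk.bound x' x' hx' hx')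
  rw [← inner_toLp hm]
  refine (abs_real_inner_le_norm _ _).trans ?_
  rw [mul_comm]
  gcongr
  refine le_of_sq_le_sq ?_ hA
  rw [norm_sq_Lp_two]
  calc ∫ x, (hm.toLp : Lp ℝ 2 ν) x ^ 2 ∂ν ≤ ∫ _, A ^ 2 ∂ν := by
        refine integral_mono_of_nonneg (.of_forall fun _ => sq_nonneg _) (integrable_const _) ?_
        filter_upwards [hm.coeFn_toLp, hR] with x hx hRx
        rw [hx, ← sq_abs]
        gcongr
        exact hk.bound x x' hRx hx'
    _ = A ^ 2 := by simp

lemma IsBoundedKernel.stronglyMeasurable_integral (hk : IsBoundedKernel k R A) (f : Lp ℝ 2 ν) :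
    StronglyMeasurable fun x' => ∫ x, f x * k x x' ∂ν := by
  have : StronglyMeasurable (Function.uncurry fun x' x => f x * k x x') :=
    ((Lp.stronglyMeasurable f).comp_measurable measurable_snd).mul
      (hk.measurable.comp measurable_swap).stronglyMeasurable
  exact this.integral_prod_right

lemma IsBoundedKernel.memLp_integral (hk : IsBoundedKernel k R A) (hR : ∀ᵐ x ∂ν, R x)
    (f : Lp ℝ 2 ν) : MemLp (fun x' => ∫ x, f x * k x x' ∂ν) 2 ν :=
  memLp_two_of_bounded (hk.stronglyMeasurable_integral f).measurable
    (by filter_upwards [hR] with x hx using hk.abs_integral_le hR f hx)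

/-- The integral operator of a bounded kernel as an operator on `L²`. -/
theorem IsBoundedKernel.exists_operator (hk : IsBoundedKernel k R A) (hR : ∀ᵐ x ∂ν, R x) :
    ∃ L : Lp ℝ 2 ν →L[ℝ] Lp ℝ 2 ν, ∀ f, L f =ᵐ[ν] fun x' => ∫ x, f x * k x x' ∂ν := by
  have hlin : ∀ f : Lp ℝ 2 ν, (hk.memLp_integral hR f).toLp =ᵐ[ν] fun x' => ∫ x, f x * k x x' ∂ν :=
    fun f => (hk.memLp_integral hR f).coeFn_toLp
  have hint : ∀ (f : Lp ℝ 2 ν) x', R x' → Integrable (fun x => f x * k x x') ν := fun f x' hx' =>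
    integrable_mul_of_bounded f (hk.measurable_left x') (C := A)
      (by filter_upwards [hR] with x hx using hk.bound x x' hx hx')
  obtain ⟨x₀, hx₀⟩ := hR.exists
  have hA : 0 ≤ A := (abs_nonneg _).trans (hk.bound x₀ x₀ hx₀ hx₀)
  let L₀ : Lp ℝ 2 ν →ₗ[ℝ] Lp ℝ 2 ν :=
    { toFun := fun f => (hk.memLp_integral hR f).toLp
      map_add' := by
        intro f g
        refine Lp.ext ?_
        filter_upwards [hlin (f + g), hlin f, hlin g, hR, Lp.coeFn_add
          (hk.memLp_integral hR f).toLp (hk.memLp_integral hR g).toLp] with x' h1 h2 h3 hx' h4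
        rw [h1, h4, Pi.add_apply, h2, h3, ← integral_add (hint f x' hx') (hint g x' hx')]
        refine integral_congr_ae ?_
        filter_upwards [Lp.coeFn_add f g] with x hx
        rw [hx, Pi.add_apply, add_mul]
      map_smul' := by
        intro c f
        refine Lp.ext ?_
        filter_upwards [hlin (c • f), hlin f, Lp.coeFn_smul c (hk.memLp_integral hR f).toLp]
          with x' h1 h2 h4
        rw [h1, RingHom.id_apply, h4, Pi.smul_apply, h2, smul_eq_mul, ← integral_const_mul]
        refine integral_congr_ae ?_
        filter_upwards [Lp.coeFn_smul c f] with x hx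
        rw [hx, Pi.smul_apply, smul_eq_mul, mul_assoc] }
  refine ⟨L₀.mkContinuous A fun f => ?_, fun f => hlin f⟩
  refine le_of_sq_le_sq ?_ (by positivity)
  rw [norm_sq_Lp_two]
  calc ∫ x, (L₀ f) x ^ 2 ∂ν ≤ ∫ _, (A * ‖f‖) ^ 2 ∂ν := by
        refine integral_mono_of_nonneg (.of_forall fun _ => sq_nonneg _) (integrable_const _) ?_
        filter_upwards [hlin f, hR] with x hx hRx
        have hx' : (L₀ f) x = ∫ y, f y * k y x ∂ν := hx
        rw [hx', ← sq_abs]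
        gcongr
        exact hk.abs_integral_le hR f hRx
    _ = (A * ‖f‖) ^ 2 := by simp

lemma IsBoundedKernel.integrable_prod (hk : IsBoundedKernel k R A) (hR : ∀ᵐ x ∂ν, R x)
    (f g : Lp ℝ 2 ν) :
    Integrable (fun q : X × X => f q.1 * k q.1 q.2 * g q.2) (ν.prod ν) := by
  have h1 : Integrable (fun q : X × X => f q.1 * g q.2) (ν.prod ν) :=
    ((Lp.memLp f).integrable one_le_two).mul_prod ((Lp.memLp g).integrable one_le_two)
  have hb : ∀ᵐ q ∂(ν.prod ν), ‖k q.1 q.2‖ ≤ A := by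
    filter_upwards [Measure.quasiMeasurePreserving_fst.ae hR,
      Measure.quasiMeasurePreserving_snd.ae hR] with q h1 h2 using hk.bound _ _ h1 h2
  refine (h1.bdd_mul hk.measurable.aestronglyMeasurable hb).congr (.of_forall fun q => ?_)
  simp [Function.uncurry]; ring

/-- The integral operator of a symmetric kernel is symmetric. -/
theorem IsBoundedKernel.inner_operator_symm (hk : IsBoundedKernel k R A) (hR : ∀ᵐ x ∂ν, R x)
    (hsymm : ∀ x x', k x x' = k x' x) {L : Lp ℝ 2 ν →L[ℝ] Lp ℝ 2 ν}
    (hL : ∀ f, L f =ᵐ[ν] fun x' => ∫ x, f x * k x x' ∂ν) (f g : Lp ℝ 2 ν) :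
    inner ℝ (L f) g = inner ℝ f (L g) := by
  rw [inner_Lp_two, inner_Lp_two]
  calc ∫ x', L f x' * g x' ∂ν = ∫ x', ∫ x, f x * k x x' * g x' ∂ν ∂ν := by
        refine integral_congr_ae ?_
        filter_upwards [hL f] with x' hx'
        rw [hx', integral_mul_const]
    _ = ∫ x, ∫ x', f x * k x x' * g x' ∂ν ∂ν := by
        rw [integral_integral_swap]
        exact (hk.integrable_prod hR f g).swap
    _ = ∫ x, f x * L g x ∂ν := by
        refine integral_congr_ae ?_
        filter_upwards [hL g] with x hx
        rw [hx, ← integral_const_mul]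
        refine integral_congr_ae (.of_forall fun x' => ?_)
        simp only [hsymm x' x]; ring

/-- The Hilbert-Schmidt bound for integral operators. -/
theorem IsBoundedKernel.sum_norm_sq_le (hk : IsBoundedKernel k R A) (hR : ∀ᵐ x ∂ν, R x)
    {ι : Type*} [Fintype ι] {f g : ι → Lp ℝ 2 ν} (hf : Orthonormal ℝ f)
    (hg : ∀ i, g i =ᵐ[ν] fun x' => ∫ x, f i x * k x x' ∂ν) :
    ∑ i, ‖g i‖ ^ 2 ≤ ∫ q, k q.1 q.2 ^ 2 ∂(ν.prod ν) := by
  have hb : ∀ᵐ q ∂(ν.prod ν), ‖k q.1 q.2 ^ 2‖ ≤ A ^ 2 := by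
    filter_upwards [Measure.quasiMeasurePreserving_fst.ae hR,
      Measure.quasiMeasurePreserving_snd.ae hR] with q h1 h2
    rw [norm_pow, Real.norm_eq_abs]
    gcongr
    exact hk.bound _ _ h1 h2
  have hi : Integrable (fun q : X × X => k q.1 q.2 ^ 2) (ν.prod ν) :=
    Integrable.of_bound (hk.measurable.pow_const 2).aestronglyMeasurable (A ^ 2) hb
  have hgi : ∀ i, Integrable (fun x => g i x ^ 2) ν := fun i => (Lp.memLp (g i)).integrable_sq
  simp_rw [norm_sq_Lp_two]
  rw [← integral_finsetSum _ fun i _ => hgi i, integral_prod_symm _ hi]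
  refine integral_mono_ae (integrable_finsetSum _ fun i _ => hgi i) hi.integral_prod_right ?_
  have hall : ∀ᵐ x' ∂ν, ∀ i, g i x' = ∫ x, f i x * k x x' ∂ν := by
    rw [ae_all_iff]; exact hg
  -- For fixed x', the values g i x' are the coefficients of the section k(·, x') in the orthonormal
  -- family f, so Bessel's inequality applies pointwise.
  filter_upwards [hall, hR] with x' hx' hRx'
  have hm := hk.memLp hR hRx'
  have hbes := hf.sum_inner_products_le (hm.toLp) (s := Finset.univ)
  simp only [Real.norm_eq_abs, sq_abs, inner_toLp, norm_sq_Lp_two] at hbes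
  calc ∑ i, g i x' ^ 2 = ∑ i, (∫ x, f i x * k x x' ∂ν) ^ 2 := by simp_rw [hx']
    _ ≤ _ := hbes
    _ = _ := by
      refine integral_congr_ae ?_
      filter_upwards [hm.coeFn_toLp] with x hx
      rw [hx]

end KernelOperator

/-! ### Features as an operator into L² -/

section Feature

variable {X : Type*} [MeasurableSpace X] {ν : Measure X} [IsProbabilityMeasure ν]
  {H : Type*} [NormedAddCommGroup H] [InnerProductSpace ℝ H] [FiniteDimensional ℝ H]
  [MeasurableSpace H] [BorelSpace H] {Φ : X → H} {κ : ℝ}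

lemma memLp_inner_feature (hΦ : Measurable Φ) (hκ : ∀ᵐ x ∂ν, ‖Φ x‖ ≤ κ) (u : H) :
    MemLp (fun x => inner ℝ (Φ x) u) 2 ν := by
  refine memLp_two_of_bounded (C := κ * ‖u‖) (by fun_prop) ?_
  filter_upwards [hκ] with x hx
  exact (abs_real_inner_le_norm _ _).trans (by gcongr)

/-- The operator `u ↦ ⟪Φ ·, u⟫` from the parameter space to `L²`, together with an orthonormal
eigenbasis of the covariance of the features. -/
theorem exists_feature_eigenbasis (hΦ : Measurable Φ) (hκ : ∀ᵐ x ∂ν, ‖Φ x‖ ≤ κ) :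
    ∃ (A : H →L[ℝ] Lp ℝ 2 ν) (e : OrthonormalBasis (Fin (Module.finrank ℝ H)) ℝ H)
      (ev : Fin (Module.finrank ℝ H) → ℝ),
      (∀ u, A u =ᵐ[ν] fun x => inner ℝ (Φ x) u) ∧
      ∀ i j, inner ℝ (A (e i)) (A (e j)) = if i = j then ev i else 0 := by
  have hA : ∀ u, (memLp_inner_feature hΦ hκ u).toLp =ᵐ[ν] fun x => inner ℝ (Φ x) u :=
    fun u => (memLp_inner_feature hΦ hκ u).coeFn_toLp
  let A₀ : H →ₗ[ℝ] Lp ℝ 2 ν :=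
    { toFun := fun u => (memLp_inner_feature hΦ hκ u).toLp
      map_add' := by
        intro u v
        refine Lp.ext ?_
        filter_upwards [hA (u + v), hA u, hA v, Lp.coeFn_add (memLp_inner_feature hΦ hκ u).toLp
          (memLp_inner_feature hΦ hκ v).toLp] with x h1 h2 h3 h4
        rw [h1, h4, Pi.add_apply, h2, h3, inner_add_right]
      map_smul' := by
        intro c u
        refine Lp.ext ?_
        filter_upwards [hA (c • u), hA u, Lp.coeFn_smul c (memLp_inner_feature hΦ hκ u).toLp]
          with x h1 h2 h4
        rw [h1, RingHom.id_apply, h4, Pi.smul_apply, h2, inner_smul_right, smul_eq_mul] }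
  let A : H →L[ℝ] Lp ℝ 2 ν := LinearMap.toContinuousLinearMap A₀
  -- The covariance of the features. Its eigenbasis has orthogonal images under A.
  let C : H →L[ℝ] H := (ContinuousLinearMap.adjoint A).comp A
  have hC : (C : H →ₗ[ℝ] H).IsSymmetric := by
    intro u v
    simp [C, ContinuousLinearMap.adjoint_inner_left, ContinuousLinearMap.adjoint_inner_right]
  refine ⟨A, hC.eigenvectorBasis rfl, hC.eigenvalues rfl, fun u => hA u, fun i j => ?_⟩
  have h1 : inner ℝ (A (hC.eigenvectorBasis rfl i)) (A (hC.eigenvectorBasis rfl j))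
      = inner ℝ (C (hC.eigenvectorBasis rfl i)) (hC.eigenvectorBasis rfl j) := by
    simp [C, ContinuousLinearMap.adjoint_inner_left]
  have h2 := hC.apply_eigenvectorBasis rfl i
  simp only [ContinuousLinearMap.coe_coe] at h2
  rw [h1, h2, inner_smul_left, orthonormal_iff_ite.1 (hC.eigenvectorBasis rfl).orthonormal i j]
  simp

end Feature


/-! ### Excess risk of the linear recursion -/

section LinearExcess

set_option linter.unusedSectionVars false

variable {X : Type*} [MeasurableSpace X]
  {H : Type*} [NormedAddCommGroup H] [InnerProductSpace ℝ H] [FiniteDimensional ℝ H]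
  [MeasurableSpace H] [BorelSpace H] {Φ : X → H} {κ : ℝ}

section Operator

variable {ν : Measure X} [IsProbabilityMeasure ν] {ι : Type*} [Fintype ι] [DecidableEq ι]
  {A : H →L[ℝ] Lp ℝ 2 ν} {e : OrthonormalBasis ι ℝ H} {ev : ι → ℝ}

lemma finiteRankOp_smul {K ι : Type*} [NormedAddCommGroup K] [InnerProductSpace ℝ K] [Fintype ι]
    (p : ι → K) (c : ℝ) (f : K) : finiteRankOp p (c • f) = c • finiteRankOp p f := by
  simp [finiteRankOp, inner_smul_right, Finset.smul_sum, smul_smul]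

/-- The basis e being orthonormal, the finite rank operator is A composed with its adjoint. Ridge
regression in the parameter space becomes an equation in L², where it can be compared with the
operator of the limit kernel. -/
lemma finiteRankOp_feature_eq (hΦ : Measurable Φ) (hκ : ∀ᵐ x ∂ν, ‖Φ x‖ ≤ κ)
    (hA : ∀ u, A u =ᵐ[ν] fun x => inner ℝ (Φ x) u) (f : Lp ℝ 2 ν) :
    (finiteRankOp (fun i => A (e i)) f : Lp ℝ 2 ν) =ᵐ[ν] fun x' => ∫ x, f x * inner ℝ (Φ x) (Φ x') ∂ν := by
  have h1 : finiteRankOp (fun i => A (e i)) f = A (∑ i, inner ℝ (A (e i)) f • e i) := by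
    simp [finiteRankOp, map_sum, map_smul]
  have h2 : ∀ u, inner ℝ (A u) f = ∫ x, f x * inner ℝ (Φ x) u ∂ν := by
    intro u
    rw [real_inner_comm, inner_Lp_two]
    refine integral_congr_ae ?_
    filter_upwards [hA u] with x hx
    rw [hx]
  have hi : ∀ u, Integrable (fun x => f x * inner ℝ (Φ x) u) ν := fun u =>
    (Lp.memLp f).integrable_mul (memLp_inner_feature hΦ hκ u)
  rw [h1]
  filter_upwards [hA (∑ i, inner ℝ (A (e i)) f • e i)] with x' hx'
  rw [hx', inner_sum]
  calc ∑ i, inner ℝ (Φ x') (inner ℝ (A (e i)) f • e i)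
      = ∑ i, ∫ x, (f x * inner ℝ (Φ x) (e i)) * inner ℝ (e i) (Φ x') ∂ν := by
        refine Finset.sum_congr rfl fun i _ => ?_
        rw [inner_smul_right, h2, integral_mul_const, real_inner_comm (e i)]
    _ = _ := by
        rw [← integral_finsetSum _ fun i _ => (hi (e i)).mul_const _]
        refine integral_congr_ae (.of_forall fun x => ?_)
        simp only [mul_assoc, ← Finset.mul_sum]
        rw [e.sum_inner_mul_inner]

lemma norm_sq_feature_eq_sum
    (hp : ∀ i j, inner ℝ (A (e i)) (A (e j)) = if i = j then ev i else 0) (v : H) :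
    ‖A v‖ ^ 2 = ∑ i, ev i * inner ℝ (e i) v ^ 2 := by
  have h1 : A v = ∑ i, inner ℝ (e i) v • A (e i) := by
    conv_lhs => rw [← e.sum_repr' v]
    simp [map_sum, map_smul]
  rw [← real_inner_self_eq_norm_sq, h1, sum_inner]
  refine Finset.sum_congr rfl fun i _ => ?_
  rw [inner_smul_left, inner_sum]
  simp only [inner_smul_right, hp, mul_ite, mul_zero, Finset.sum_ite_eq, Finset.mem_univ, if_true,
    conj_trivial]
  ring

end Operator

variable {ρ : Measure (X × ℝ)} [IsProbabilityMeasure ρ]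

lemma integral_fst {f : X → ℝ} (hf : AEStronglyMeasurable f ρ.fst) :
    ∫ z, f z.1 ∂ρ = ∫ x, f x ∂ρ.fst := by
  rw [Measure.fst, integral_map measurable_fst.aemeasurable hf]

set_option maxHeartbeats 1000000 in
/-- The mean squared prediction error of the last iterate of stochastic gradient descent for a
linear model whose kernel is close to a kernel `k` with eigensystem `(μ, φ)`. -/
theorem linSgd_excess_le (hΦ : Measurable Φ) {R : X → Prop} (hR : ∀ᵐ x ∂ρ.fst, R x)
    (hκ : ∀ x, R x → ‖Φ x‖ ≤ κ) (hY : ∀ᵐ z ∂ρ, |z.2| ≤ 1)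
    {k : X → X → ℝ} (hk : IsBoundedKernel k R (κ ^ 2)) (hsymm : ∀ x x', k x x' = k x' x)
    {μ : ℕ → ℝ} {φ : ℕ → Lp ℝ 2 ρ.fst} (hμ : Antitone μ) (hμ0 : ∀ i, 0 ≤ μ i)
    (hφ : Orthonormal ℝ φ)
    (heigen : ∀ i, (fun x' => ∫ x, φ i x * k x x' ∂ρ.fst) =ᵐ[ρ.fst] fun x => μ i * φ i x)
    (hcomplete : ∀ f : Lp ℝ 2 ρ.fst, (∀ i, inner ℝ (φ i) f = 0) →
      (fun x' => ∫ x, f x * k x x' ∂ρ.fst) =ᵐ[ρ.fst] 0)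
    {r : ℝ} (hr : 1 / 2 ≤ r) (hr1 : r ≤ 1) {F h : Lp ℝ 2 ρ.fst}
    (hF : HasSum (fun k => (μ k ^ r * inner ℝ (φ k) h) • φ k) F) (hF1 : ‖F‖ ≤ 1)
    (hreg : ∀ u, ∫ z, z.2 * inner ℝ (Φ z.1) u ∂ρ = ∫ x, F x * inner ℝ (Φ x) u ∂ρ.fst)
    {Q : ℝ} (hQ : ∫ q, (k q.1 q.2 - inner ℝ (Φ q.1) (Φ q.2)) ^ 2 ∂(ρ.fst.prod ρ.fst) ≤ Q)
    {η θ lam V : ℝ} (hη : 0 < η) (hθ : 0 ≤ θ) (hθ1 : θ ≤ 1) {T : ℕ} (hT : 1 ≤ T)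
    (hlam : (T : ℝ) ^ (-(1 - θ)) ≤ lam) (hηl : η * (lam + 2 * κ ^ 2) ≤ 1)
    (hV : ∀ T, ∑ t ∈ Finset.range T, stepSize η θ t ^ 2 ≤ V) :
    ∃ (A : H →L[ℝ] Lp ℝ 2 ρ.fst) (W U E : ℝ),
      (∀ u, A u =ᵐ[ρ.fst] fun x => inner ℝ (Φ x) u) ∧
      0 ≤ W ∧ W ≤ lam ^ r * ‖h‖ * (1 + Real.sqrt Q / lam) ∧
      0 ≤ U ∧ U ≤ 1 / lam ∧
      U ≤ 2 * (μ 0 ^ (2 * r - 1) + Real.sqrt Q * (lam ^ (r - 1)) ^ 2) * ‖h‖ ^ 2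
        + 2 * Q * (lam ^ (r - 1)) ^ 2 * ‖h‖ ^ 2 / lam ∧
      0 ≤ E ∧ E ≤ κ ^ 4 * Real.exp (-lam * (η * (T : ℝ) ^ (1 - θ))) ∧
      (∀ N, HasSum (fun i => (μ i / (μ i + lam)) ^ 2) N → (T : ℝ) ^ (1 - θ) = 1 / lam →
        E ≤ 2 / η ^ 2 * lam ^ 2 * (2 * N + 2 * Q / lam ^ 2)) ∧
      Integrable (fun z => ‖A (linSgd Φ lam (stepSize η θ) T z) - F‖ ^ 2)
        (Measure.pi fun _ : Fin T => ρ) ∧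
      ∫ z, ‖A (linSgd Φ lam (stepSize η θ) T z) - F‖ ^ 2 ∂(Measure.pi fun _ : Fin T => ρ)
        ≤ (8 / η ^ 2 + 2) * W ^ 2 + 2 * (2 + 8 * κ ^ 2 * U + 16 * κ ^ 4 * (κ ^ 2 * U + 1) * V)
          * (V * E + 2 * η * (T : ℝ) ^ (-θ) * κ ^ 2) := by
  have hT0 : (0 : ℝ) < T := by exact_mod_cast hT
  have hlam0 : 0 < lam := lt_of_lt_of_le (by positivity) hlam
  have hV0 : 0 ≤ V := by simpa using hV 0
  have hκae : ∀ᵐ x ∂ρ.fst, ‖Φ x‖ ≤ κ := by filter_upwards [hR] with x hx using hκ x hx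
  obtain ⟨A, e, ev, hA, hp⟩ := exists_feature_eigenbasis hΦ hκae
  obtain ⟨L, hL⟩ := hk.exists_operator hR
  set p : Fin (Module.finrank ℝ H) → Lp ℝ 2 ρ.fst := fun i => A (e i) with hpdef
  have hp' : ∀ i j, inner ℝ (p i) (p j) = if i = j then ev i else 0 := hp
  have hev : ∀ i, 0 ≤ ev i := fun i => by
    have := hp i i; simp only [if_true] at this; rw [← this]; exact real_inner_self_nonneg
  have hpos : ∀ i, 0 < ev i + lam := fun i => by linarith [hev i]
  -- the regularized minimizer
  set ul : H := ∑ i, (inner ℝ (p i) F / (ev i + lam)) • e i with hul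
  have hul_inner : ∀ i, inner ℝ (e i) ul = inner ℝ (p i) F / (ev i + lam) := by
    intro i
    rw [hul, inner_sum]
    simp [inner_smul_right, orthonormal_iff_ite.1 e.orthonormal]
  have hpA : ∀ i v, inner ℝ (p i) (A v) = ev i * inner ℝ (e i) v := by
    intro i v
    have h1 : A v = ∑ j, inner ℝ (e j) v • A (e j) := by
      conv_lhs => rw [← e.sum_repr' v]
      simp [map_sum, map_smul]
    rw [h1, inner_sum]
    simp only [inner_smul_right, hpdef, hp, mul_ite, mul_zero, Finset.sum_ite_eq, Finset.mem_univ,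
      if_true]
    ring
  -- The dual variable of ridge regression: lam • w is the residual F - A ul, w solves the
  -- regularized equation in L² with right side F, and its products with the p i are the coordinates
  -- of `ul`.
  set w : Lp ℝ 2 ρ.fst := lam⁻¹ • (F - A ul) with hw
  have hpw : ∀ i, inner ℝ (p i) w = inner ℝ (e i) ul := by
    intro i
    rw [hw, inner_smul_right, inner_sub_right, hpA, hul_inner]
    have := (hpos i).ne'
    field_simp
    ring
  have hlw : lam • w = F - A ul := by rw [hw, smul_smul, mul_inv_cancel₀ hlam0.ne', one_smul]
  have hweq : finiteRankOp p w + lam • w = F := by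
    have h1 : finiteRankOp p w = A ul := by
      simp only [finiteRankOp, hpw]
      conv_rhs => rw [← e.sum_repr' ul]
      simp [map_sum, map_smul, hpdef]
    rw [h1, hlw]; abel
  -- the difference of the kernels
  set Dk : X → X → ℝ := fun x x' => k x x' - inner ℝ (Φ x) (Φ x') with hDk
  have hDkb : IsBoundedKernel Dk R (2 * κ ^ 2) := by
    refine ⟨?_, fun x x' hx hx' => ?_⟩
    · have : Measurable fun q : X × X => inner ℝ (Φ q.1) (Φ q.2) := by fun_prop
      exact hk.measurable.sub this
    · refine (abs_sub _ _).trans ?_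
      have h1 := hk.bound x x' hx hx'
      have h2 : |inner ℝ (Φ x) (Φ x')| ≤ κ * κ :=
        (abs_real_inner_le_norm _ _).trans (mul_le_mul (hκ x hx) (hκ x' hx') (norm_nonneg _)
          ((norm_nonneg _).trans (hκ x hx)))
      nlinarith
  have hdiff : ∀ f, (L f - finiteRankOp p f : Lp ℝ 2 ρ.fst)
      =ᵐ[ρ.fst] fun x' => ∫ x, f x * Dk x x' ∂ρ.fst := by
    intro f
    filter_upwards [hL f, finiteRankOp_feature_eq (e := e) hΦ hκae hA f,
      Lp.coeFn_sub (L f) (finiteRankOp p f), hR] with x' h1 h2 h3 hx'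
    rw [h3, Pi.sub_apply, h1, h2, ← integral_sub]
    · simp only [hDk, mul_sub]
    · exact integrable_mul_of_bounded f (hk.measurable_left x') (C := κ ^ 2)
        (by filter_upwards [hR] with x hx using hk.bound x x' hx hx')
    · exact (Lp.memLp f).integrable_mul (memLp_inner_feature hΦ hκae (Φ x'))
  have hHS : ∀ {ι : Type} [Fintype ι] {f : ι → Lp ℝ 2 ρ.fst}, Orthonormal ℝ f →
      ∑ i, ‖L (f i) - finiteRankOp p (f i)‖ ^ 2 ≤ Q := fun hf =>
    (hDkb.sum_norm_sq_le hR hf fun i => hdiff _).trans hQ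
  have hQ0 : 0 ≤ Q := (integral_nonneg fun _ => sq_nonneg _).trans hQ
  have hD : ∀ f, ‖L f - finiteRankOp p f‖ ≤ Real.sqrt Q * ‖f‖ := by
    intro f
    by_cases hf : f = 0
    · simp [hf, finiteRankOp]
    · have hf0 : 0 < ‖f‖ := norm_pos_iff.2 hf
      -- A family with one element: the Hilbert-Schmidt bound contains the operator norm bound.
      have ho : Orthonormal ℝ fun _ : Unit => ‖f‖⁻¹ • f := by
        refine ⟨fun _ => ?_, fun i j hij => (hij (Subsingleton.elim _ _)).elim⟩
        rw [norm_smul, norm_inv, norm_norm, inv_mul_cancel₀ hf0.ne']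
      have h1 := hHS ho
      simp only [Finset.univ_unique, Finset.sum_const, Finset.card_singleton, one_smul, map_smul,
        finiteRankOp_smul, ← smul_sub, norm_smul, norm_inv, norm_norm] at h1
      have h2 := Real.le_sqrt_of_sq_le h1
      rw [inv_mul_le_iff₀ hf0] at h2
      linarith
  have hLφ : ∀ i, L (φ i) = μ i • φ i := by
    intro i
    refine Lp.ext ?_
    filter_upwards [hL (φ i), heigen i, Lp.coeFn_smul (μ i) (φ i)] with x h1 h2 h3
    rw [h1, h2, h3]; rfl
  have hLc : ∀ f, (∀ i, inner ℝ (φ i) f = 0) → L f = 0 := by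
    intro f hf
    refine Lp.ext ?_
    filter_upwards [hL f, hcomplete f hf, Lp.coeFn_zero ℝ 2 ρ.fst] with x h1 h2 h3
    rw [h1, h2, h3]
  -- the linear model
  have hM : IsLinearModel ρ Φ κ lam e ev ul := by
    refine ⟨hΦ, ?_, hY, hlam0, ?_, ?_⟩
    · exact ae_of_ae_map measurable_fst.aemeasurable hκae
    · intro i u
      have h1 : ∫ z, inner ℝ (e i) (Φ z.1) * inner ℝ (Φ z.1) u ∂ρ
          = ∫ x, inner ℝ (e i) (Φ x) * inner ℝ (Φ x) u ∂ρ.fst :=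
        integral_fst (f := fun x => inner ℝ (e i) (Φ x) * inner ℝ (Φ x) u)
          (Measurable.aestronglyMeasurable (by fun_prop))
      rw [h1, ← hpA i u, inner_Lp_two]
      refine integral_congr_ae ?_
      filter_upwards [hA (e i), hA u] with x h1 h2
      rw [hpdef, h1, h2, real_inner_comm]
    · intro i
      simp_rw [real_inner_comm (Φ _) (e i)]
      rw [hul_inner, mul_div_cancel₀ _ (hpos i).ne', hreg, real_inner_comm, inner_Lp_two]
      refine integral_congr_ae ?_
      filter_upwards [hA (e i)] with x h1
      rw [hpdef, h1]
  have hs : ∀ t, 0 ≤ stepSize η θ t := stepSize_nonneg hη.le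
  have hsl : ∀ t, stepSize η θ t * (lam + 2 * κ ^ 2) ≤ 1 := fun t =>
    le_trans (by gcongr; exact stepSize_le hη.le hθ t) hηl
  have hsl' : ∀ t, stepSize η θ t * (lam + κ ^ 2) ≤ 1 := fun t =>
    le_trans (by have := hs t; gcongr; nlinarith [sq_nonneg κ]) (hsl t)
  have hevκ : ∀ i, ev i ≤ κ ^ 2 := fun i =>
    (Finset.single_le_sum (fun j _ => hev j) (Finset.mem_univ i)).trans hM.sum_ev_le
  have hsev : ∀ i j, stepSize η θ j * (ev i + lam) ≤ 1 := fun i j =>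
    le_trans (mul_le_mul_of_nonneg_left (by linarith [hevκ i]) (hs j)) (hsl' j)
  have hUsum : ∑ i, inner ℝ (p i) w ^ 2 = ‖ul‖ ^ 2 := by
    simp_rw [hpw]; exact IsLinearModel.sum_inner_sq e ul
  have hbias := ridge_bias hlam0 hweq hD (Real.sqrt_nonneg Q) hμ hμ0 hφ hLφ hr hr1 hF
  set E := ∑ i, ev i ^ 2 * Real.exp (-(ev i + lam) * (η * (T : ℝ) ^ (1 - θ))) with hE
  -- W is the norm of the ridge residual, U the squared norm of the regularized minimizer, E the
  -- damped noise of the first half.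
  refine ⟨A, lam * ‖w‖, ‖ul‖ ^ 2, E, hA, by positivity, ?_, by positivity, ?_, ?_, ?_, ?_, ?_, ?_,
    ?_⟩
  · calc lam * ‖w‖ ≤ lam * (lam ^ (r - 1) * ‖h‖ * (1 + Real.sqrt Q / lam)) := by
          gcongr; exact hbias.1
      _ = _ := by rw [Real.rpow_sub_one hlam0.ne']; field_simp
  -- Comparison with the zero vector gives lam ‖ul‖² ≤ ‖F‖², without any source condition.
  · have h1 := (ridge_stability hlam0 hweq 0).2
    simp only [sub_zero, smul_zero, add_zero, finiteRankOp, inner_zero_right, zero_smul,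
      Finset.sum_const_zero, hUsum] at h1
    rw [le_div_iff₀ hlam0, mul_comm]
    exact h1.trans (pow_le_one₀ (norm_nonneg _) hF1)
  · rw [← hUsum]
    refine hbias.2.trans (le_of_eq ?_)
    rw [mul_pow (Real.sqrt Q), Real.sq_sqrt hQ0]; ring
  · exact Finset.sum_nonneg fun i _ => by positivity
  · calc E ≤ ∑ i, (κ ^ 2 * Real.exp (-lam * (η * (T : ℝ) ^ (1 - θ)))) * ev i := by
          refine Finset.sum_le_sum fun i _ => ?_
          have h1 : Real.exp (-(ev i + lam) * (η * (T : ℝ) ^ (1 - θ)))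
              ≤ Real.exp (-lam * (η * (T : ℝ) ^ (1 - θ))) := by
            refine Real.exp_le_exp.2 (mul_le_mul_of_nonneg_right ?_ (by positivity))
            linarith [hev i]
          have h2 : ev i ^ 2 ≤ κ ^ 2 * ev i := by
            rw [sq]; exact mul_le_mul_of_nonneg_right (hevκ i) (hev i)
          calc _ ≤ (κ ^ 2 * ev i) * Real.exp (-lam * (η * (T : ℝ) ^ (1 - θ))) := by
                gcongr
                exact mul_nonneg (sq_nonneg κ) (hev i)
            _ = _ := by ring
      _ ≤ _ := by
          rw [← Finset.mul_sum]
          calc _ ≤ (κ ^ 2 * Real.exp (-lam * (η * (T : ℝ) ^ (1 - θ)))) * κ ^ 2 := by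
                gcongr; exact hM.sum_ev_le
            _ = _ := by ring
  -- The normalized p i with ev i ≠ 0 are exact eigenvectors of the finite rank operator. Their
  -- defects as eigenvectors of L are therefore the kernel error applied to an orthonormal family,
  -- with total square at most Q.
  · intro N hN hTl
    obtain ⟨ws, b, mm, hm0, hmL, hmN⟩ := exists_eigen_hilbertBasis
      (hk.inner_operator_symm hR hsymm hL) hμ0 hφ hLφ hLc
    have hN' := hmN (fun x => (x / (x + lam)) ^ 2) (by simp) N hN
    have ho := orthonormal_normalize hp'
    have hfr : ∀ i : {i // ev i ≠ 0}, finiteRankOp p ((Real.sqrt (ev i))⁻¹ • p i)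
        = ev i • ((Real.sqrt (ev i))⁻¹ • p i) := by
      intro i
      simp only [finiteRankOp, inner_smul_right, hp', mul_ite, mul_zero, ite_smul, zero_smul]
      rw [Finset.sum_ite_eq']
      simp [smul_smul, mul_comm]
    have hHS' := hHS ho
    simp_rw [hfr] at hHS'
    have hdim := sum_effectiveDim_le b hm0 hmL ho (fun i => hev i) hlam0 hHS' hN'
    rw [sum_subtype_ne_zero (F := fun i => (ev i / (ev i + lam)) ^ 2)
      (fun i hi => by simp [hi])] at hdim
    calc E ≤ ∑ i, 2 / η ^ 2 * lam ^ 2 * (ev i / (ev i + lam)) ^ 2 := by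
          rw [hE, hTl]
          exact Finset.sum_le_sum fun i _ => sq_mul_exp_le_effectiveDim (hev i) hlam0 hη
      _ ≤ _ := by rw [← Finset.mul_sum]; gcongr
  · exact hM.integrable_linSgd hs hsl' T (F := fun u => ‖A u - F‖ ^ 2) (by fun_prop)
  · set a : Fin (Module.finrank ℝ H) → ℝ := fun i =>
      ∫ z, inner ℝ (e i) (linSgd Φ lam (stepSize η θ) T z - ul) ^ 2
        ∂(Measure.pi fun _ : Fin T => ρ) with ha
    have hint : ∀ i, Integrable
        (fun z => ev i * inner ℝ (e i) (linSgd Φ lam (stepSize η θ) T z - ul) ^ 2)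
        (Measure.pi fun _ : Fin T => ρ) := fun i =>
      (hM.integrable_linSgd hs hsl' T (F := fun u => inner ℝ (e i) (u - ul) ^ 2)
        (by fun_prop)).const_mul _
    have hint1 := hM.integrable_linSgd hs hsl' T (F := fun u => ‖A u - F‖ ^ 2) (by fun_prop)
    have hint2 := hM.integrable_linSgd hs hsl' T (F := fun u => ‖A (u - ul)‖ ^ 2) (by fun_prop)
    set D := 2 + 8 * κ ^ 2 * ‖ul‖ ^ 2 + 8 * κ ^ 4 * (κ * ‖ul‖ + 1) ^ 2 * V with hDdef
    have hD0 : 0 ≤ D := by positivity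
    have hcoord := fun i => hM.integral_inner_linSgd_le hs hsl hV i T
    have hspec := sum_ev_mul_le hp' hη hθ hθ1 hT hlam hsev hV hD0 hM.sum_ev_le (w := w) (a := a)
      (fun i => by rw [hpw]; exact hcoord i)
    have hDle : D ≤ 2 + 8 * κ ^ 2 * ‖ul‖ ^ 2 + 16 * κ ^ 4 * (κ ^ 2 * ‖ul‖ ^ 2 + 1) * V := by
      have h1 : (κ * ‖ul‖ + 1) ^ 2 ≤ 2 * (κ ^ 2 * ‖ul‖ ^ 2 + 1) := by
        nlinarith [sq_nonneg (κ * ‖ul‖ - 1)]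
      have h2 : 8 * κ ^ 4 * (κ * ‖ul‖ + 1) ^ 2 * V
          ≤ 8 * κ ^ 4 * (2 * (κ ^ 2 * ‖ul‖ ^ 2 + 1)) * V := by gcongr
      rw [hDdef]; linarith
    have hE0 : 0 ≤ E := Finset.sum_nonneg fun i _ => by positivity
    have hrest : 0 ≤ V * E + 2 * η * (T : ℝ) ^ (-θ) * κ ^ 2 := by positivity
    have hsum : ∫ z, ‖A (linSgd Φ lam (stepSize η θ) T z - ul)‖ ^ 2
        ∂(Measure.pi fun _ : Fin T => ρ) = ∑ i, ev i * a i := by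
      simp_rw [norm_sq_feature_eq_sum hp]
      rw [integral_finsetSum _ fun i _ => hint i]
      simp_rw [integral_const_mul, ha]
    have hpt : ∀ u, ‖A u - F‖ ^ 2 ≤ 2 * ‖A (u - ul)‖ ^ 2 + 2 * (lam * ‖w‖) ^ 2 := by
      intro u
      have h1 : A u - F = A (u - ul) - lam • w := by rw [hlw, map_sub]; abel
      have h2 : ‖lam • w‖ = lam * ‖w‖ := by rw [norm_smul, Real.norm_eq_abs, abs_of_pos hlam0]
      have h3 : ‖A u - F‖ ≤ ‖A (u - ul)‖ + lam * ‖w‖ := by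
        rw [h1, ← h2]; exact norm_sub_le _ _
      nlinarith [sq_nonneg (‖A (u - ul)‖ - lam * ‖w‖), norm_nonneg (A u - F)]
    calc _ ≤ ∫ z, (2 * ‖A (linSgd Φ lam (stepSize η θ) T z - ul)‖ ^ 2 + 2 * (lam * ‖w‖) ^ 2)
            ∂(Measure.pi fun _ : Fin T => ρ) :=
          integral_mono hint1 ((hint2.const_mul 2).add (integrable_const _)) fun z => hpt _
      _ = 2 * ∑ i, ev i * a i + 2 * (lam * ‖w‖) ^ 2 := by
          rw [integral_add (hint2.const_mul 2) (integrable_const _), integral_const_mul, hsum]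
          simp
      _ ≤ _ := by
          have h5 := mul_le_mul_of_nonneg_right hDle hrest
          have h6 : (8 / η ^ 2 + 2) * (lam * ‖w‖) ^ 2
            = 2 * (4 / η ^ 2 * (lam * ‖w‖) ^ 2) + 2 * (lam * ‖w‖) ^ 2 := by ring
          rw [h6]
          linarith

end LinearExcess


/-! ### First-order expansion of the network -/

section Network

/-- The parameter space of a network of width `2 m`, with its Euclidean norm. -/
abbrev ParamSpace (d m : ℕ) : Type :=
  PiLp 2 fun _ : Neuron m => WithLp 2 (ℝ × WithLp 2 (Inp d × ℝ))

variable {d m : ℕ}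

/-- The element of the parameter space with the given blocks. -/
def blocks (a : Neuron m → ℝ) (b : Neuron m → Inp d) (c : Neuron m → ℝ) : ParamSpace d m :=
  WithLp.toLp 2 fun r => WithLp.toLp 2 (a r, WithLp.toLp 2 (b r, c r))

lemma inner_blocks (a a' : Neuron m → ℝ) (b b' : Neuron m → Inp d) (c c' : Neuron m → ℝ) :
    inner ℝ (blocks a b c) (blocks a' b' c')
      = ∑ r, (a r * a' r + (inner ℝ (b r) (b' r) + c r * c' r)) := by
  simp [blocks, PiLp.inner_apply, WithLp.prod_inner_apply, mul_comm]

lemma norm_sq_blocks (a : Neuron m → ℝ) (b : Neuron m → Inp d) (c : Neuron m → ℝ) :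
    ‖blocks a b c‖ ^ 2 = ∑ r, (a r ^ 2 + (‖b r‖ ^ 2 + c r ^ 2)) := by
  rw [← real_inner_self_eq_norm_sq, inner_blocks]
  simp only [sq, real_inner_self_eq_norm_mul_norm]

lemma blocks_sub (a a' : Neuron m → ℝ) (b b' : Neuron m → Inp d) (c c' : Neuron m → ℝ) :
    blocks a b c - blocks a' b' c'
      = blocks (fun r => a r - a' r) (fun r => b r - b' r) (fun r => c r - c' r) := rfl

lemma smul_blocks (t : ℝ) (a : Neuron m → ℝ) (b : Neuron m → Inp d) (c : Neuron m → ℝ) :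
    t • blocks a b c = blocks (fun r => t * a r) (fun r => t • b r) (fun r => t * c r) := rfl

/-- The displacement `Θ - Θ₀`. -/
def displacement (Θ₀ Θ : Params d m) : ParamSpace d m :=
  blocks (fun r => Θ.a r - Θ₀.a r) (fun r => Θ.b r - Θ₀.b r) (fun r => Θ.c r - Θ₀.c r)

/-- The gradient of the network with respect to its parameters. -/
def gradient (σ : ℝ → ℝ) (γ : ℝ) (Θ : Params d m) (x : Inp d) : ParamSpace d m :=
  blocks (fun r => (Real.sqrt (2 * m : ℝ))⁻¹ * σ (inner ℝ (Θ.b r) x + γ * Θ.c r))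
    (fun r => ((Real.sqrt (2 * m : ℝ))⁻¹
      * (Θ.a r * deriv σ (inner ℝ (Θ.b r) x + γ * Θ.c r))) • x)
    (fun r => (Real.sqrt (2 * m : ℝ))⁻¹
      * (Θ.a r * γ * deriv σ (inner ℝ (Θ.b r) x + γ * Θ.c r)))

lemma displacement_sgdStep (σ : ℝ → ℝ) (γ lam s : ℝ) (Θ₀ Θ : Params d m) (z : Inp d × ℝ) :
    displacement Θ₀ (sgdStep σ γ lam s Θ₀ Θ z)
      = (1 - s * lam) • displacement Θ₀ Θ
        - (s * (network σ γ Θ z.1 - z.2)) • gradient σ γ Θ z.1 := by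
  simp only [displacement, gradient, smul_blocks, blocks_sub, sgdStep]
  congr 1
  · funext r; ring
  · funext r; rw [add_sub_cancel_left, smul_smul]; congr 2; ring
  · funext r; ring

variable {σ : ℝ → ℝ} {C γ : ℝ}

lemma IsActivation.continuous (hσ : IsActivation σ C) : Continuous σ := hσ.diff.continuous

lemma IsActivation.continuous_deriv (hσ : IsActivation σ C) : Continuous (deriv σ) :=
  hσ.diff_deriv.continuous

lemma IsActivation.abs_sub_le (hσ : IsActivation σ C) (u v : ℝ) :
    |σ v - σ u| ≤ C * |v - u| :=
  convex_univ.norm_image_sub_le_of_norm_deriv_le (fun x _ => hσ.diff x)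
    (fun x _ => hσ.deriv_le x) (Set.mem_univ u) (Set.mem_univ v)

lemma IsActivation.abs_deriv_sub_le (hσ : IsActivation σ C) (u v : ℝ) :
    |deriv σ v - deriv σ u| ≤ C * |v - u| :=
  convex_univ.norm_image_sub_le_of_norm_deriv_le (fun x _ => hσ.diff_deriv x)
    (fun x _ => hσ.deriv_deriv_le x) (Set.mem_univ u) (Set.mem_univ v)

/-- The mean value inequality for t ↦ σ t - deriv σ u * t on the segment from u to v. No continuity
of the second derivative is needed, at the price of C in place of C / 2. -/
lemma IsActivation.abs_taylor_le (hσ : IsActivation σ C) (u v : ℝ) :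
    |σ v - σ u - deriv σ u * (v - u)| ≤ C * (v - u) ^ 2 := by
  set f : ℝ → ℝ := fun t => σ t - deriv σ u * t with hf
  have hd : ∀ t, HasDerivAt f (deriv σ t - deriv σ u) t := by
    intro t
    have := (hσ.diff t).hasDerivAt.sub ((hasDerivAt_id t).const_mul (deriv σ u))
    rw [mul_one] at this
    exact this
  have h := (convex_uIcc u v).norm_image_sub_le_of_norm_hasDerivWithin_le
    (f := f) (C := C * |v - u|) (fun t _ => (hd t).hasDerivWithinAt)
    (fun t ht => (hσ.abs_deriv_sub_le u t).trans
      (mul_le_mul_of_nonneg_left (Set.abs_sub_left_of_mem_uIcc ht) hσ.pos.le))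
    Set.left_mem_uIcc Set.right_mem_uIcc
  have e1 : f v - f u = σ v - σ u - deriv σ u * (v - u) := by simp only [hf]; ring
  rw [e1, Real.norm_eq_abs, Real.norm_eq_abs] at h
  refine h.trans (le_of_eq ?_)
  rw [← sq_abs (v - u)]; ring

/-- The kernel of a single neuron. -/
def neuronKernel (σ : ℝ → ℝ) (γ : ℝ) (b : Inp d) (q : Inp d × Inp d) : ℝ :=
  σ (inner ℝ b q.1) * σ (inner ℝ b q.2)
    + (inner ℝ q.1 q.2 + γ ^ 2) * (deriv σ (inner ℝ b q.1) * deriv σ (inner ℝ b q.2))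

lemma measurable_neuronKernel (hσ : IsActivation σ C) :
    Measurable (Function.uncurry (neuronKernel (d := d) σ γ)) := by
  have h1 := hσ.continuous
  have h2 := hσ.continuous_deriv
  refine Continuous.measurable ?_
  unfold neuronKernel Function.uncurry
  fun_prop

lemma abs_sigma_inner_le (hσ : IsActivation σ C) {b x : Inp d} (hb : ‖b‖ = 1) (hx : ‖x‖ ≤ 1) :
    |σ (inner ℝ b x)| ≤ 2 := by
  have h1 := hσ.growth (inner ℝ b x)
  have h2 : |inner ℝ b x| ≤ ‖b‖ * ‖x‖ := abs_real_inner_le_norm _ _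
  rw [hb, one_mul] at h2
  linarith

lemma abs_neuronKernel_le (hσ : IsActivation σ C) (hγ : γ ∈ Set.Icc (0 : ℝ) 1) {b : Inp d}
    {q : Inp d × Inp d} (hb : ‖b‖ = 1) (hq : ‖q.1‖ ≤ 1 ∧ ‖q.2‖ ≤ 1) :
    |neuronKernel σ γ b q| ≤ 4 + 2 * C ^ 2 := by
  have h1 := abs_sigma_inner_le hσ hb hq.1
  have h2 := abs_sigma_inner_le hσ hb hq.2
  have h3 := hσ.deriv_le (inner ℝ b q.1)
  have h4 := hσ.deriv_le (inner ℝ b q.2)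
  have h5 : |inner ℝ q.1 q.2 + γ ^ 2| ≤ 2 := by
    have e1 : |inner ℝ q.1 q.2| ≤ 1 * 1 :=
      (abs_real_inner_le_norm _ _).trans
        (mul_le_mul hq.1 hq.2 (norm_nonneg _) zero_le_one)
    have e2 : |γ ^ 2| ≤ 1 := by rw [abs_of_nonneg (sq_nonneg _)]; nlinarith [hγ.1, hγ.2]
    exact (abs_add_le _ _).trans (by linarith)
  have hC := hσ.pos
  unfold neuronKernel
  refine (abs_add_le _ _).trans ?_
  rw [abs_mul, abs_mul, abs_mul]
  calc _ ≤ 2 * 2 + 2 * (C * C) := by gcongr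
    _ = _ := by ring

/-- The features at a symmetric initialization. -/
def initFeature (σ : ℝ → ℝ) (γ : ℝ) (w : Fin m → Inp d) (x : Inp d) : ParamSpace d m :=
  gradient σ γ (initParams 1 w) x

lemma measurable_initFeature (hσ : IsActivation σ C) (w : Fin m → Inp d) :
    Measurable (initFeature σ γ w) := by
  have h1 := hσ.continuous
  have h2 := hσ.continuous_deriv
  refine Continuous.measurable ?_
  unfold initFeature gradient blocks
  fun_prop

/-- The outer weights ±1 enter through their squares, so neuron r and its mirror image contribute
equally and M terms reduce to m independent ones. -/
lemma inner_initFeature (hm : 1 ≤ m) (w : Fin m → Inp d) (x x' : Inp d) :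
    inner ℝ (initFeature σ γ w x) (initFeature σ γ w x')
      = (m : ℝ)⁻¹ * ∑ r, neuronKernel σ γ (w r) (x, x') := by
  have hm0 : (0 : ℝ) < m := by exact_mod_cast hm
  have hs : ((Real.sqrt (2 * m : ℝ))⁻¹) ^ 2 = (2 * m : ℝ)⁻¹ := by
    rw [inv_pow, Real.sq_sqrt (by positivity)]
  unfold initFeature gradient
  rw [inner_blocks, Fintype.sum_sum_type]
  simp only [initParams, Sum.elim_inl, Sum.elim_inr, mul_zero, add_zero, inner_smul_left,
    inner_smul_right, conj_trivial, one_mul, neg_mul, mul_neg]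
  rw [← Finset.sum_add_distrib, Finset.mul_sum]
  refine Finset.sum_congr rfl fun r _ => ?_
  simp only [neuronKernel]
  have : (m : ℝ)⁻¹ = 2 * ((Real.sqrt (2 * m : ℝ))⁻¹) ^ 2 := by rw [hs]; field_simp
  rw [this]
  ring

lemma norm_initFeature_le (hσ : IsActivation σ C) (hγ : γ ∈ Set.Icc (0 : ℝ) 1) (hm : 1 ≤ m)
    {w : Fin m → Inp d} (hw : ∀ r, ‖w r‖ = 1) {x : Inp d} (hx : ‖x‖ ≤ 1) :
    ‖initFeature σ γ w x‖ ≤ Real.sqrt (4 + 2 * C ^ 2) := by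
  have hm0 : (0 : ℝ) < m := by exact_mod_cast hm
  have h1 : ‖initFeature σ γ w x‖ ^ 2 = (m : ℝ)⁻¹ * ∑ r, neuronKernel σ γ (w r) (x, x) :=
    (real_inner_self_eq_norm_sq _).symm.trans (inner_initFeature hm w x x)
  have h2 : ∑ r, neuronKernel σ γ (w r) (x, x) ≤ ∑ _r : Fin m, (4 + 2 * C ^ 2) :=
    Finset.sum_le_sum fun r _ => (le_abs_self _).trans
      (abs_neuronKernel_le hσ hγ (hw r) ⟨hx, hx⟩)
  rw [Finset.sum_const, Finset.card_univ, Fintype.card_fin, nsmul_eq_mul] at h2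
  refine Real.le_sqrt_of_sq_le ?_
  rw [h1, inv_mul_le_iff₀ hm0]
  exact h2

/-- The mirrored halves cancel. -/
lemma network_initParams (w : Fin m → Inp d) (x : Inp d) : network σ γ (initParams 1 w) x = 0 := by
  unfold network
  rw [Fintype.sum_sum_type]
  simp [initParams]

lemma preactivation_sub_sq_le (hγ : γ ∈ Set.Icc (0 : ℝ) 1) (Θ₀ Θ : Params d m) {x : Inp d}
    (hx : ‖x‖ ≤ 1) (r : Neuron m) :
    ((inner ℝ (Θ.b r) x + γ * Θ.c r) - (inner ℝ (Θ₀.b r) x + γ * Θ₀.c r)) ^ 2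
      ≤ 2 * (‖Θ.b r - Θ₀.b r‖ ^ 2 + (Θ.c r - Θ₀.c r) ^ 2) := by
  have e1 : (inner ℝ (Θ.b r) x + γ * Θ.c r) - (inner ℝ (Θ₀.b r) x + γ * Θ₀.c r)
      = inner ℝ (Θ.b r - Θ₀.b r) x + γ * (Θ.c r - Θ₀.c r) := by
    rw [inner_sub_left]; ring
  have e2 : |inner ℝ (Θ.b r - Θ₀.b r) x + γ * (Θ.c r - Θ₀.c r)|
      ≤ ‖Θ.b r - Θ₀.b r‖ + |Θ.c r - Θ₀.c r| := by
    refine (abs_add_le _ _).trans (add_le_add ?_ ?_)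
    · exact (abs_real_inner_le_norm _ _).trans (mul_le_of_le_one_right (norm_nonneg _) hx)
    · rw [abs_mul, abs_of_nonneg hγ.1]; exact mul_le_of_le_one_left (abs_nonneg _) hγ.2
  rw [e1, ← sq_abs, ← sq_abs (Θ.c r - Θ₀.c r)]
  refine (pow_le_pow_left₀ (abs_nonneg _) e2 2).trans ?_
  nlinarith [sq_nonneg (‖Θ.b r - Θ₀.b r‖ - |Θ.c r - Θ₀.c r|)]

/-- The error of the first order expansion of the network at a symmetric initialization. -/
theorem abs_network_sub_inner_le (hσ : IsActivation σ C) (hγ : γ ∈ Set.Icc (0 : ℝ) 1)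
    (w : Fin m → Inp d) (Θ : Params d m) {x : Inp d} (hx : ‖x‖ ≤ 1) :
    |network σ γ Θ x - inner ℝ (initFeature σ γ w x) (displacement (initParams 1 w) Θ)|
      ≤ 4 * C / Real.sqrt (2 * m) * ‖displacement (initParams 1 w) Θ‖ ^ 2 := by
  set Θ₀ : Params d m := initParams 1 w with hΘ₀
  have hC := hσ.pos
  have ha0 : ∀ r, |Θ₀.a r| = 1 := by
    rintro (r | r) <;> simp [hΘ₀, initParams]
  set s := (Real.sqrt (2 * m : ℝ))⁻¹ with hs
  have hs0 : 0 ≤ s := by positivity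
  set P : Neuron m → ℝ := fun r => inner ℝ (Θ.b r) x + γ * Θ.c r with hP
  set P₀ : Neuron m → ℝ := fun r => inner ℝ (Θ₀.b r) x + γ * Θ₀.c r with hP₀
  -- Each neuron contributes a Taylor remainder with the initial outer weight, and the change of the
  -- outer weight times the change of the activation. Both are quadratic in the displacement.
  have h1 : network σ γ Θ x - inner ℝ (initFeature σ γ w x) (displacement Θ₀ Θ)
      = s * ∑ r, (Θ₀.a r * (σ (P r) - σ (P₀ r) - deriv σ (P₀ r) * (P r - P₀ r))
        + (Θ.a r - Θ₀.a r) * (σ (P r) - σ (P₀ r))) := by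
    have h2 : network σ γ Θ x = network σ γ Θ x - network σ γ Θ₀ x := by
      rw [hΘ₀, network_initParams, sub_zero]
    rw [h2]
    unfold network initFeature gradient displacement
    rw [inner_blocks, ← hΘ₀, ← mul_sub, ← Finset.sum_sub_distrib, Finset.mul_sum, Finset.mul_sum,
      ← Finset.sum_sub_distrib]
    refine Finset.sum_congr rfl fun r _ => ?_
    rw [inner_smul_left, inner_sub_right, conj_trivial, real_inner_comm (Θ.b r) x,
      real_inner_comm (Θ₀.b r) x]
    simp only [← hs, hP, hP₀]
    ring
  rw [h1, abs_mul, abs_of_nonneg hs0, div_eq_mul_inv, ← hs, mul_comm (4 * C), mul_assoc]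
  refine mul_le_mul_of_nonneg_left ?_ hs0
  unfold displacement
  rw [norm_sq_blocks, Finset.mul_sum]
  refine (Finset.abs_sum_le_sum_abs _ _).trans (Finset.sum_le_sum fun r _ => ?_)
  have hΔ2 : (P r - P₀ r) ^ 2 ≤ 2 * (‖Θ.b r - Θ₀.b r‖ ^ 2 + (Θ.c r - Θ₀.c r) ^ 2) :=
    preactivation_sub_sq_le hγ Θ₀ Θ hx r
  have t1 : |Θ₀.a r * (σ (P r) - σ (P₀ r) - deriv σ (P₀ r) * (P r - P₀ r))|
      ≤ C * (P r - P₀ r) ^ 2 := by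
    rw [abs_mul, ha0, one_mul]; exact hσ.abs_taylor_le _ _
  have t2 : |(Θ.a r - Θ₀.a r) * (σ (P r) - σ (P₀ r))|
      ≤ C * (|Θ.a r - Θ₀.a r| * |P r - P₀ r|) := by
    rw [abs_mul]
    calc _ ≤ |Θ.a r - Θ₀.a r| * (C * |P r - P₀ r|) := by gcongr; exact hσ.abs_sub_le _ _
      _ = _ := by ring
  have t3 : |Θ.a r - Θ₀.a r| * |P r - P₀ r| ≤ ((Θ.a r - Θ₀.a r) ^ 2 + (P r - P₀ r) ^ 2) / 2 := by
    rw [← sq_abs (P r - P₀ r), ← sq_abs (Θ.a r - Θ₀.a r)]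
    nlinarith [sq_nonneg (|Θ.a r - Θ₀.a r| - |P r - P₀ r|)]
  refine (abs_add_le _ _).trans ((add_le_add t1 t2).trans ?_)
  rw [mul_comm 4 C, mul_assoc, ← mul_add]
  refine mul_le_mul_of_nonneg_left ?_ hC.le
  nlinarith [sq_nonneg (Θ.a r - Θ₀.a r), sq_nonneg (Θ.c r - Θ₀.c r),
    sq_nonneg ‖Θ.b r - Θ₀.b r‖]

/-- The gradient of the network is Lipschitz at a symmetric initialization. -/
theorem norm_gradient_sub_le (hσ : IsActivation σ C) (hγ : γ ∈ Set.Icc (0 : ℝ) 1)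
    (w : Fin m → Inp d) (Θ : Params d m) {x : Inp d} (hx : ‖x‖ ≤ 1) :
    ‖gradient σ γ Θ x - initFeature σ γ w x‖
      ≤ 4 * C / Real.sqrt (2 * m) * ‖displacement (initParams 1 w) Θ‖ := by
  set Θ₀ : Params d m := initParams 1 w with hΘ₀
  have hC := hσ.pos
  have ha0 : ∀ r, |Θ₀.a r| = 1 := by
    rintro (r | r) <;> simp [hΘ₀, initParams]
  set s := (Real.sqrt (2 * m : ℝ))⁻¹ with hs
  have hs0 : 0 ≤ s := by positivity
  set P : Neuron m → ℝ := fun r => inner ℝ (Θ.b r) x + γ * Θ.c r with hP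
  set P₀ : Neuron m → ℝ := fun r => inner ℝ (Θ₀.b r) x + γ * Θ₀.c r with hP₀
  refine le_of_sq_le_sq ?_ (by positivity)
  rw [mul_pow, div_eq_mul_inv, ← hs]
  unfold initFeature gradient displacement
  rw [blocks_sub, norm_sq_blocks, norm_sq_blocks, Finset.mul_sum]
  refine Finset.sum_le_sum fun r _ => ?_
  simp only [← hs, ← hΘ₀]
  have hΔ2 : (P r - P₀ r) ^ 2 ≤ 2 * (‖Θ.b r - Θ₀.b r‖ ^ 2 + (Θ.c r - Θ₀.c r) ^ 2) :=
    preactivation_sub_sq_le hγ Θ₀ Θ hx r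
  set n := (Θ.a r - Θ₀.a r) ^ 2 + (‖Θ.b r - Θ₀.b r‖ ^ 2 + (Θ.c r - Θ₀.c r) ^ 2) with hn
  have hPn : (P r - P₀ r) ^ 2 ≤ 2 * n := by nlinarith [sq_nonneg (Θ.a r - Θ₀.a r)]
  have han : (Θ.a r - Θ₀.a r) ^ 2 ≤ n := by
    nlinarith [sq_nonneg (Θ.c r - Θ₀.c r), sq_nonneg ‖Θ.b r - Θ₀.b r‖]
  have t1 : (σ (P r) - σ (P₀ r)) ^ 2 ≤ 2 * C ^ 2 * n := by
    have := hσ.abs_sub_le (P₀ r) (P r)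
    calc (σ (P r) - σ (P₀ r)) ^ 2 = |σ (P r) - σ (P₀ r)| ^ 2 := (sq_abs _).symm
      _ ≤ (C * |P r - P₀ r|) ^ 2 := by gcongr
      _ = C ^ 2 * (P r - P₀ r) ^ 2 := by rw [mul_pow, sq_abs]
      _ ≤ C ^ 2 * (2 * n) := by gcongr
      _ = _ := by ring
  have t2 : (Θ.a r * deriv σ (P r) - Θ₀.a r * deriv σ (P₀ r)) ^ 2 ≤ 6 * C ^ 2 * n := by
    have e1 : |Θ.a r * deriv σ (P r) - Θ₀.a r * deriv σ (P₀ r)|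
        ≤ C * |P r - P₀ r| + C * |Θ.a r - Θ₀.a r| := by
      have e2 : Θ.a r * deriv σ (P r) - Θ₀.a r * deriv σ (P₀ r)
          = Θ₀.a r * (deriv σ (P r) - deriv σ (P₀ r)) + deriv σ (P r) * (Θ.a r - Θ₀.a r) := by
        ring
      rw [e2]
      refine (abs_add_le _ _).trans (add_le_add ?_ ?_)
      · rw [abs_mul, ha0, one_mul]; exact hσ.abs_deriv_sub_le _ _
      · rw [abs_mul]; gcongr; exact hσ.deriv_le _
    calc _ = |Θ.a r * deriv σ (P r) - Θ₀.a r * deriv σ (P₀ r)| ^ 2 := (sq_abs _).symm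
      _ ≤ (C * |P r - P₀ r| + C * |Θ.a r - Θ₀.a r|) ^ 2 := by gcongr
      _ = C ^ 2 * (|P r - P₀ r| + |Θ.a r - Θ₀.a r|) ^ 2 := by ring
      _ ≤ C ^ 2 * (2 * ((P r - P₀ r) ^ 2 + (Θ.a r - Θ₀.a r) ^ 2)) := by
          gcongr
          rw [← sq_abs (P r - P₀ r), ← sq_abs (Θ.a r - Θ₀.a r)]
          nlinarith [sq_nonneg (|P r - P₀ r| - |Θ.a r - Θ₀.a r|)]
      _ ≤ C ^ 2 * (2 * (2 * n + n)) := by gcongr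
      _ = _ := by ring
  set A := Θ.a r * deriv σ (P r) - Θ₀.a r * deriv σ (P₀ r) with hA
  have e1 : s * σ (inner ℝ (Θ.b r) x + γ * Θ.c r) - s * σ (inner ℝ (Θ₀.b r) x + γ * Θ₀.c r)
      = s * (σ (P r) - σ (P₀ r)) := by simp only [hP, hP₀]; ring
  have e2 : (s * (Θ.a r * deriv σ (inner ℝ (Θ.b r) x + γ * Θ.c r))) • x
      - (s * (Θ₀.a r * deriv σ (inner ℝ (Θ₀.b r) x + γ * Θ₀.c r))) • x = (s * A) • x := by
    rw [← sub_smul]; congr 1; simp only [hA, hP, hP₀]; ring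
  have e3 : s * (Θ.a r * γ * deriv σ (inner ℝ (Θ.b r) x + γ * Θ.c r))
      - s * (Θ₀.a r * γ * deriv σ (inner ℝ (Θ₀.b r) x + γ * Θ₀.c r)) = s * A * γ := by
    simp only [hA, hP, hP₀]; ring
  rw [e1, e2, e3, norm_smul, mul_pow ‖s * A‖, Real.norm_eq_abs, sq_abs]
  have hx2 : ‖x‖ ^ 2 ≤ 1 := pow_le_one₀ (norm_nonneg _) hx
  have hγ2 : γ ^ 2 ≤ 1 := pow_le_one₀ hγ.1 hγ.2
  -- The constants add up to 2 + 6 + 6 = 14, within the 16 = 4² claimed.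
  calc (s * (σ (P r) - σ (P₀ r))) ^ 2 + ((s * A) ^ 2 * ‖x‖ ^ 2 + (s * A * γ) ^ 2)
      = s ^ 2 * ((σ (P r) - σ (P₀ r)) ^ 2 + A ^ 2 * ‖x‖ ^ 2 + A ^ 2 * γ ^ 2) := by ring
    _ ≤ s ^ 2 * (2 * C ^ 2 * n + 6 * C ^ 2 * n * 1 + 6 * C ^ 2 * n * 1) := by
        have hn0 : 0 ≤ n := by positivity
        gcongr
    _ ≤ (4 * C * s) ^ 2 * n := by
        have hn0 : 0 ≤ n := by positivity
        nlinarith [mul_nonneg (mul_nonneg (sq_nonneg s) (sq_nonneg C)) hn0]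

end Network


/-! ### Distance between network SGD and its linearization -/

section Deviation

/-- A linear step contracts the difference of two iterates by 1 - s lam, since s‖Φ‖² ≤ 1 - s lam.
What remains is s times the local error: the prediction error times the feature, plus the residual
times the gradient error. -/
lemma norm_sgdStep_sub_linStep_le {H : Type*} [NormedAddCommGroup H] [InnerProductSpace ℝ H]
    {Φ G u v : H} {g y s lam κ ε : ℝ} (hs : 0 ≤ s)
    (hsl : s * (lam + κ ^ 2) ≤ 1) (hΦ : ‖Φ‖ ≤ κ) (hy : |y| ≤ 1) (hε : 0 ≤ ε)
    (hg : |g - inner ℝ Φ u| ≤ ε * ‖u‖ ^ 2) (hG : ‖G - Φ‖ ≤ ε * ‖u‖) :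
    ‖((1 - s * lam) • u - (s * (g - y)) • G)
        - ((1 - s * lam) • v - (s * (inner ℝ Φ v - y)) • Φ)‖
      ≤ (1 - s * lam) * ‖u - v‖
        + s * (ε * ‖u‖ ^ 2 * κ + (κ * ‖u‖ + ε * ‖u‖ ^ 2 + 1) * (ε * ‖u‖)) := by
  have hκ : ‖Φ‖ ^ 2 ≤ κ ^ 2 := by gcongr
  have h2 : s * ‖Φ‖ ^ 2 ≤ 1 - s * lam := by nlinarith
  have h0 : 0 ≤ 1 - s * lam := le_trans (by positivity) h2
  set e := u - v with he
  have hdecomp : ((1 - s * lam) • u - (s * (g - y)) • G)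
        - ((1 - s * lam) • v - (s * (inner ℝ Φ v - y)) • Φ)
      = ((1 - s * lam) • e - (s * inner ℝ Φ e) • Φ)
        - s • ((g - inner ℝ Φ u) • Φ + (g - y) • (G - Φ)) := by
    rw [he, inner_sub_right]
    module
  have h3 : ‖(1 - s * lam) • e - (s * inner ℝ Φ e) • Φ‖ ≤ (1 - s * lam) * ‖e‖ := by
    refine le_of_sq_le_sq ?_ (by positivity)
    rw [norm_sub_sq_real, inner_smul_left, inner_smul_right, norm_smul, norm_smul,
      real_inner_comm Φ e]
    simp only [mul_pow, Real.norm_eq_abs, sq_abs, conj_trivial]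
    have h4 : s ^ 2 * inner ℝ Φ e ^ 2 * ‖Φ‖ ^ 2 ≤ s * inner ℝ Φ e ^ 2 * (1 - s * lam) := by
      have : s ^ 2 * inner ℝ Φ e ^ 2 * ‖Φ‖ ^ 2 = s * inner ℝ Φ e ^ 2 * (s * ‖Φ‖ ^ 2) := by ring
      rw [this]; gcongr
    have h5 : 0 ≤ s * inner ℝ Φ e ^ 2 * (1 - s * lam) := by positivity
    nlinarith
  have hgb : |g - y| ≤ κ * ‖u‖ + ε * ‖u‖ ^ 2 + 1 := by
    have e1 : g - y = inner ℝ Φ u + (g - inner ℝ Φ u) - y := by ring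
    have e2 : |inner ℝ Φ u| ≤ κ * ‖u‖ := (abs_real_inner_le_norm _ _).trans (by gcongr)
    rw [e1]
    refine (abs_sub _ _).trans (add_le_add ((abs_add_le _ _).trans (add_le_add e2 hg)) hy)
  rw [hdecomp]
  refine (norm_sub_le _ _).trans (add_le_add h3 ?_)
  rw [norm_smul, Real.norm_eq_abs, abs_of_nonneg hs]
  refine mul_le_mul_of_nonneg_left ((norm_add_le _ _).trans (add_le_add ?_ ?_)) hs
  · rw [norm_smul, Real.norm_eq_abs]; gcongr
  · rw [norm_smul, Real.norm_eq_abs]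
    have : 0 ≤ κ * ‖u‖ + ε * ‖u‖ ^ 2 + 1 := (abs_nonneg _).trans hgb
    gcongr

variable {d m : ℕ} {σ : ℝ → ℝ} {C γ : ℝ}

lemma displacement_self (Θ : Params d m) : displacement Θ Θ = 0 := by
  have h : ‖displacement Θ Θ‖ ^ 2 = 0 := by
    unfold displacement
    rw [norm_sq_blocks]
    simp
  simpa using h

/-- Stochastic gradient descent for the network stays close to stochastic gradient descent for
its linearization at the initialization. -/
theorem norm_displacement_sub_linSgd_le (hσ : IsActivation σ C) (hγ : γ ∈ Set.Icc (0 : ℝ) 1)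
    (hm : 1 ≤ m) {w : Fin m → Inp d} (hw : ∀ r, ‖w r‖ = 1) {lam η θ B κ ε : ℝ}
    (hκ : κ = Real.sqrt (4 + 2 * C ^ 2)) (hε : ε = 4 * C / Real.sqrt (2 * m)) (hB : 1 ≤ B)
    (hlamB : lam * B ^ 2 = 1) (hη : 0 ≤ η) (hθ : 0 ≤ θ) (hηl : η * (lam + κ ^ 2) ≤ 1)
    (hsmall : ε * B ^ 2 * (8 * κ + 8 * ε * B + 2) * B ^ 2 ≤ B) {T : ℕ} {z : Fin T → Inp d × ℝ}
    (hx : ∀ i, ‖(z i).1‖ ≤ 1) (hy : ∀ i, |(z i).2| ≤ 1) :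
    ‖displacement (initParams 1 w) (sgd σ γ lam η θ (initParams 1 w) T z)
        - linSgd (initFeature σ γ w) lam (stepSize η θ) T z‖
      ≤ ε * B ^ 2 * (8 * κ + 8 * ε * B + 2) * B ^ 2 := by
  have hlam : 0 < lam := by
    by_contra h
    nlinarith [sq_nonneg B, not_lt.1 h]
  have hC := hσ.pos
  have hκ0 : 0 ≤ κ := hκ ▸ Real.sqrt_nonneg _
  have hε0 : 0 ≤ ε := by rw [hε]; positivity
  have hsl : ∀ t, stepSize η θ t * (lam + κ ^ 2) ≤ 1 := fun t =>
    le_trans (by gcongr; exact stepSize_le hη hθ t) hηl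
  -- The local error of one step when ‖u‖ ≤ 2B. Since B² = 1 / lam, the value E B² is the fixed
  -- point of x ↦ (1 - s lam) x + s E and survives the induction; `hsmall` keeps it below B, which
  -- restores ‖u‖ ≤ 2B.
  set E := ε * B ^ 2 * (8 * κ + 8 * ε * B + 2) with hE
  induction T with
  | zero =>
    simp only [sgd, linSgd, displacement_self, sub_zero, norm_zero]
    positivity
  | succ T ih =>
    have ih' := ih (z := fun i => z i.castSucc) (fun i => hx _) (fun i => hy _)
    set Θ := sgd σ γ lam η θ (initParams 1 w) T (fun i => z i.castSucc) with hΘ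
    set u := displacement (initParams 1 w) Θ with hu
    set v := linSgd (initFeature σ γ w) lam (stepSize η θ) T (fun i => z i.castSucc) with hv
    have hΦ : ∀ x : Inp d, ‖x‖ ≤ 1 → ‖initFeature σ γ w x‖ ≤ κ := fun x hx =>
      hκ ▸ norm_initFeature_le hσ hγ hm hw hx
    have hvB : ‖v‖ ≤ B := by
      have h1 := norm_linSgd_sq_le (stepSize_nonneg hη) hlam hsl
        (z := fun i : Fin T => z i.castSucc) (fun i => hΦ _ (hx _)) (fun i => hy _)
      refine le_of_sq_le_sq (h1.trans (le_of_eq ?_)) (by linarith)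
      rw [div_eq_iff hlam.ne', mul_comm]; exact hlamB.symm
    have huB : ‖u‖ ≤ 2 * B := by
      have h1 : ‖u‖ ≤ ‖v‖ + ‖u - v‖ := by simpa using norm_add_le v (u - v)
      linarith
    have hstep := norm_sgdStep_sub_linStep_le (Φ := initFeature σ γ w (z (Fin.last T)).1)
      (G := gradient σ γ Θ (z (Fin.last T)).1) (u := u) (v := v)
      (g := network σ γ Θ (z (Fin.last T)).1) (y := (z (Fin.last T)).2)
      (stepSize_nonneg (θ := θ) hη T) (hsl T) (hΦ _ (hx _)) (hy _) hε0
      (by rw [hε]; exact abs_network_sub_inner_le hσ hγ w Θ (hx _))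
      (by rw [hε]; exact norm_gradient_sub_le hσ hγ w Θ (hx _))
    have hsgd : displacement (initParams 1 w) (sgd σ γ lam η θ (initParams 1 w) (T + 1) z)
        = (1 - stepSize η θ T * lam) • u
          - (stepSize η θ T * (network σ γ Θ (z (Fin.last T)).1 - (z (Fin.last T)).2))
            • gradient σ γ Θ (z (Fin.last T)).1 :=
      displacement_sgdStep σ γ lam _ _ Θ _
    rw [hsgd]
    refine hstep.trans ?_
    have hs0 : 0 ≤ stepSize η θ T := stepSize_nonneg hη T
    have h1 : 0 ≤ 1 - stepSize η θ T * lam := by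
      have := hsl T; nlinarith [mul_nonneg hs0 (sq_nonneg κ)]
    have hErr : ε * ‖u‖ ^ 2 * κ + (κ * ‖u‖ + ε * ‖u‖ ^ 2 + 1) * (ε * ‖u‖) ≤ E := by
      calc _ ≤ ε * (2 * B) ^ 2 * κ + (κ * (2 * B) + ε * (2 * B) ^ 2 + 1) * (ε * (2 * B)) := by
            gcongr
        _ = ε * B ^ 2 * (8 * κ + 8 * ε * B) + 2 * ε * B := by ring
        _ ≤ ε * B ^ 2 * (8 * κ + 8 * ε * B) + 2 * ε * B ^ 2 := by gcongr; nlinarith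
        _ = E := by rw [hE]; ring
    calc _ ≤ (1 - stepSize η θ T * lam) * (E * B ^ 2) + stepSize η θ T * E := by gcongr
      _ = E * B ^ 2 + stepSize η θ T * E * (1 - lam * B ^ 2) := by ring
      _ = E * B ^ 2 := by rw [hlamB]; ring

lemma abs_network_le (hσ : IsActivation σ C) (hγ : γ ∈ Set.Icc (0 : ℝ) 1)
    (hm : 1 ≤ m) {w : Fin m → Inp d} (hw : ∀ r, ‖w r‖ = 1) {κ B : ℝ}
    (hκ : κ = Real.sqrt (4 + 2 * C ^ 2)) (Θ : Params d m)
    (hΘ : ‖displacement (initParams 1 w) Θ‖ ≤ B) {x : Inp d} (hx : ‖x‖ ≤ 1) :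
    |network σ γ Θ x| ≤ κ * B + 4 * C * B ^ 2 ∧ ‖gradient σ γ Θ x‖ ≤ κ + 4 * C * B := by
  have hC := hσ.pos
  have hm0 : (1 : ℝ) ≤ m := by exact_mod_cast hm
  have hs1 : 4 * C / Real.sqrt (2 * m) ≤ 4 * C := by
    refine div_le_self (by positivity) ?_
    rw [Real.one_le_sqrt]; linarith
  have hΦ : ‖initFeature σ γ w x‖ ≤ κ := hκ ▸ norm_initFeature_le hσ hγ hm hw hx
  have h1 := abs_network_sub_inner_le hσ hγ w Θ hx
  have h2 := norm_gradient_sub_le hσ hγ w Θ hx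
  set u := displacement (initParams 1 w) Θ
  constructor
  · have h3 : |inner ℝ (initFeature σ γ w x) u| ≤ κ * B :=
      (abs_real_inner_le_norm _ _).trans (mul_le_mul hΦ hΘ (norm_nonneg _)
        ((norm_nonneg _).trans hΦ))
    have h4 : 4 * C / Real.sqrt (2 * m) * ‖u‖ ^ 2 ≤ 4 * C * B ^ 2 := by gcongr
    have h5 : network σ γ Θ x = inner ℝ (initFeature σ γ w x) u
        + (network σ γ Θ x - inner ℝ (initFeature σ γ w x) u) := by ring
    rw [h5]
    exact (abs_add_le _ _).trans (add_le_add h3 (h1.trans h4))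
  · have h4 : 4 * C / Real.sqrt (2 * m) * ‖u‖ ≤ 4 * C * B := by gcongr
    have h5 : gradient σ γ Θ x = initFeature σ γ w x
        + (gradient σ γ Θ x - initFeature σ γ w x) := by abel
    rw [h5]
    exact (norm_add_le _ _).trans (add_le_add hΦ (h2.trans h4))

/-- For a bounded number of steps, the network stays bounded uniformly in its width. -/
theorem exists_network_sgd_bound (hσ : IsActivation σ C) (hγ : γ ∈ Set.Icc (0 : ℝ) 1)
    {η θ : ℝ} (hη : 0 ≤ η) (hθ : 0 ≤ θ) (d T : ℕ) :
    ∃ B : ℝ, 0 ≤ B ∧ ∀ (m : ℕ), 1 ≤ m → ∀ w : Fin m → Inp d, (∀ r, ‖w r‖ = 1) →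
      ∀ lam, 0 ≤ lam → η * lam ≤ 1 → ∀ t ≤ T, ∀ z : Fin t → Inp d × ℝ,
        (∀ i, ‖(z i).1‖ ≤ 1) → (∀ i, |(z i).2| ≤ 1) → ∀ x : Inp d, ‖x‖ ≤ 1 →
          |network σ γ (sgd σ γ lam η θ (initParams 1 w) t z) x| ≤ B := by
  have hC := hσ.pos
  set κ := Real.sqrt (4 + 2 * C ^ 2) with hκ
  have hκ0 : 0 ≤ κ := Real.sqrt_nonneg _
  have key : ∃ B : ℝ, 0 ≤ B ∧ ∀ (m : ℕ), 1 ≤ m → ∀ w : Fin m → Inp d, (∀ r, ‖w r‖ = 1) →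
      ∀ lam, 0 ≤ lam → η * lam ≤ 1 → ∀ t ≤ T, ∀ z : Fin t → Inp d × ℝ,
        (∀ i, ‖(z i).1‖ ≤ 1) → (∀ i, |(z i).2| ≤ 1) →
          ‖displacement (initParams 1 w) (sgd σ γ lam η θ (initParams 1 w) t z)‖ ≤ B := by
    induction T with
    | zero =>
      refine ⟨0, le_rfl, fun m hm w hw lam hlam hηl t ht z hx hy => ?_⟩
      obtain rfl : t = 0 := by omega
      simp [sgd, displacement_self]
    | succ T ih =>
      obtain ⟨B, hB0, hB⟩ := ih
      -- One step adds at most η times a residual bound times a gradient bound. The constant may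
      -- grow quickly with T but never involves m.
      refine ⟨B + η * (κ * B + 4 * C * B ^ 2 + 1) * (κ + 4 * C * B), by positivity,
        fun m hm w hw lam hlam hηl t ht z hx hy => ?_⟩
      have hnn : 0 ≤ η * (κ * B + 4 * C * B ^ 2 + 1) * (κ + 4 * C * B) := by positivity
      rcases Nat.lt_or_ge t (T + 1) with h | h
      · exact (hB m hm w hw lam hlam hηl t (by omega) z hx hy).trans (by linarith)
      · obtain rfl : t = T + 1 := by omega
        have h1 := hB m hm w hw lam hlam hηl T le_rfl (fun i => z i.castSucc) (fun i => hx _)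
          (fun i => hy _)
        set Θ := sgd σ γ lam η θ (initParams 1 w) T (fun i => z i.castSucc) with hΘ
        have h2 := abs_network_le hσ hγ hm hw hκ Θ h1 (hx (Fin.last T))
        have hs0 : 0 ≤ stepSize η θ T := stepSize_nonneg hη T
        have hsη : stepSize η θ T ≤ η := stepSize_le hη hθ T
        have hsgd : displacement (initParams 1 w) (sgd σ γ lam η θ (initParams 1 w) (T + 1) z)
            = (1 - stepSize η θ T * lam) • displacement (initParams 1 w) Θ
              - (stepSize η θ T * (network σ γ Θ (z (Fin.last T)).1 - (z (Fin.last T)).2))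
                • gradient σ γ Θ (z (Fin.last T)).1 :=
          displacement_sgdStep σ γ lam _ _ Θ _
        rw [hsgd]
        refine (norm_sub_le _ _).trans (add_le_add ?_ ?_)
        · rw [norm_smul, Real.norm_eq_abs]
          have h3 : stepSize η θ T * lam ≤ 1 := le_trans (by gcongr) hηl
          have h4 : 0 ≤ stepSize η θ T * lam := by positivity
          have h5 : |1 - stepSize η θ T * lam| ≤ 1 := by rw [abs_le]; constructor <;> linarith
          exact (mul_le_of_le_one_left (norm_nonneg _) h5).trans h1
        · rw [norm_smul, Real.norm_eq_abs, abs_mul, abs_of_nonneg hs0]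
          have h3 : |network σ γ Θ (z (Fin.last T)).1 - (z (Fin.last T)).2|
              ≤ κ * B + 4 * C * B ^ 2 + 1 := (abs_sub _ _).trans (add_le_add h2.1 (hy _))
          have h4 := h2.2
          gcongr
  obtain ⟨B, hB0, hB⟩ := key
  refine ⟨κ * B + 4 * C * B ^ 2, by positivity,
    fun m hm w hw lam hlam hηl t ht z hx hy x hx1 => ?_⟩
  exact (abs_network_le hσ hγ hm hw hκ _ (hB m hm w hw lam hlam hηl t ht z hx hy) hx1).1

end Deviation

/-! ### The limit kernel -/

section Kernel

variable {d : ℕ} {σ : ℝ → ℝ} {C γ : ℝ}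

lemma isProbabilityMeasure_sphereUniform (hd : 1 ≤ d) :
    IsProbabilityMeasure (sphereUniform d) := by
  have : Nonempty (Fin d) := ⟨⟨0, hd⟩⟩
  have hne : (volume : Measure (Inp d)).toSphere Set.univ ≠ 0 := by
    rw [Measure.measure_univ_ne_zero]
    exact Measure.toSphere_ne_zero _
  unfold sphereUniform
  have : IsProbabilityMeasure (((volume : Measure (Inp d)).toSphere Set.univ)⁻¹
      • (volume : Measure (Inp d)).toSphere) :=
    ⟨by
      rw [Measure.smul_apply, smul_eq_mul]
      exact ENNReal.inv_mul_cancel hne (measure_ne_top _ _)⟩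
  exact Measure.isProbabilityMeasure_map measurable_subtype_coe.aemeasurable

lemma ae_sphereUniform_norm_eq (d : ℕ) : ∀ᵐ b ∂(sphereUniform d), ‖b‖ = 1 := by
  unfold sphereUniform
  rw [ae_map_iff measurable_subtype_coe.aemeasurable
    (measurableSet_eq_fun measurable_norm measurable_const)]
  exact .of_forall fun b => by simp

/-- Presents the limit kernel as the expectation of the one-neuron kernel whose empirical mean is
the feature kernel, the form that concentration needs. -/
lemma ntk_eq_integral (hd : 1 ≤ d) (hσ : IsActivation σ C) (x x' : Inp d) :
    ntk σ 1 γ x x' = ∫ b, neuronKernel σ γ b (x, x') ∂(sphereUniform d) := by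
  have := isProbabilityMeasure_sphereUniform hd
  have hc := hσ.continuous
  have hc' := hσ.continuous_deriv
  have hC := hσ.pos
  have hg : ∀ x : Inp d, ∀ᵐ b ∂(sphereUniform d), |σ (inner ℝ b x)| ≤ 1 + ‖x‖ := by
    intro x
    filter_upwards [ae_sphereUniform_norm_eq d] with b hb
    have h2 : |inner ℝ b x| ≤ ‖b‖ * ‖x‖ := abs_real_inner_le_norm _ _
    rw [hb, one_mul] at h2
    linarith [hσ.growth (inner ℝ b x)]
  have h1 : Integrable (fun b => σ (inner ℝ b x) * σ (inner ℝ b x')) (sphereUniform d) := by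
    refine Integrable.of_bound (Continuous.aestronglyMeasurable (by fun_prop))
      ((1 + ‖x‖) * (1 + ‖x'‖)) ?_
    filter_upwards [hg x, hg x'] with b h1 h2
    rw [norm_mul, Real.norm_eq_abs, Real.norm_eq_abs]; gcongr
  have h2 : Integrable (fun b => deriv σ (inner ℝ b x) * deriv σ (inner ℝ b x'))
      (sphereUniform d) := by
    refine Integrable.of_bound (Continuous.aestronglyMeasurable (by fun_prop)) (C * C) ?_
    refine .of_forall fun b => ?_
    rw [norm_mul, Real.norm_eq_abs, Real.norm_eq_abs]
    exact mul_le_mul (hσ.deriv_le _) (hσ.deriv_le _) (abs_nonneg _) hC.le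
  unfold ntk neuronKernel
  rw [integral_add h1 (h2.const_mul _), integral_const_mul]
  simp

lemma isBoundedKernel_ntk (hd : 1 ≤ d) (hσ : IsActivation σ C) (hγ : γ ∈ Set.Icc (0 : ℝ) 1) :
    IsBoundedKernel (ntk (d := d) σ 1 γ) (fun x => ‖x‖ ≤ 1) (Real.sqrt (4 + 2 * C ^ 2) ^ 2) := by
  have := isProbabilityMeasure_sphereUniform hd
  refine ⟨?_, fun x x' hx hx' => ?_⟩
  · have h1 : Function.uncurry (ntk (d := d) σ 1 γ)
        = fun q => ∫ b, neuronKernel σ γ b q ∂(sphereUniform d) := by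
      funext q; exact ntk_eq_integral hd hσ q.1 q.2
    rw [h1]
    have h2 : StronglyMeasurable (Function.uncurry fun (q : Inp d × Inp d) (b : Inp d) =>
        neuronKernel σ γ b q) :=
      ((measurable_neuronKernel hσ).comp measurable_swap).stronglyMeasurable
    exact h2.integral_prod_right.measurable
  · rw [ntk_eq_integral hd hσ, Real.sq_sqrt (by positivity)]
    have h1 := norm_integral_le_of_norm_le_const (μ := sphereUniform d)
      (f := fun b => neuronKernel σ γ b (x, x')) (C := 4 + 2 * C ^ 2)
      (by
        filter_upwards [ae_sphereUniform_norm_eq d] with b hb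
        exact abs_neuronKernel_le hσ hγ hb ⟨hx, hx'⟩)
    simpa using h1

lemma ntk_symm (x x' : Inp d) : ntk σ 1 γ x x' = ntk σ 1 γ x' x := by
  unfold ntk
  simp only [mul_comm (σ (inner ℝ _ x)), mul_comm (deriv σ (inner ℝ _ x)), real_inner_comm x x']

end Kernel

/-! ### The regression function -/

section Regression

variable {d : ℕ} {ρ : Measure (Inp d × ℝ)} [IsProbabilityMeasure ρ]

lemma ae_condKernel_abs_le (hY : ∀ᵐ z ∂ρ, |z.2| ≤ 1) :
    ∀ᵐ x ∂ρ.fst, ∀ᵐ y ∂(ρ.condKernel x), |y| ≤ 1 := by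
  rw [← ρ.disintegrate ρ.condKernel] at hY
  exact Measure.ae_ae_of_ae_compProd hY

lemma ae_abs_regression_le (hY : ∀ᵐ z ∂ρ, |z.2| ≤ 1) :
    ∀ᵐ x ∂ρ.fst, |regression ρ x| ≤ 1 := by
  filter_upwards [ae_condKernel_abs_le hY] with x hx
  have := norm_integral_le_of_norm_le_const (μ := ρ.condKernel x) (f := fun y => y) (C := 1) hx
  simpa [regression] using this

/-- By disintegration over the input. It lets the regression function replace the labels in the
normal equations of the linear model. -/
lemma integral_label_mul (hY : ∀ᵐ z ∂ρ, |z.2| ≤ 1) {f : Inp d → ℝ} (hf : Measurable f) {B : ℝ}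
    (hB : ∀ᵐ x ∂ρ.fst, |f x| ≤ B) :
    ∫ z, z.2 * f z.1 ∂ρ = ∫ x, regression ρ x * f x ∂ρ.fst := by
  have hB' : ∀ᵐ z ∂ρ, |f z.1| ≤ B := ae_of_ae_map measurable_fst.aemeasurable hB
  have hi : Integrable (fun z : Inp d × ℝ => z.2 * f z.1) ρ := by
    refine Integrable.of_bound (Measurable.aestronglyMeasurable (by fun_prop)) (1 * B) ?_
    filter_upwards [hY, hB'] with z h1 h2
    rw [norm_mul, Real.norm_eq_abs, Real.norm_eq_abs]
    gcongr
  conv_lhs => rw [← ρ.disintegrate ρ.condKernel]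
  rw [Measure.integral_compProd (by rwa [ρ.disintegrate ρ.condKernel])]
  refine integral_congr_ae (.of_forall fun x => ?_)
  simp only [regression, integral_mul_const]

end Regression


/-! ### Good initializations and the risk of the network -/

section Risk

variable {d m : ℕ} {σ : ℝ → ℝ} {C γ : ℝ}

/-- An event that contains all unit initializations with a small kernel error has probability at
least `1 - δ`. -/
theorem ofReal_one_sub_le_initLaw (hd : 1 ≤ d) (hσ : IsActivation σ C)
    (hγ : γ ∈ Set.Icc (0 : ℝ) 1) {ν : Measure (Inp d)} [IsProbabilityMeasure ν]
    (hν : ∀ᵐ x ∂ν, ‖x‖ ≤ 1) (hm : 1 ≤ m) {δ : ℝ} (hδ : 0 < δ) {S : Set (Fin m → Inp d)}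
    (hS : ∀ w : Fin m → Inp d, (∀ r, ‖w r‖ = 1) →
      ∫ q, (ntk σ 1 γ q.1 q.2 - inner ℝ (initFeature σ γ w q.1) (initFeature σ γ w q.2)) ^ 2
        ∂(ν.prod ν) ≤ 4 * (4 + 2 * C ^ 2) ^ 2 * Real.log (2 / δ) / m → w ∈ S) :
    ENNReal.ofReal (1 - δ) ≤ initLaw d m S := by
  have := isProbabilityMeasure_sphereUniform hd
  have hprob : IsProbabilityMeasure (initLaw d m) := by unfold initLaw; infer_instance
  have hν2 : ∀ᵐ q ∂(ν.prod ν), ‖q.1‖ ≤ 1 ∧ ‖q.2‖ ≤ 1 := by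
    have h1 : ∀ᵐ q ∂(ν.prod ν), ‖q.1‖ ≤ 1 := Measure.quasiMeasurePreserving_fst.ae hν
    have h2 : ∀ᵐ q ∂(ν.prod ν), ‖q.2‖ ≤ 1 := Measure.quasiMeasurePreserving_snd.ae hν
    filter_upwards [h1, h2] with q h1 h2 using ⟨h1, h2⟩
  have hbad := measure_meanSquare_deviation_le (P := sphereUniform d) (τ := ν.prod ν)
    (ψ := neuronKernel σ γ) (measurable_neuronKernel hσ) (A := 4 + 2 * C ^ 2) (by positivity)
    (ae_sphereUniform_norm_eq d) hν2
    (fun b q hb hq => abs_neuronKernel_le hσ hγ hb hq) hm hδ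
  have hunit : ∀ᵐ w ∂(initLaw d m), ∀ r, ‖w r‖ = 1 :=
    ae_pi_of_ae (ae_sphereUniform_norm_eq d) m
  have hle : initLaw d m Sᶜ ≤ ENNReal.ofReal δ := by
    refine le_trans (measure_mono_ae ?_) hbad
    filter_upwards [hunit] with w hw hwS
    by_contra hcon
    refine hwS (hS w hw (le_trans (le_of_eq ?_) (not_lt.1 hcon)))
    refine integral_congr_ae (.of_forall fun q => ?_)
    simp only
    rw [ntk_eq_integral hd hσ, inner_initFeature hm]
    ring
  -- Subadditivity only, because S need not be measurable.
  have h1 : (1 : ENNReal) ≤ initLaw d m S + ENNReal.ofReal δ := by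
    calc (1 : ENNReal) = initLaw d m Set.univ := measure_univ.symm
      _ ≤ initLaw d m S + initLaw d m Sᶜ := by
        rw [← Set.union_compl_self S]; exact measure_union_le _ _
      _ ≤ _ := by gcongr
  rw [ENNReal.ofReal_sub _ hδ.le, ENNReal.ofReal_one]
  exact tsub_le_iff_right.2 h1

/-- For wide networks, the network trained by SGD is uniformly close to its linearization at the
initialization. -/
theorem abs_network_sgd_sub_linear_le (hσ : IsActivation σ C) (hγ : γ ∈ Set.Icc (0 : ℝ) 1)
    (hm : 1 ≤ m) {w : Fin m → Inp d} (hw : ∀ r, ‖w r‖ = 1) {lam η θ κ c : ℝ}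
    (hκ : κ = Real.sqrt (4 + 2 * C ^ 2)) (hc : c = 4 * C * (8 * κ + 32 * C + 2))
    (hlam : 0 < lam) (hlam1 : lam ≤ 1) (hη : 0 ≤ η) (hθ : 0 ≤ θ)
    (hηl : η * (lam + κ ^ 2) ≤ 1) {T : ℕ} (hT : 1 ≤ T) (hcT : c ≤ Real.sqrt T)
    (hTm : (T : ℝ) ≤ 2 * m * lam ^ 5) {z : Fin T → Inp d × ℝ}
    (hx : ∀ i, ‖(z i).1‖ ≤ 1) (hy : ∀ i, |(z i).2| ≤ 1) {x : Inp d} (hx1 : ‖x‖ ≤ 1) :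
    |network σ γ (sgd σ γ lam η θ (initParams 1 w) T z) x
        - inner ℝ (initFeature σ γ w x) (linSgd (initFeature σ γ w) lam (stepSize η θ) T z)|
      ≤ (16 * C + κ * c) / Real.sqrt T := by
  have hC := hσ.pos
  have hκ0 : 0 ≤ κ := hκ ▸ Real.sqrt_nonneg _
  have hm0 : (0 : ℝ) < m := by exact_mod_cast hm
  have hT1 : (1 : ℝ) ≤ T := by exact_mod_cast hT
  have hsT : 1 ≤ Real.sqrt T := by rw [Real.one_le_sqrt]; exact hT1
  have hsT0 : 0 < Real.sqrt T := by linarith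
  set q := Real.sqrt lam with hq
  have hq0 : 0 < q := Real.sqrt_pos.2 hlam
  have hq2 : q ^ 2 = lam := Real.sq_sqrt hlam.le
  have hq1 : q ≤ 1 := by rw [hq]; exact Real.sqrt_le_one.2 hlam1
  -- B = lam ^ (-1/2), the a priori bound for the linear iterates.
  set B := q⁻¹ with hBdef
  have hB : 1 ≤ B := (one_le_inv₀ hq0).2 hq1
  have hlamB : lam * B ^ 2 = 1 := by
    rw [← hq2, hBdef]; field_simp
  set ε := 4 * C / Real.sqrt (2 * m) with hε
  have hs2m : 0 < Real.sqrt (2 * m) := Real.sqrt_pos.2 (by positivity)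
  have hε0 : 0 ≤ ε := by rw [hε]; positivity
  -- The width condition as B⁵ / √(2m) ≤ 1 / √T. The deviation bound uses four powers of B: two from
  -- the squared displacement and two from the accumulation over steps.
  have hsq : Real.sqrt T ≤ Real.sqrt (2 * m) * q ^ 5 := by
    calc Real.sqrt T ≤ Real.sqrt (2 * m * (q ^ 5) ^ 2) := by
          apply Real.sqrt_le_sqrt
          calc (T : ℝ) ≤ 2 * m * lam ^ 5 := hTm
            _ = 2 * m * (q ^ 5) ^ 2 := by rw [← hq2]; ring
      _ = _ := by rw [Real.sqrt_mul (by positivity), Real.sqrt_sq (by positivity)]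
  have hεB : ε * B ^ 5 ≤ 4 * C / Real.sqrt T := by
    rw [hε, hBdef, inv_pow, ← div_eq_mul_inv, div_div]
    gcongr
  have hmono : ∀ i ≤ 5, ε * B ^ i ≤ 4 * C / Real.sqrt T := fun i hi =>
    le_trans (by gcongr) hεB
  have hεB1 : ε * B ≤ 4 * C := by
    have h1 := hmono 1 (by norm_num)
    rw [pow_one] at h1
    exact h1.trans (div_le_self (by positivity) hsT)
  have hEc : ε * B ^ 2 * (8 * κ + 8 * ε * B + 2) * B ^ 2 ≤ c / Real.sqrt T := by
    calc ε * B ^ 2 * (8 * κ + 8 * ε * B + 2) * B ^ 2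
        = (ε * B ^ 4) * (8 * κ + 8 * (ε * B) + 2) := by ring
      _ ≤ (4 * C / Real.sqrt T) * (8 * κ + 8 * (4 * C) + 2) := by
        gcongr
        exact hmono 4 (by norm_num)
      _ = c / Real.sqrt T := by rw [hc]; ring
  have hc1 : c / Real.sqrt T ≤ 1 := (div_le_one hsT0).2 hcT
  have hdiff := norm_displacement_sub_linSgd_le hσ hγ hm hw hκ hε hB hlamB hη hθ hηl
    (hEc.trans (hc1.trans hB)) hx hy
  have hΦ : ∀ x : Inp d, ‖x‖ ≤ 1 → ‖initFeature σ γ w x‖ ≤ κ := fun x hx => by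
    rw [hκ]; exact norm_initFeature_le hσ hγ hm hw hx
  have hsl : ∀ t, stepSize η θ t * (lam + κ ^ 2) ≤ 1 := fun t =>
    le_trans (by gcongr; exact stepSize_le hη hθ t) hηl
  have hlin : ‖linSgd (initFeature σ γ w) lam (stepSize η θ) T z‖ ≤ B := by
    have h1 := norm_linSgd_sq_le (stepSize_nonneg hη) hlam hsl
      (fun i => hΦ _ (hx i)) hy
    refine abs_le_of_sq_le_sq' (h1.trans ?_) (by positivity) |>.2
    rw [div_le_iff₀ hlam]
    linarith
  set u := linSgd (initFeature σ γ w) lam (stepSize η θ) T z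
  set v := displacement (initParams 1 w) (sgd σ γ lam η θ (initParams 1 w) T z)
  have hvu : ‖v - u‖ ≤ c / Real.sqrt T := hdiff.trans hEc
  have hv : ‖v‖ ≤ 2 * B := by
    calc ‖v‖ = ‖(v - u) + u‖ := by rw [sub_add_cancel]
      _ ≤ ‖v - u‖ + ‖u‖ := norm_add_le _ _
      _ ≤ 2 * B := by linarith
  have h1 := abs_network_sub_inner_le hσ hγ w (sgd σ γ lam η θ (initParams 1 w) T z) hx1
  have h2 : |inner ℝ (initFeature σ γ w x) (v - u)| ≤ κ * (c / Real.sqrt T) :=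
    (abs_real_inner_le_norm _ _).trans (by gcongr; exact hΦ x hx1)
  have h3 : ε * ‖v‖ ^ 2 ≤ 16 * C / Real.sqrt T := by
    calc ε * ‖v‖ ^ 2 ≤ ε * (2 * B) ^ 2 := by gcongr
      _ = 4 * (ε * B ^ 2) := by ring
      _ ≤ 4 * (4 * C / Real.sqrt T) := by gcongr; exact hmono 2 (by norm_num)
      _ = _ := by ring
  rw [inner_sub_right] at h2
  calc _ ≤ _ := abs_sub_le _ (inner ℝ (initFeature σ γ w x) v) _
    _ ≤ 16 * C / Real.sqrt T + κ * (c / Real.sqrt T) := add_le_add (h1.trans h3) h2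
    _ = _ := by ring

lemma continuous_network (hσ : IsActivation σ C) (Θ : Params d m) :
    Continuous (network σ γ Θ) := by
  have := hσ.continuous
  unfold network
  fun_prop

/-- The excess risk of a bounded deviation. -/
lemma excessRisk_le_of_abs_sub_le {ρ : Measure (Inp d × ℝ)} [IsProbabilityMeasure ρ]
    {g : Inp d → ℝ} {B : ℝ} (hB : 0 ≤ B) (hg : ∀ᵐ x ∂ρ.fst, |g x - regression ρ x| ≤ B) :
    excessRisk ρ g ≤ ENNReal.ofReal (B ^ 2) := by
  have h := eLpNorm_le_of_ae_bound (p := 2) (f := fun x => g x - regression ρ x) hg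
  simp only [measure_univ, ENNReal.one_rpow, one_mul] at h
  rw [excessRisk, ENNReal.ofReal_pow hB]
  gcongr

/-- The excess risk of a function that is uniformly close to a square-integrable one. -/
lemma excessRisk_le_add {ρ : Measure (Inp d × ℝ)} [IsProbabilityMeasure ρ]
    {F G : Lp ℝ 2 ρ.fst} (hF : F =ᵐ[ρ.fst] regression ρ) {g : Inp d → ℝ} (hg : Continuous g)
    {B : ℝ} (hB : 0 ≤ B) (hgG : ∀ᵐ x ∂ρ.fst, |g x - G x| ≤ B) :
    excessRisk ρ g ≤ ENNReal.ofReal (2 * B ^ 2 + 2 * ‖G - F‖ ^ 2) := by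
  have h1 : eLpNorm (fun x => g x - G x) 2 ρ.fst ≤ ENNReal.ofReal B := by
    have h := eLpNorm_le_of_ae_bound (p := 2) (f := fun x => g x - G x) hgG
    simpa using h
  have h2 : eLpNorm (fun x => G x - F x) 2 ρ.fst = ENNReal.ofReal ‖G - F‖ := by
    rw [ofReal_norm, Lp.enorm_def]
    exact eLpNorm_congr_ae (Lp.coeFn_sub G F).symm
  have hGm := Lp.aestronglyMeasurable G
  have hFm := Lp.aestronglyMeasurable F
  have h3 : eLpNorm (fun x => g x - regression ρ x) 2 ρ.fst
      ≤ ENNReal.ofReal (B + ‖G - F‖) := by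
    calc eLpNorm (fun x => g x - regression ρ x) 2 ρ.fst
        = eLpNorm ((fun x => g x - G x) + fun x => G x - F x) 2 ρ.fst := by
          refine eLpNorm_congr_ae ?_
          filter_upwards [hF] with x hx
          simp [hx]
      _ ≤ _ := eLpNorm_add_le (hg.aestronglyMeasurable.sub hGm) (hGm.sub hFm) (by norm_num)
      _ ≤ ENNReal.ofReal B + ENNReal.ofReal ‖G - F‖ := by rw [h2]; gcongr
      _ = _ := (ENNReal.ofReal_add hB (norm_nonneg _)).symm
  calc excessRisk ρ g ≤ ENNReal.ofReal (B + ‖G - F‖) ^ 2 := by rw [excessRisk]; gcongr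
    _ = ENNReal.ofReal ((B + ‖G - F‖) ^ 2) := (ENNReal.ofReal_pow (by positivity) 2).symm
    _ ≤ _ := by
      apply ENNReal.ofReal_le_ofReal
      nlinarith [sq_nonneg (B - ‖G - F‖)]

end Risk


/-! ### Converting the error terms into rates -/

section Rates

/-- The three error terms of the linear recursion, for a kernel error of order `l * lam ^ 5`, are
of order `lam ^ (2 * r) * l`. -/
lemma linear_error_le {r lam l K Q W U E H M V η κ τ c : ℝ} (hr : 1 / 2 ≤ r) (hr1 : r ≤ 1)
    (hlam : 0 < lam) (hlam1 : lam ≤ 1) (hl : 1 / 2 ≤ l) (hK : 0 ≤ K)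
    (hQ : Q = K * l * lam ^ 5) (hM : 0 ≤ M) (hV : 0 ≤ V) (hη : 0 < η) (hc : 0 ≤ c)
    (hW0 : 0 ≤ W) (hW : W ≤ lam ^ r * H * (1 + Real.sqrt Q / lam))
    (hU0 : 0 ≤ U) (hU1 : U ≤ 1 / lam)
    (hU : U ≤ 2 * (M + Real.sqrt Q * (lam ^ (r - 1)) ^ 2) * H ^ 2
      + 2 * Q * (lam ^ (r - 1)) ^ 2 * H ^ 2 / lam)
    (hE : E ≤ c * (lam ^ (2 * r) + Q)) (hτ : τ ≤ lam ^ (2 * r)) :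
    (8 / η ^ 2 + 2) * W ^ 2 + 2 * (2 + 8 * κ ^ 2 * U + 16 * κ ^ 4 * (κ ^ 2 * U + 1) * V)
          * (V * E + 2 * η * τ * κ ^ 2)
      ≤ ((8 / η ^ 2 + 2) * (2 * H ^ 2 * (2 + K))
        + 2 * (V * c * ((2 * (2 + 16 * κ ^ 4 * V)
              + (8 * κ ^ 2 + 16 * κ ^ 6 * V) * (4 * H ^ 2 * (M + 1 + K)))
            + (2 + 16 * κ ^ 4 * V + (8 * κ ^ 2 + 16 * κ ^ 6 * V)) * K)
          + 2 * η * κ ^ 2 * (2 * (2 + 16 * κ ^ 4 * V)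
              + (8 * κ ^ 2 + 16 * κ ^ 6 * V) * (4 * H ^ 2 * (M + 1 + K)))))
        * lam ^ (2 * r) * l := by
  have hl0 : 0 < l := by linarith
  have hQ0 : 0 ≤ Q := by rw [hQ]; positivity
  set R := lam ^ (2 * r) with hR
  have hR0 : 0 < R := Real.rpow_pos_of_pos hlam _
  have hlamR : lam ^ 2 ≤ R := by
    rw [hR, ← Real.rpow_natCast]
    exact Real.rpow_le_rpow_of_exponent_ge hlam hlam1 (by push_cast; linarith)
  have hWR : (lam ^ r) ^ 2 = R := by
    rw [hR, ← Real.rpow_natCast, ← Real.rpow_mul hlam.le]; congr 1; push_cast; ring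
  have hp : (lam ^ (r - 1)) ^ 2 ≤ 1 / lam := by
    rw [← Real.rpow_natCast, ← Real.rpow_mul hlam.le, one_div, ← Real.rpow_neg_one]
    exact Real.rpow_le_rpow_of_exponent_ge hlam hlam1 (by push_cast; linarith)
  have hQlam : Q / lam ^ 2 ≤ K * l := by
    rw [div_le_iff₀ (by positivity), hQ]
    have : lam ^ 5 ≤ lam ^ 2 := pow_le_pow_of_le_one hlam.le hlam1 (by norm_num)
    gcongr
  have hsq : (Real.sqrt Q / lam) ^ 2 = Q / lam ^ 2 := by rw [div_pow, Real.sq_sqrt hQ0]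
  have hs0 : 0 ≤ Real.sqrt Q / lam := by positivity
  have hW2 : W ^ 2 ≤ 2 * H ^ 2 * (2 + K) * R * l := by
    calc W ^ 2 ≤ (lam ^ r * H * (1 + Real.sqrt Q / lam)) ^ 2 := by gcongr
      _ = R * H ^ 2 * (1 + Real.sqrt Q / lam) ^ 2 := by rw [mul_pow, mul_pow, hWR]
      _ ≤ R * H ^ 2 * (2 * (2 + K) * l) := by
        gcongr
        nlinarith [sq_nonneg (1 - Real.sqrt Q / lam)]
      _ = _ := by ring
  have hU2 : U ≤ 4 * H ^ 2 * (M + 1 + K) * l := by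
    have h1 : Real.sqrt Q * (lam ^ (r - 1)) ^ 2 ≤ 1 + K * l := by
      calc _ ≤ Real.sqrt Q * (1 / lam) := by gcongr
        _ = Real.sqrt Q / lam := by ring
        _ ≤ 1 + Q / lam ^ 2 := by rw [← hsq]; nlinarith [sq_nonneg (1 - Real.sqrt Q / lam)]
        _ ≤ _ := by linarith
    have h2 : Q * (lam ^ (r - 1)) ^ 2 / lam ≤ K * l := by
      calc _ ≤ Q * (1 / lam) / lam := by gcongr
        _ = Q / lam ^ 2 := by field_simp
        _ ≤ _ := hQlam
    calc U ≤ 2 * (M + Real.sqrt Q * (lam ^ (r - 1)) ^ 2) * H ^ 2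
          + 2 * (Q * (lam ^ (r - 1)) ^ 2 / lam) * H ^ 2 := by
          refine hU.trans (le_of_eq ?_); ring
      _ ≤ 2 * (M + (1 + K * l)) * H ^ 2 + 2 * (K * l) * H ^ 2 := by gcongr
      _ = H ^ 2 * (2 * M + 2 + 4 * K * l) := by ring
      _ ≤ H ^ 2 * (4 * (M + 1 + K) * l) := by
        gcongr
        nlinarith
      _ = _ := by ring
  set a₀ := 2 + 16 * κ ^ 4 * V with ha₀
  set a₁ := 8 * κ ^ 2 + 16 * κ ^ 6 * V with ha₁
  set c₂ := 4 * H ^ 2 * (M + 1 + K) with hc₂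
  have ha₀0 : 0 ≤ a₀ := by positivity
  have ha₁0 : 0 ≤ a₁ := by positivity
  have hc₂0 : 0 ≤ c₂ := by positivity
  have hD : 2 + 8 * κ ^ 2 * U + 16 * κ ^ 4 * (κ ^ 2 * U + 1) * V = a₀ + a₁ * U := by
    rw [ha₀, ha₁]; ring
  rw [hD]
  set D := a₀ + a₁ * U with hDdef
  have hD0 : 0 ≤ D := by positivity
  have hD1 : D ≤ (2 * a₀ + a₁ * c₂) * l := by
    calc D ≤ a₀ * (2 * l) + a₁ * (c₂ * l) := by
          rw [hDdef]
          gcongr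
          exact le_mul_of_one_le_right ha₀0 (by linarith)
      _ = _ := by ring
  -- Bounding D by a multiple of l would make D * Q quadratic in l. There the bound U ≤ 1 / lam is
  -- used instead, and the powers of lam in Q pay for the loss.
  have hD2 : D ≤ (a₀ + a₁) / lam := by
    have : 1 ≤ 1 / lam := (one_le_div hlam).2 hlam1
    calc D ≤ a₀ * (1 / lam) + a₁ * (1 / lam) := by
          rw [hDdef]
          gcongr
          exact le_mul_of_one_le_right ha₀0 this
      _ = _ := by ring
  have hDQ : D * Q ≤ (a₀ + a₁) * K * R * l := by
    calc D * Q ≤ (a₀ + a₁) / lam * Q := by gcongr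
      _ = (a₀ + a₁) * K * l * lam ^ 4 := by rw [hQ]; field_simp
      _ ≤ (a₀ + a₁) * K * l * R := by
        gcongr
        exact (pow_le_pow_of_le_one hlam.le hlam1 (by norm_num)).trans hlamR
      _ = _ := by ring
  have hDR : D * R ≤ (2 * a₀ + a₁ * c₂) * R * l := by
    calc D * R ≤ (2 * a₀ + a₁ * c₂) * l * R := by gcongr
      _ = _ := by ring
  calc (8 / η ^ 2 + 2) * W ^ 2 + 2 * D * (V * E + 2 * η * τ * κ ^ 2)
      ≤ (8 / η ^ 2 + 2) * (2 * H ^ 2 * (2 + K) * R * l)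
        + 2 * D * (V * (c * (R + Q)) + 2 * η * R * κ ^ 2) := by gcongr
    _ = (8 / η ^ 2 + 2) * (2 * H ^ 2 * (2 + K) * R * l)
        + 2 * (V * c * (D * R + D * Q) + 2 * η * κ ^ 2 * (D * R)) := by ring
    _ ≤ (8 / η ^ 2 + 2) * (2 * H ^ 2 * (2 + K) * R * l)
        + 2 * (V * c * ((2 * a₀ + a₁ * c₂) * R * l + (a₀ + a₁) * K * R * l)
          + 2 * η * κ ^ 2 * ((2 * a₀ + a₁ * c₂) * R * l)) := by gcongr
    _ = _ := by ring

/-- The step size condition of the theorem is stronger than the one used for the recursion. -/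
lemma mul_le_one_of_lt_stepBound {C lam θ η κ : ℝ} (hκ : κ = Real.sqrt (4 + 2 * C ^ 2))
    (hlam : 0 < lam) (hθ : 1 / 2 < θ) (hθ1 : θ < 1) (hη : η < stepBound C lam θ) :
    η * (lam + 2 * κ ^ 2) ≤ 1 := by
  have hκ0 : 0 ≤ κ := hκ ▸ Real.sqrt_nonneg _
  have h2 : (2 : ℝ) ^ (θ - 1) < 1 :=
    Real.rpow_lt_one_of_one_lt_of_neg (by norm_num) (by linarith)
  have h20 : (0 : ℝ) < 2 ^ (θ - 1) := by positivity
  have hden0 : 0 < (1 - (2 : ℝ) ^ (θ - 1)) * (2 * θ - 1) :=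
    mul_pos (by linarith) (by linarith)
  have hden1 : (1 - (2 : ℝ) ^ (θ - 1)) * (2 * θ - 1) ≤ 1 :=
    mul_le_one₀ (by linarith) (by linarith) (by linarith)
  have hlog : 1 ≤ Real.log (8 / (1 - θ)) + 1 / (1 - θ) := by
    have h3 : 0 ≤ Real.log (8 / (1 - θ)) :=
      Real.log_nonneg ((one_le_div (by linarith)).2 (by linarith))
    have h4 : 1 ≤ 1 / (1 - θ) := (one_le_div (by linarith)).2 (by linarith)
    linarith
  have hbig : 2 * κ ^ 2 ≤ 208 * (1 + κ) ^ 4 / ((1 - 2 ^ (θ - 1)) * (2 * θ - 1))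
      * (Real.log (8 / (1 - θ)) + 1 / (1 - θ)) := by
    have h5 : 2 * κ ^ 2 ≤ 208 * (1 + κ) ^ 4 := by
      have : κ ^ 2 ≤ (1 + κ) ^ 4 := by
        calc κ ^ 2 ≤ (1 + κ) ^ 2 := by gcongr; linarith
          _ ≤ (1 + κ) ^ 4 := pow_le_pow_right₀ (by linarith) (by norm_num)
      nlinarith [pow_nonneg (by linarith : 0 ≤ 1 + κ) 4]
    have h6 : 208 * (1 + κ) ^ 4 ≤ 208 * (1 + κ) ^ 4 / ((1 - 2 ^ (θ - 1)) * (2 * θ - 1)) :=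
      le_div_self (by positivity) hden0 hden1
    exact (h5.trans h6).trans (le_mul_of_one_le_right (h5.trans h6 |>.trans' (by positivity)) hlog)
  have hpos : 0 < lam + 2 * κ ^ 2 := by positivity
  have : η ≤ (lam + 2 * κ ^ 2)⁻¹ := by
    refine hη.le.trans ?_
    rw [stepBound, ← hκ]
    gcongr
  calc η * (lam + 2 * κ ^ 2) ≤ (lam + 2 * κ ^ 2)⁻¹ * (lam + 2 * κ ^ 2) := by gcongr
    _ = 1 := inv_mul_cancel₀ (ne_of_gt hpos)

/-- Effective dimension of a polynomially decaying spectrum. -/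
lemma exists_effectiveDim_le {μ : ℕ → ℝ} {β r : ℝ} (hμ0 : ∀ i, 0 ≤ μ i) (hβ : 1 < β)
    (hcap : PolynomialDecay μ β) (hr : 1 / 2 < r) (hrβ : r < 1 - 1 / (2 * β)) :
    ∃ S : ℝ, 0 ≤ S ∧ ∀ lam, 0 < lam → ∃ N,
      HasSum (fun i => (μ i / (μ i + lam)) ^ 2) N ∧ lam ^ 2 * N ≤ S * lam ^ (2 * r) := by
  obtain ⟨b, -, c, hc, hb⟩ := hcap
  -- An interpolation exponent: the ridge filter is at most 1 and s ≤ 2, so its square is at most (μ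
  -- i / lam) ^ s, and lam² lam^(-s) = lam^(2r). The series of μ i ^ s converges because β s > 1,
  -- which is the condition r < 1 - 1/(2β).
  set s := 2 - 2 * r with hs
  have hβ0 : 0 < β := by linarith
  have hs0 : 0 < s := by
    have : 0 < 1 / (2 * β) := by positivity
    rw [hs]; linarith
  have hβs : 1 < β * s := by
    have h1 : 1 / β < s := by
      have : 1 / β = 2 * (1 / (2 * β)) := by field_simp
      rw [hs, this]; linarith
    rw [div_lt_iff₀ hβ0] at h1
    linarith
  have hsum : Summable fun i => μ i ^ s := by
    have h1 : Summable fun i : ℕ => c ^ s * ((i : ℝ) + 1) ^ (-(β * s)) := by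
      refine Summable.mul_left _ ?_
      have := (summable_nat_add_iff 1).2 (Real.summable_nat_rpow.2 (by linarith : -(β * s) < -1))
      simpa using this
    refine Summable.of_nonneg_of_le (fun i => Real.rpow_nonneg (hμ0 i) _) (fun i => ?_) h1
    calc μ i ^ s ≤ (c * ((i : ℝ) + 1) ^ (-β)) ^ s :=
          Real.rpow_le_rpow (hμ0 i) (hb i).2 hs0.le
      _ = _ := by
        rw [Real.mul_rpow hc.le (by positivity), ← Real.rpow_mul (by positivity), neg_mul]
  refine ⟨∑' i, μ i ^ s, tsum_nonneg fun i => Real.rpow_nonneg (hμ0 i) _, fun lam hlam => ?_⟩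
  have hterm : ∀ i, (μ i / (μ i + lam)) ^ 2 ≤ lam ^ (-s) * μ i ^ s := by
    intro i
    have hpos : 0 < μ i + lam := by linarith [hμ0 i]
    have h0 : 0 ≤ μ i / (μ i + lam) := div_nonneg (hμ0 i) hpos.le
    have h1 : μ i / (μ i + lam) ≤ 1 := (div_le_one hpos).2 (by linarith)
    calc (μ i / (μ i + lam)) ^ 2 = (μ i / (μ i + lam)) ^ (2 : ℝ) := by norm_cast
      _ ≤ (μ i / (μ i + lam)) ^ s :=
        Real.rpow_le_rpow_of_exponent_ge_of_imp h0 h1 (by rw [hs]; linarith)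
          (fun _ h => absurd h two_ne_zero)
      _ ≤ (μ i / lam) ^ s := by
        refine Real.rpow_le_rpow h0 ?_ hs0.le
        exact div_le_div_of_nonneg_left (hμ0 i) hlam (by linarith [hμ0 i])
      _ = _ := by
        rw [Real.div_rpow (hμ0 i) hlam.le, Real.rpow_neg hlam.le]; ring
  have hsN : Summable fun i => (μ i / (μ i + lam)) ^ 2 :=
    Summable.of_nonneg_of_le (fun i => sq_nonneg _) hterm (hsum.mul_left _)
  refine ⟨_, hsN.hasSum, ?_⟩
  calc lam ^ 2 * ∑' i, (μ i / (μ i + lam)) ^ 2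
      ≤ lam ^ 2 * (lam ^ (-s) * ∑' i, μ i ^ s) := by
        gcongr
        rw [← tsum_mul_left]
        exact hsN.tsum_le_tsum hterm (hsum.mul_left _)
    _ = (∑' i, μ i ^ s) * (lam ^ (2 : ℝ) * lam ^ (-s)) := by norm_cast; ring
    _ = _ := by
      rw [← Real.rpow_add hlam]; congr 2; rw [hs]; ring

end Rates


/-! ### The combined bound -/

section MainBound

variable {d : ℕ} {σ : ℝ → ℝ} {Cσ γ : ℝ}

set_option maxHeartbeats 800000 in
/-- The error bound with rate `lam ^ (2 * r)`, given a bound `hE` for the accumulated noise. -/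
theorem exists_expectedExcessRisk_bound (hd : 1 ≤ d) (hσ : IsActivation σ Cσ)
    (hγ : γ ∈ Set.Icc (0 : ℝ) 1) {ρ : Measure (Inp d × ℝ)} [IsProbabilityMeasure ρ]
    (hX : ∀ᵐ x ∂ρ.fst, ‖x‖ ≤ 1) (hY : ∀ᵐ z ∂ρ, |z.2| ≤ 1)
    {μ : ℕ → ℝ} {φ : ℕ → Lp ℝ 2 ρ.fst} (hμφ : IsEigensystem (ntk σ 1 γ) ρ.fst μ φ)
    {r : ℝ} (hr : 1 / 2 < r) (hr1 : r ≤ 1) (hsource : InPowRange μ φ r (regression ρ))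
    {η : ℝ} (hη : 0 < η) {θ κ c : ℝ} (hθ : θ = 2 * r / (2 * r + 1))
    (hκ : κ = Real.sqrt (4 + 2 * Cσ ^ 2)) (hc : 0 ≤ c) :
    ∃ C : ℝ, 0 < C ∧ ∀ T : ℕ, 1 ≤ T → ∀ lam : ℝ, (T : ℝ) ^ (-(1 / (2 * r + 1))) ≤ lam →
      lam ≤ 1 → η < stepBound Cσ lam θ →
      (∀ E Q : ℝ, 0 ≤ Q → E ≤ κ ^ 4 * Real.exp (-lam * (η * (T : ℝ) ^ (1 - θ))) →
        (∀ N, HasSum (fun i => (μ i / (μ i + lam)) ^ 2) N → (T : ℝ) ^ (1 - θ) = 1 / lam →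
          E ≤ 2 / η ^ 2 * lam ^ 2 * (2 * N + 2 * Q / lam ^ 2)) →
        E ≤ c * (lam ^ (2 * r) + Q)) →
      ∀ m : ℕ, (T : ℝ) ^ (1 + 5 / (2 * r + 1)) ≤ ((2 * m : ℕ) : ℝ) →
      ∀ δ : ℝ, 0 < δ → δ < 1 →
        ENNReal.ofReal (1 - δ) ≤ initLaw d m
          {w | expectedExcessRisk σ γ 1 lam η θ ρ T w ≤
            ENNReal.ofReal (C * lam ^ (2 * r) * Real.log (2 / δ))} := by
  obtain ⟨h, F, hF, hFreg⟩ := hsource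
  have h2r : 0 < 2 * r + 1 := by linarith
  have hθ0 : 1 / 2 < θ := by rw [hθ, lt_div_iff₀ h2r]; linarith
  have hθ00 : 0 ≤ θ := by linarith
  have hθ1 : θ < 1 := by rw [hθ, div_lt_one h2r]; linarith
  have hθ' : 1 - θ = 1 / (2 * r + 1) := by rw [hθ]; field_simp; ring
  have hC0 := hσ.pos
  have hκ0 : 0 ≤ κ := hκ ▸ Real.sqrt_nonneg _
  have hκ2 : κ ^ 2 = 4 + 2 * Cσ ^ 2 := by rw [hκ, Real.sq_sqrt (by positivity)]
  have hregle := ae_abs_regression_le hY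
  have hF1 : ‖F‖ ≤ 1 := by
    have h1 : ‖F‖ ^ 2 ≤ 1 := by
      rw [norm_sq_Lp_two]
      calc ∫ x, F x ^ 2 ∂ρ.fst ≤ ∫ _, (1 : ℝ) ∂ρ.fst := by
            refine integral_mono_of_nonneg (.of_forall fun _ => sq_nonneg _)
              (integrable_const _) ?_
            filter_upwards [hFreg, hregle] with x hx hx1
            rw [hx]
            exact (sq_le_one_iff_abs_le_one _).2 hx1
        _ = 1 := by simp
    exact (sq_le_one_iff₀ (norm_nonneg _)).1 h1
  obtain ⟨V, hV0, hV⟩ := exists_sum_stepSize_sq_le η hθ0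
  obtain ⟨c₁, hc₁⟩ : ∃ t : ℝ, t = 4 * Cσ * (8 * κ + 32 * Cσ + 2) := ⟨_, rfl⟩
  have hc₁0 : 0 ≤ c₁ := by rw [hc₁]; positivity
  -- Beyond T₀ one has c₁ ≤ √T, as the comparison with the linearization requires; up to T₀ the
  -- crude bound B₀ is enough.
  obtain ⟨T₀, hT₀⟩ := exists_nat_ge (c₁ ^ 2)
  obtain ⟨B₀, hB₀, hB⟩ := exists_network_sgd_bound hσ hγ hη.le hθ00 d T₀
  obtain ⟨c₂, hc₂⟩ : ∃ t : ℝ, t = 16 * Cσ + κ * c₁ := ⟨_, rfl⟩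
  have hc₂0 : 0 ≤ c₂ := by rw [hc₂]; positivity
  -- From the deviation 4 κ⁴ l / m and 1 / m ≤ 2 lam⁵.
  obtain ⟨K, hK⟩ : ∃ t : ℝ, t = 8 * κ ^ 4 := ⟨_, rfl⟩
  have hK0 : 0 ≤ K := by rw [hK]; positivity
  have hM0 : 0 ≤ μ 0 ^ (2 * r - 1) := Real.rpow_nonneg (hμφ.nonneg 0) _
  obtain ⟨C₁, hC₁⟩ : ∃ t : ℝ, t = (8 / η ^ 2 + 2) * (2 * ‖h‖ ^ 2 * (2 + K))
        + 2 * (V * c * ((2 * (2 + 16 * κ ^ 4 * V)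
              + (8 * κ ^ 2 + 16 * κ ^ 6 * V) * (4 * ‖h‖ ^ 2 * (μ 0 ^ (2 * r - 1) + 1 + K)))
            + (2 + 16 * κ ^ 4 * V + (8 * κ ^ 2 + 16 * κ ^ 6 * V)) * K)
          + 2 * η * κ ^ 2 * (2 * (2 + 16 * κ ^ 4 * V)
              + (8 * κ ^ 2 + 16 * κ ^ 6 * V) * (4 * ‖h‖ ^ 2 * (μ 0 ^ (2 * r - 1) + 1 + K)))) := ⟨_, rfl⟩
  have hC₁0 : 0 ≤ C₁ := by rw [hC₁]; positivity
  refine ⟨2 * (B₀ + 1) ^ 2 * (T₀ + 1) + 4 * c₂ ^ 2 + 2 * C₁, by positivity, ?_⟩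
  intro T hT lam hlamT hlam1 hηb hE m hmT δ hδ hδ1
  have hT1 : (1 : ℝ) ≤ T := by exact_mod_cast hT
  have hT0 : (0 : ℝ) < T := by linarith
  have hlam : 0 < lam := lt_of_lt_of_le (by positivity) hlamT
  have hηl : η * (lam + 2 * κ ^ 2) ≤ 1 := mul_le_one_of_lt_stepBound hκ hlam hθ0 hθ1 hηb
  have hηl1 : η * (lam + κ ^ 2) ≤ 1 := le_trans (by gcongr; nlinarith) hηl
  have hηl0 : η * lam ≤ 1 := le_trans (by gcongr; nlinarith) hηl
  obtain ⟨l, hl⟩ : ∃ t : ℝ, t = Real.log (2 / δ) := ⟨_, rfl⟩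
  -- As log 2 > 1/2, constant terms can be absorbed into multiples of l.
  have hl2 : 1 / 2 ≤ l := by
    have h1 : Real.log 2 ≤ l := by
      rw [hl]
      apply Real.log_le_log (by norm_num)
      rw [le_div_iff₀ hδ]; linarith
    linarith [Real.log_two_gt_d9]
  have hTm : (T : ℝ) ≤ 2 * m * lam ^ 5 := by
    have h5 : (T : ℝ) ^ (-(5 / (2 * r + 1))) ≤ lam ^ 5 := by
      calc (T : ℝ) ^ (-(5 / (2 * r + 1))) = ((T : ℝ) ^ (-(1 / (2 * r + 1)))) ^ 5 := by
            rw [← Real.rpow_natCast, ← Real.rpow_mul hT0.le]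
            congr 1
            push_cast
            ring
        _ ≤ lam ^ 5 := by gcongr
    push_cast at hmT
    calc (T : ℝ) = (T : ℝ) ^ (1 + 5 / (2 * r + 1)) * (T : ℝ) ^ (-(5 / (2 * r + 1))) := by
          rw [← Real.rpow_add hT0]; simp
      _ ≤ 2 * m * lam ^ 5 := by gcongr
  have hm : 1 ≤ m := by
    by_contra hm
    have : m = 0 := by omega
    subst this
    simp at hTm
    linarith
  have hm0 : (0 : ℝ) < m := by exact_mod_cast hm
  obtain ⟨R, hR⟩ : ∃ t : ℝ, t = lam ^ (2 * r) := ⟨_, rfl⟩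
  -- The choice of θ balances the late noise against the bias: equality holds when lam =
  -- T^(-1/(2r+1)).
  have hTR : (T : ℝ) ^ (-θ) ≤ R := by
    calc (T : ℝ) ^ (-θ) = ((T : ℝ) ^ (-(1 / (2 * r + 1)))) ^ (2 * r) := by
          rw [← Real.rpow_mul hT0.le, hθ]
          congr 1
          ring
      _ ≤ R := by
        rw [hR]; exact Real.rpow_le_rpow (by positivity) hlamT (by linarith)
  have hTR1 : 1 / (T : ℝ) ≤ R := by
    refine le_trans ?_ hTR
    rw [one_div, ← Real.rpow_neg_one]
    exact Real.rpow_le_rpow_of_exponent_le hT1 (by linarith)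
  have hR0 : 0 ≤ R := by rw [hR]; positivity
  refine ofReal_one_sub_le_initLaw hd hσ hγ hX hm hδ fun w hw hQw => ?_
  obtain ⟨Q, hQ⟩ : ∃ t : ℝ, t = K * l * lam ^ 5 := ⟨_, rfl⟩
  have hQ0 : 0 ≤ Q := by rw [hQ]; positivity
  have hQle : ∫ q, (ntk σ 1 γ q.1 q.2
      - inner ℝ (initFeature σ γ w q.1) (initFeature σ γ w q.2)) ^ 2
        ∂(ρ.fst.prod ρ.fst) ≤ Q := by
    refine hQw.trans ?_
    rw [← hκ2, ← hl, div_le_iff₀ hm0, hQ, hK]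
    have h1 : 1 ≤ 2 * m * lam ^ 5 := hT1.trans hTm
    calc 4 * (κ ^ 2) ^ 2 * l = 4 * κ ^ 4 * l * 1 := by ring
      _ ≤ 4 * κ ^ 4 * l * (2 * m * lam ^ 5) := by gcongr
      _ = _ := by ring
  have hzX : ∀ᵐ z ∂(Measure.pi fun _ : Fin T => ρ), ∀ i, ‖(z i).1‖ ≤ 1 :=
    ae_pi_of_ae (P := fun z : Inp d × ℝ => ‖z.1‖ ≤ 1) (ae_of_ae_map measurable_fst.aemeasurable hX) T
  have hzY : ∀ᵐ z ∂(Measure.pi fun _ : Fin T => ρ), ∀ i, |(z i).2| ≤ 1 :=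
    ae_pi_of_ae (P := fun z : Inp d × ℝ => |z.2| ≤ 1) hY T
  rw [Set.mem_ofPred_eq, ← hl, ← hR]
  by_cases hTT : T ≤ T₀
  · calc expectedExcessRisk σ γ 1 lam η θ ρ T w
        ≤ ∫⁻ _, ENNReal.ofReal ((B₀ + 1) ^ 2) ∂(Measure.pi fun _ : Fin T => ρ) := by
          refine lintegral_mono_ae ?_
          filter_upwards [hzX, hzY] with z hz1 hz2
          refine excessRisk_le_of_abs_sub_le (by positivity) ?_
          filter_upwards [hX, hregle] with x hx hx1
          exact (abs_sub _ _).trans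
            (add_le_add (hB m hm w hw lam hlam.le hηl0 T hTT z hz1 hz2 x hx) hx1)
      _ = ENNReal.ofReal ((B₀ + 1) ^ 2) := by simp
      _ ≤ _ := by
        apply ENNReal.ofReal_le_ofReal
        -- For bounded T the target rate is bounded below, so a constant bound on the risk already
        -- has the required form.
        have h1 : 1 ≤ (T₀ + 1 : ℝ) * R := by
          have h2 : (T : ℝ) ≤ T₀ + 1 := by
            have : (T : ℝ) ≤ T₀ := by exact_mod_cast hTT
            linarith
          calc (1 : ℝ) = T * (1 / T) := by field_simp
            _ ≤ _ := by gcongr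
        have h3 : 1 ≤ (T₀ + 1 : ℝ) * R * (2 * l) :=
          one_le_mul_of_one_le_of_one_le h1 (by linarith)
        calc (B₀ + 1) ^ 2 ≤ (B₀ + 1) ^ 2 * ((T₀ + 1 : ℝ) * R * (2 * l)) :=
              le_mul_of_one_le_right (by positivity) h3
          _ = (2 * (B₀ + 1) ^ 2 * (T₀ + 1)) * R * l := by ring
          _ ≤ _ := by
            gcongr
            nlinarith [sq_nonneg c₂]
  · have hcT : c₁ ≤ Real.sqrt T := by
      refine Real.le_sqrt_of_sq_le (hT₀.trans ?_)
      exact_mod_cast (not_le.1 hTT).le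
    have hΦκ : ∀ x : Inp d, ‖x‖ ≤ 1 → ‖initFeature σ γ w x‖ ≤ κ := fun x hx => by
      rw [hκ]; exact norm_initFeature_le hσ hγ hm hw hx
    have hΦm := measurable_initFeature (γ := γ) hσ w
    have hreg : ∀ u, ∫ z, z.2 * inner ℝ (initFeature σ γ w z.1) u ∂ρ
        = ∫ x, F x * inner ℝ (initFeature σ γ w x) u ∂ρ.fst := by
      intro u
      rw [integral_label_mul (f := fun x => inner ℝ (initFeature σ γ w x) u) (B := κ * ‖u‖) hY
        (hΦm.inner_const)]
      · refine integral_congr_ae ?_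
        filter_upwards [hFreg] with x hx
        rw [hx]
      · filter_upwards [hX] with x hx
        exact (abs_real_inner_le_norm _ _).trans (by gcongr; exact hΦκ x hx)
    have hkb : IsBoundedKernel (ntk σ 1 γ) (fun x : Inp d => ‖x‖ ≤ 1) (κ ^ 2) := by
      rw [hκ]; exact isBoundedKernel_ntk hd hσ hγ
    obtain ⟨A, W, U, E, hA, hW0, hW, hU0, hU1, hU, -, hE1, hE2, hint, hle⟩ :=
      linSgd_excess_le hΦm hX hΦκ hY hkb ntk_symm hμφ.antitone hμφ.nonneg hμφ.orthonormal
        hμφ.eigen hμφ.complete hr.le hr1 hF hF1 hreg hQle hη hθ00 hθ1.le hT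
        (by rwa [hθ']) hηl hV
    have hfin := linear_error_le (κ := κ) hr.le hr1 hlam hlam1 hl2 hK0 hQ hM0
      hV0 hη hc hW0 hW hU0 hU1 hU (hE E Q hQ0 hE1 hE2) (hR ▸ hTR)
    have hD := hle.trans hfin
    rw [← hC₁, ← hR] at hD
    calc expectedExcessRisk σ γ 1 lam η θ ρ T w
        ≤ ∫⁻ z, ENNReal.ofReal (2 * (c₂ / Real.sqrt T) ^ 2
            + 2 * ‖A (linSgd (initFeature σ γ w) lam (stepSize η θ) T z) - F‖ ^ 2)
            ∂(Measure.pi fun _ : Fin T => ρ) := by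
          refine lintegral_mono_ae ?_
          filter_upwards [hzX, hzY] with z hz1 hz2
          refine excessRisk_le_add hFreg (continuous_network hσ _) (by positivity) ?_
          filter_upwards [hX, hA (linSgd (initFeature σ γ w) lam (stepSize η θ) T z)]
            with x hx hAx
          rw [hAx, hc₂]
          exact abs_network_sgd_sub_linear_le hσ hγ hm hw hκ hc₁ hlam hlam1 hη.le hθ00
            hηl1 hT hcT hTm hz1 hz2 hx
      _ = ENNReal.ofReal (∫ z, (2 * (c₂ / Real.sqrt T) ^ 2
            + 2 * ‖A (linSgd (initFeature σ γ w) lam (stepSize η θ) T z) - F‖ ^ 2)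
            ∂(Measure.pi fun _ : Fin T => ρ)) := by
          rw [ofReal_integral_eq_lintegral_ofReal]
          · exact (integrable_const _).add (hint.const_mul 2)
          · exact .of_forall fun z => by positivity
      _ ≤ _ := by
        apply ENNReal.ofReal_le_ofReal
        rw [integral_add (integrable_const _) (hint.const_mul 2), integral_const, integral_const_mul,
          probReal_univ, one_smul, div_pow, Real.sq_sqrt hT0.le]
        have h1 : 2 * (c₂ ^ 2 / T) ≤ 4 * c₂ ^ 2 * R * l := by
          calc 2 * (c₂ ^ 2 / T) = 2 * c₂ ^ 2 * (1 / T) * 1 := by ring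
            _ ≤ 2 * c₂ ^ 2 * R * (2 * l) :=
              mul_le_mul (mul_le_mul_of_nonneg_left hTR1 (by positivity)) (by linarith) zero_le_one
                (by positivity)
            _ = _ := by ring
        calc _ ≤ 4 * c₂ ^ 2 * R * l + 2 * (C₁ * R * l) :=
              add_le_add h1 (mul_le_mul_of_nonneg_left hD zero_le_two)
          _ = (0 + 4 * c₂ ^ 2 + 2 * C₁) * R * l := by ring
          _ ≤ _ := by
            gcongr
            positivity

end MainBound

end TwoLayerSGD

end

/-! ### The two choices of the regularization parameter -/

theorem corollary1 (d : ℕ) (hd : 1 ≤ d)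
    (σ : ℝ → ℝ) (Cσ : ℝ) (hσ : TwoLayerSGD.IsActivation σ Cσ)
    (γ : ℝ) (hγ : γ ∈ Set.Icc (0 : ℝ) 1)
    (ρ : Measure (TwoLayerSGD.Inp d × ℝ)) [IsProbabilityMeasure ρ]
    (hX : ρ.fst.support = Metric.closedBall (0 : TwoLayerSGD.Inp d) 1)
    (hY : ∀ᵐ z ∂ρ, z.2 ∈ Set.Icc (-1 : ℝ) 1)
    (μ : ℕ → ℝ) (φ : ℕ → Lp ℝ 2 ρ.fst)
    (hμφ : TwoLayerSGD.IsEigensystem (TwoLayerSGD.ntk σ 1 γ) ρ.fst μ φ)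
    (r : ℝ) (hr : 1 / 2 < r) (hr1 : r ≤ 1)
    (hsource : TwoLayerSGD.InPowRange μ φ r (TwoLayerSGD.regression ρ))
    (β : ℝ) (hβ : 1 < β) (hcap : TwoLayerSGD.PolynomialDecay μ β)
    (η : ℝ) (hη : 0 < η) :
    (r < 1 - 1 / (2 * β) →
      ∃ C : ℝ, 0 < C ∧ ∀ T : ℕ, 1 ≤ T → ∀ lam : ℝ, lam = (T : ℝ) ^ (-(1 / (2 * r + 1))) →
        η < TwoLayerSGD.stepBound Cσ lam (2 * r / (2 * r + 1)) →
        ∀ m : ℕ, (T : ℝ) ^ (1 + 5 / (2 * r + 1)) ≤ ((2 * m : ℕ) : ℝ) →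
        ∀ δ : ℝ, 0 < δ → δ < 1 →
          ENNReal.ofReal (1 - δ) ≤ TwoLayerSGD.initLaw d m
            {w | TwoLayerSGD.expectedExcessRisk σ γ 1 lam η (2 * r / (2 * r + 1)) ρ T w ≤
              ENNReal.ofReal (C * (T : ℝ) ^ (-(2 * r / (2 * r + 1))) * Real.log (2 / δ))}) ∧
    (1 - 1 / (2 * β) ≤ r → ∀ ε : ℝ, 0 < ε → ε < 2 * r / (2 * r + 1) →
      ∃ C : ℝ, 0 < C ∧ ∀ T : ℕ, 1 ≤ T →
        ∀ lam : ℝ, lam = (T : ℝ) ^ (-(1 / (2 * r + 1)) + ε / (2 * r)) →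
        η < TwoLayerSGD.stepBound Cσ lam (2 * r / (2 * r + 1)) →
        ∀ m : ℕ, (T : ℝ) ^ (1 + 5 / (2 * r + 1)) ≤ ((2 * m : ℕ) : ℝ) →
        ∀ δ : ℝ, 0 < δ → δ < 1 →
          ENNReal.ofReal (1 - δ) ≤ TwoLayerSGD.initLaw d m
            {w | TwoLayerSGD.expectedExcessRisk σ γ 1 lam η (2 * r / (2 * r + 1)) ρ T w ≤
              ENNReal.ofReal
                (C * (T : ℝ) ^ (-(2 * r / (2 * r + 1)) + ε) * Real.log (2 / δ))}) := by
  obtain ⟨κ, hκ⟩ : ∃ t : ℝ, t = Real.sqrt (4 + 2 * Cσ ^ 2) := ⟨_, rfl⟩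
  obtain ⟨θ, hθ⟩ : ∃ t : ℝ, t = 2 * r / (2 * r + 1) := ⟨_, rfl⟩
  have hX' : ∀ᵐ x ∂ρ.fst, ‖x‖ ≤ 1 := by
    have h : ρ.fst.support ∈ ae ρ.fst := Measure.support_mem_ae
    rw [hX] at h
    filter_upwards [h] with x hx
    simpa using hx
  have hY' : ∀ᵐ z ∂ρ, |z.2| ≤ 1 := by
    filter_upwards [hY] with z hz
    exact abs_le.2 hz
  have h2r : 0 < 2 * r + 1 := by linarith
  have hr0 : 0 < r := by linarith
  have hθ' : 1 - θ = 1 / (2 * r + 1) := by rw [hθ]; field_simp; ring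
  rw [← hθ]
  refine ⟨fun hrβ => ?_, fun _ ε hε hε1 => ?_⟩
  -- Here lam * T^(1-θ) = 1, so the exponential of -lam η T^(1-θ) does not decay and the early noise
  -- is bounded through the effective dimension.
  · obtain ⟨S, hS0, hS⟩ := TwoLayerSGD.exists_effectiveDim_le hμφ.nonneg hβ hcap hr hrβ
    obtain ⟨C, hC, hbound⟩ := TwoLayerSGD.exists_expectedExcessRisk_bound hd hσ hγ hX' hY' hμφ hr
      hr1 hsource hη hθ hκ (by positivity : 0 ≤ 4 / η ^ 2 * (S + 1))
    refine ⟨C, hC, fun T hT lam hlam hηb m hm δ hδ hδ1 => ?_⟩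
    have hT1 : (1 : ℝ) ≤ T := by exact_mod_cast hT
    have hT0 : (0 : ℝ) < T := by linarith
    have hlam0 : 0 < lam := by rw [hlam]; positivity
    have hlam1 : lam ≤ 1 := by
      rw [hlam]
      exact Real.rpow_le_one_of_one_le_of_nonpos hT1
        (neg_nonpos.2 (one_div_nonneg.2 h2r.le))
    have hrate : lam ^ (2 * r) = (T : ℝ) ^ (-θ) := by
      rw [hlam, ← Real.rpow_mul hT0.le, hθ]
      congr 1
      ring
    rw [← hrate]
    refine hbound T hT lam hlam.ge hlam1 hηb (fun E Q hQ _ hE => ?_) m hm δ hδ hδ1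
    obtain ⟨N, hN, hNle⟩ := hS lam hlam0
    have hTlam : (T : ℝ) ^ (1 - θ) = 1 / lam := by
      rw [hlam, hθ', Real.rpow_neg hT0.le, one_div _⁻¹, inv_inv]
    have hR0 : 0 ≤ lam ^ (2 * r) := by positivity
    calc E ≤ 2 / η ^ 2 * lam ^ 2 * (2 * N + 2 * Q / lam ^ 2) := hE N hN hTlam
      _ = 4 / η ^ 2 * (lam ^ 2 * N + Q) := by field_simp; ring
      _ ≤ 4 / η ^ 2 * ((S + 1) * (lam ^ (2 * r) + Q)) := by
        gcongr
        nlinarith [mul_nonneg hS0 hQ]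
      _ = _ := by ring
  -- Here lam * T^(1-θ) = T^(ε/(2r)), so the exponential alone makes the early noise O(T^(-θ))
  -- without using the eigenvalue decay.
  · have ha : 0 < ε / (2 * r) := by positivity
    obtain ⟨D, hD0, hD⟩ := TwoLayerSGD.exp_neg_mul_rpow_le (θ := θ) hη ha
    obtain ⟨C, hC, hbound⟩ := TwoLayerSGD.exists_expectedExcessRisk_bound hd hσ hγ hX' hY' hμφ hr
      hr1 hsource hη hθ hκ (by positivity : 0 ≤ κ ^ 4 * D)
    refine ⟨C, hC, fun T hT lam hlam hηb m hm δ hδ hδ1 => ?_⟩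
    have hT1 : (1 : ℝ) ≤ T := by exact_mod_cast hT
    have hT0 : (0 : ℝ) < T := by linarith
    -- The restriction on ε keeps the exponent of lam nonpositive, hence lam ≤ 1.
    have hεr : ε / (2 * r) ≤ 1 / (2 * r + 1) := by
      rw [div_le_iff₀ (by positivity)]
      calc ε ≤ 2 * r / (2 * r + 1) := hθ ▸ hε1.le
        _ = _ := by ring
    have hlam1 : lam ≤ 1 := by
      rw [hlam]
      exact Real.rpow_le_one_of_one_le_of_nonpos hT1 (by linarith)
    have hrate : lam ^ (2 * r) = (T : ℝ) ^ (-θ + ε) := by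
      rw [hlam, ← Real.rpow_mul hT0.le, hθ]
      congr 1
      field_simp
    have hlamT : (T : ℝ) ^ (-(1 / (2 * r + 1))) ≤ lam := by
      rw [hlam]
      exact Real.rpow_le_rpow_of_exponent_le hT1 (by linarith)
    rw [← hrate]
    refine hbound T hT lam hlamT hlam1 hηb (fun E Q hQ hE _ => ?_) m hm δ hδ hδ1
    have hexp : -lam * (η * (T : ℝ) ^ (1 - θ)) = -(η * (T : ℝ) ^ (ε / (2 * r))) := by
      have h : lam * (T : ℝ) ^ (1 - θ) = (T : ℝ) ^ (ε / (2 * r)) := by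
        rw [hlam, hθ', ← Real.rpow_add hT0]
        congr 1
        ring
      rw [← h]
      ring
    calc E ≤ κ ^ 4 * Real.exp (-lam * (η * (T : ℝ) ^ (1 - θ))) := hE
      _ ≤ κ ^ 4 * (D * (T : ℝ) ^ (-θ)) := by
        rw [hexp]
        gcongr
        exact hD T hT1
      _ ≤ κ ^ 4 * (D * lam ^ (2 * r)) := by
        rw [hrate]
        gcongr
        linarith
      _ ≤ κ ^ 4 * (D * (lam ^ (2 * r) + Q)) := by
        gcongr
        linarith
      _ = _ := by ring
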